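/- **Setting.** For $-\infty\le\kappa_1<\kappa_2\le+\infty$ put $\rho_i=\operatorname{arccot}\kappa_i\in[0,\pi]$, with $\operatorname{arccot}(+\infty)=0$ and $\operatorname{arccot}(-\infty)=\pi$. Let $h(t)=t-t^{-1}$, a diffeomorphism $(0,+\infty)\to\mathbf R$, and let $h_{\kappa_1,\kappa_2}:(\kappa_1,\kappa_2)\to\mathbf R$ be the diffeomorphism equal to $(\kappa_1-t)^{-1}+(\kappa_2-t)^{-1}$ if both bounds are finite, $t+(\kappa_2-t)^{-1}$ if only $\kappa_1$ is infinite, $t+(\kappa_1-t)^{-1}$ if only $\kappa_2$ is infinite, and $t$ if both are infinite. A curve $\gamma:[0,1]\to\mathbf S^2$ is *$(\kappa_1,\kappa_2)$-admissible* if there are $Q_0\in\mathbf{SO}_3$ and $(\hat v,\hat w)\in L^2[0,1]\times L^2[0,1]$ such that $\gamma=\Phi e_1$, where $\Phi:[0,1]\to\mathbf{SO}_3$ is the (absolutely continuous) solution of $$\dot\Phi=\Phi\begin{pmatrix}0&-v&0\\ v&0&-w\\ 0&w&0\end{pmatrix},\qquad \Phi(0)=Q_0,\qquad v=h^{-1}(\hat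 v),\quad w=v\,h_{\kappa_1,\kappa_2}^{-1}(\hat w).$$ Then $\Phi=\Phi_\gamma$ is the frame of $\gamma$ (position, unit tangent, unit normal), $v$ is the speed and $\kappa=w/v\in(\kappa_1,\kappa_2)$ is the geodesic curvature (defined a.e.). Identify $\gamma$ with $(Q_0,\hat v,\hat w)$, and give the set of admissible curves the topology of $\mathbf{SO}_3\times L^2[0,1]\times L^2[0,1]$. Let $\mathcal L_{\kappa_1}^{\kappa_2}$ be the subspace of those $\gamma$ with $\Phi_\gamma(0)=\Phi_\gamma(1)$, and $\mathcal L_{\kappa_1}^{\kappa_2}(I)$ the subspace of those with $\Phi_\gamma(0)=\Phi_\gamma(1)=I$. A *circle traversed $j$ times* is a curve in the space considered of the form $t\mapsto P\,(\sin\rho\cos\varphi(t),\ \sin\rho\sin\varphi(t),\ \cos\rho)$ with $P\in\mathbf{SO}_3$, $\rho\in(0,\pi)$ and $\varphi:[0,1]\to[0,2\pi j]$ an increasing homeomorphism. **Theorem D.** Let $-\infty\le\kappa_1<\kappa_2\le+\infty$, let $k\ge1$ be an integer, and let $\sigma_k,\sigma_{k+2}\in\mathcal L_{\kappa_1}^{\kappa_2}(I)$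 (resp. $\mathcal L_{\kappa_1}^{\kappa_2}$) be any circles traversed $k$ and $k+2$ times, respectively. Then $\sigma_k$ and $\sigma_{k+2}$ lie in the same connected component of $\mathcal L_{\kappa_1}^{\kappa_2}(I)$ (resp. $\mathcal L_{\kappa_1}^{\kappa_2}$) if and only if $$k\ \ge\ \left\lfloor\frac{\pi}{\rho_1-\rho_2}\right\rfloor .$$ -/

import Mathlib

open MeasureTheory

noncomputable section

namespace SphereCurves

/-- The inverse cotangent on `[-∞, +∞]`, with values in `[0, π]`;
`arccot (+∞) = 0` and `arccot (-∞) = π`. -/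
def arccot (κ : EReal) : ℝ :=
  if κ = ⊤ then 0 else if κ = ⊥ then Real.pi else Real.pi / 2 - Real.arctan κ.toReal

/-- The group `SO₃` of rotations of `ℝ³`, with the topology of the space of matrices. -/
abbrev SO3 : Type := Matrix.specialOrthogonalGroup (Fin 3) ℝ

/-- The unit sphere in Euclidean three-space. -/
abbrev S2 : Type := Metric.sphere (0 : EuclideanSpace ℝ (Fin 3)) 1

/-- The Hilbert space `L²[0, 1]` of real functions on the unit interval. -/
abbrev L2I : Type := Lp ℝ 2 (volume : Measure unitInterval)

/-- The open interval `(κ₁, κ₂)` of real numbers, where the bounds may be infinite. -/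
def curvInterval (κ₁ κ₂ : EReal) : Set ℝ := {t : ℝ | κ₁ < (t : EReal) ∧ (t : EReal) < κ₂}

/-- The diffeomorphism `t ↦ t - t⁻¹` from `(0, +∞)` onto `ℝ`. -/
def hSpeed (t : ℝ) : ℝ := t - t⁻¹

/-- The diffeomorphism from `(κ₁, κ₂)` onto `ℝ` (for `κ₁ < κ₂`, possibly infinite). -/
def hCurv (κ₁ κ₂ : EReal) (t : ℝ) : ℝ :=
  if κ₁ = ⊥ then
    if κ₂ = ⊤ then t else t + (κ₂.toReal - t)⁻¹
  else
    if κ₂ = ⊤ then t + (κ₁.toReal - t)⁻¹ else (κ₁.toReal - t)⁻¹ + (κ₂.toReal - t)⁻¹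

/-- The inverse of the diffeomorphism `hSpeed : (0, +∞) → ℝ`. -/
def hSpeedInv (x : ℝ) : ℝ := Function.invFunOn hSpeed (Set.Ioi 0) x

/-- The inverse of the diffeomorphism `hCurv κ₁ κ₂ : (κ₁, κ₂) → ℝ`. -/
def hCurvInv (κ₁ κ₂ : EReal) (x : ℝ) : ℝ :=
  Function.invFunOn (hCurv κ₁ κ₂) (curvInterval κ₁ κ₂) x

/-- The skew-symmetric matrix with lower diagonal entries `v`, `w`. -/
def logDeriv (v w : ℝ) : Matrix (Fin 3) (Fin 3) ℝ :=
  !![0, -v, 0; v, 0, -w; 0, w, 0]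

/-- A `(κ₁, κ₂)`-admissible curve on the sphere, given through its data `(v̂, ŵ)` in
`L²[0, 1] × L²[0, 1]` and its frame `Φ : [0, 1] → SO₃`, the solution of `Φ' = Φ Λ` (in the
integrated form, that is, in the sense of Carathéodory), where `Λ` has the entries
`v = h⁻¹(v̂)` (the speed) and `w = v κ`, with `κ = h_{κ₁, κ₂}⁻¹(ŵ)` the geodesic curvature.
The entries of `Φ Λ` are always integrable, and `Φ` is determined by `Φ(0)` and `(v̂, ŵ)`. -/
structure AdmissibleCurve (κ₁ κ₂ : EReal) where
  /-- the function `v̂ = h ∘ v` -/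
  vHat : L2I
  /-- the function `ŵ = h_{κ₁, κ₂} ∘ κ` -/
  wHat : L2I
  /-- the frame, with columns the position, the unit tangent and the unit normal vector -/
  frame : C(unitInterval, SO3)
  frame_eq : ∀ (t : unitInterval) (i j : Fin 3),
    (frame t : Matrix (Fin 3) (Fin 3) ℝ) i j =
      (frame 0 : Matrix (Fin 3) (Fin 3) ℝ) i j +
        ∫ s in Set.Iic t,
          ((frame s : Matrix (Fin 3) (Fin 3) ℝ) *
            logDeriv (hSpeedInv (vHat s))
              (hSpeedInv (vHat s) * hCurvInv κ₁ κ₂ (wHat s))) i j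

namespace AdmissibleCurve

variable {κ₁ κ₂ : EReal}

/-- An admissible curve is identified with its initial frame together with the pair `(v̂, ŵ)`;
the topology is that of `SO₃ × L²[0, 1] × L²[0, 1]`. -/
instance : TopologicalSpace (AdmissibleCurve κ₁ κ₂) :=
  TopologicalSpace.induced
    (fun γ : AdmissibleCurve κ₁ κ₂ => (γ.frame 0, γ.vHat, γ.wHat)) inferInstance

theorem norm_first_column (Q : SO3) :
    ‖WithLp.toLp 2 (fun i => (Q : Matrix (Fin 3) (Fin 3) ℝ) i 0)‖ = 1 := by
  have h := (Matrix.mem_specialOrthogonalGroup_iff.mp Q.2).1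
  have h2 := congrFun (congrFun ((Matrix.mem_orthogonalGroup_iff' (Fin 3) ℝ).mp h) 0) 0
  rw [EuclideanSpace.norm_eq, Real.sqrt_eq_one]
  simpa [Matrix.mul_apply, Matrix.star_apply, Fin.sum_univ_three, pow_two] using h2

/-- The curve `γ(t) = Φ(t) e₁` itself. -/
def curve (γ : AdmissibleCurve κ₁ κ₂) (t : unitInterval) : S2 :=
  ⟨WithLp.toLp 2 (fun i => (γ.frame t : Matrix (Fin 3) (Fin 3) ℝ) i 0), by
    rw [mem_sphere_zero_iff_norm]; exact norm_first_column (γ.frame t)⟩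

end AdmissibleCurve

/-- The space of `(κ₁, κ₂)`-admissible curves with initial frame `I` and final frame `Q`. -/
abbrev CurvesTo (κ₁ κ₂ : EReal) (Q : SO3) : Type :=
  {γ : AdmissibleCurve κ₁ κ₂ // γ.frame 0 = 1 ∧ γ.frame 1 = Q}

/-- The space of `(κ₁, κ₂)`-admissible curves whose initial and final frames coincide. -/
abbrev ClosedCurves (κ₁ κ₂ : EReal) : Type :=
  {γ : AdmissibleCurve κ₁ κ₂ // γ.frame 0 = γ.frame 1}

/-- `γ` is a parametrized circle traversed `k` times: up to a rotation `P` of the sphere it runs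
`k` times, without turning back, around the parallel of colatitude `ρ`, counterclockwise as seen
from the north pole. (Clockwise circles are obtained by replacing `P e₃`, `ρ` by
`-P e₃`, `π - ρ`.) -/
def IsCircleTraversed (k : ℕ) (γ : unitInterval → S2) : Prop :=
  ∃ (P : SO3) (ρ : ℝ) (φ : unitInterval → ℝ),
    0 < ρ ∧ ρ < Real.pi ∧ Continuous φ ∧ StrictMono φ ∧ φ 0 = 0 ∧ φ 1 = 2 * Real.pi * k ∧
    ∀ t, ((γ t : EuclideanSpace ℝ (Fin 3)) : Fin 3 → ℝ) =
      Matrix.mulVec (P : Matrix (Fin 3) (Fin 3) ℝ)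
        ![Real.sin ρ * Real.cos (φ t), Real.sin ρ * Real.sin (φ t), Real.cos ρ]

end SphereCurves

end

/-!
The floor condition says `π < (k + 1) (ρ₁ - ρ₂)` (`floor_le_iff`), and the two directions are
proved as follows.

**Separation.** Let `(k + 1) (ρ₁ - ρ₂) ≤ π`. The caustic band of a curve consists of the points at
angles `θ ∈ [ρ₂, ρ₁]` from the position vector towards the normal vector. The curvature bounds say
that its boundary curve at `ρ₂` moves along the tangent and the one at `ρ₁` against it. Consider
the closed curves whose band lies in an open half space `h > 0` and whose tangent turns `k` times
around the direction `h` (`Winds`). The number of turns is an integer that depends continuously on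
the curve and on `h`, so it does not depend on `h` (`Winds.unique`), and the set of these curves
is open (`isOpen_winds`). It is also closed (`isClosed_winds`). In a limit, the band lies in a
closed half space `h ≥ 0`, and `h` can be tilted into an open one unless the points of contact of
the band with the plane `h = 0` have the origin in their convex hull. The longitude of `h` in the
moving frame, as a function of the tangent angle, controls these points (`LuneOscillation`): it
changes sign at each half turn of the tangent, up to an error of `ρ₁ - ρ₂`. As there are only `k`
turns, two contact points cannot be antipodal, and three of them cannot surround the origin,
because the angles `arccos (cos Δ cos Bᵢ)` of a triangle with angles `Bᵢ` add up to at most `π +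
Δ` (`sum_arccos_mul_cos_le`); this is `LuneOscillation.zero_notMem_convexHull`. A circle traversed
`k` times belongs to this clopen set, and one traversed `k + 2` times does not
(`connectedComponent_ne_of_circle`).

**Connection.** Let `π < (k + 1) (ρ₁ - ρ₂)`, and choose two radii `a`, `b` between the bounds with
`a - b = π / (k + 1)`. A circle traversed `k` times consists of `2k` half turns; these remain a
closed curve if their radii are changed in such a way that the last `k` repeat the first `k` in
reverse order, since half turns are involutions. Let the radii alternate between `a` and `b`.
Conjugation by a half turn reflects the axis of a rotation (`half_turn_conj`), and the reflections
by these `k` half turns take the axis at radius `a` or `b` to the one at `b + (k + 1) (a - b) = b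
+ π`, opposite to that at `b` (`exists_reflectAxis_alternating`). Hence two arcs of angle `ω` at
these radii, inserted before the first and before the second group of half turns, are rotations
about opposite axes and cancel (`stepProd_bridge`). Letting `ω` grow from `0` to `2π` and moving
the radii back, one arrives at a circle traversed `k + 2` times (`connectedComponent_eq_add_two`).
Curves of equal constant curvature and equal length are joined by interpolation of their speeds
(`connectedComponent_eq_of_isCircular`), and closed curves are rotated to the initial frame `1`
along paths in the connected group `SO₃` (`exists_rotate_eq`).
-/

noncomputable section

namespace SphereCurves

open Set Filter Topology

section

/-! ### Absolutely continuous functions on the unit interval -/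

/-- `f` is absolutely continuous on `[0, 1]` with derivative `f'` almost everywhere. -/
def HasACDeriv (f f' : ℝ → ℝ) : Prop :=
  AbsolutelyContinuousOnInterval f 0 1 ∧ ∀ᵐ t, t ∈ Ioo (0 : ℝ) 1 → HasDerivAt f (f' t) t

theorem absolutelyContinuous_congr {f g : ℝ → ℝ} {a b : ℝ}
    (hf : AbsolutelyContinuousOnInterval f a b) (h : ∀ t ∈ uIcc a b, g t = f t) :
    AbsolutelyContinuousOnInterval g a b := by
  rw [absolutelyContinuousOnInterval_iff] at hf ⊢
  intro ε hε
  obtain ⟨δ, hδ, H⟩ := hf ε hε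
  refine ⟨δ, hδ, fun E hE hs => ?_⟩
  convert H E hE hs using 1
  refine Finset.sum_congr rfl fun i hi => ?_
  rw [h _ (hE.1 i hi).1, h _ (hE.1 i hi).2]

theorem absolutelyContinuous_comp {f G : ℝ → ℝ} {a b : ℝ}
    (hf : AbsolutelyContinuousOnInterval f a b) (hG : ContDiff ℝ 1 G) :
    AbsolutelyContinuousOnInterval (fun t => G (f t)) a b := by
  obtain ⟨M, hM⟩ := hf.exists_bound
  obtain ⟨K, hK⟩ := (hG.contDiffOn (s := Icc (-M) M)).exists_lipschitzOnWith (by decide)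
    (convex_Icc _ _) isCompact_Icc
  have hmem : ∀ t ∈ uIcc a b, f t ∈ Icc (-M) M := fun t ht => abs_le.1 (hM t ht)
  rw [absolutelyContinuousOnInterval_iff] at hf ⊢
  intro ε hε
  obtain ⟨δ, hδ, H⟩ := hf (ε / (K + 1)) (by positivity)
  refine ⟨δ, hδ, fun E hE hs => ?_⟩
  calc ∑ i ∈ Finset.range E.1, dist (G (f (E.2 i).1)) (G (f (E.2 i).2))
      ≤ ∑ i ∈ Finset.range E.1, K * dist (f (E.2 i).1) (f (E.2 i).2) := by
        refine Finset.sum_le_sum fun i hi => ?_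
        exact hK.dist_le_mul _ (hmem _ (hE.1 i hi).1) _ (hmem _ (hE.1 i hi).2)
    _ = K * ∑ i ∈ Finset.range E.1, dist (f (E.2 i).1) (f (E.2 i).2) := by
        rw [Finset.mul_sum]
    _ ≤ K * (ε / (K + 1)) := by gcongr; exact (H E hE hs).le
    _ < (K + 1) * (ε / (K + 1)) := by gcongr; linarith
    _ = ε := by field_simp

namespace HasACDeriv

variable {f g f' g' : ℝ → ℝ}

theorem continuousOn (hf : HasACDeriv f f') : ContinuousOn f (Icc 0 1) := by
  simpa using hf.1.continuousOn

theorem congr_deriv (hf : HasACDeriv f f') (h : ∀ᵐ t, t ∈ Ioo (0 : ℝ) 1 → f' t = g' t) :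
    HasACDeriv f g' := by
  refine ⟨hf.1, ?_⟩
  filter_upwards [hf.2, h] with t h1 h2 ht
  rw [← h2 ht]; exact h1 ht

theorem congr (hf : HasACDeriv f f') (h : ∀ t ∈ Icc (0 : ℝ) 1, g t = f t) :
    HasACDeriv g f' := by
  refine ⟨absolutelyContinuous_congr hf.1 (by simpa using h), ?_⟩
  filter_upwards [hf.2] with t h1 ht
  refine (h1 ht).congr_of_eventuallyEq ?_
  filter_upwards [Ioo_mem_nhds ht.1 ht.2] with s hs
  exact h s (Ioo_subset_Icc_self hs)

theorem add (hf : HasACDeriv f f') (hg : HasACDeriv g g') :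
    HasACDeriv (fun t => f t + g t) (fun t => f' t + g' t) := by
  refine ⟨hf.1.add hg.1, ?_⟩
  filter_upwards [hf.2, hg.2] with t h1 h2 ht
  exact (h1 ht).add (h2 ht)

theorem sub (hf : HasACDeriv f f') (hg : HasACDeriv g g') :
    HasACDeriv (fun t => f t - g t) (fun t => f' t - g' t) := by
  refine ⟨hf.1.sub hg.1, ?_⟩
  filter_upwards [hf.2, hg.2] with t h1 h2 ht
  exact (h1 ht).sub (h2 ht)

theorem mul (hf : HasACDeriv f f') (hg : HasACDeriv g g') :
    HasACDeriv (fun t => f t * g t) (fun t => f' t * g t + f t * g' t) := by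
  refine ⟨hf.1.mul hg.1, ?_⟩
  filter_upwards [hf.2, hg.2] with t h1 h2 ht
  exact (h1 ht).mul (h2 ht)

theorem const (c : ℝ) : HasACDeriv (fun _ => c) (fun _ => 0) := by
  refine ⟨?_, Eventually.of_forall fun t _ => hasDerivAt_const t c⟩
  exact (contDiff_const (c := c)).contDiffOn.absolutelyContinuousOnInterval

theorem const_mul (c : ℝ) (hf : HasACDeriv f f') :
    HasACDeriv (fun t => c * f t) (fun t => c * f' t) := by
  simpa using (const c).mul hf

theorem neg (hf : HasACDeriv f f') : HasACDeriv (fun t => -f t) (fun t => -f' t) := by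
  simpa using hf.const_mul (-1)

theorem sum {ι : Type*} (s : Finset ι) {F F' : ι → ℝ → ℝ}
    (h : ∀ i ∈ s, HasACDeriv (F i) (F' i)) :
    HasACDeriv (fun t => ∑ i ∈ s, F i t) (fun t => ∑ i ∈ s, F' i t) := by
  classical
  induction s using Finset.induction_on with
  | empty => simpa using const 0
  | insert a s ha ih =>
    simp only [Finset.sum_insert ha]
    exact (h a (by simp)).add (ih fun i hi => h i (by simp [hi]))

theorem comp {G G' : ℝ → ℝ} (hf : HasACDeriv f f') (hG : ContDiff ℝ 1 G)
    (hG' : ∀ x, HasDerivAt G (G' x) x) :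
    HasACDeriv (fun t => G (f t)) (fun t => G' (f t) * f' t) := by
  refine ⟨absolutelyContinuous_comp hf.1 hG, ?_⟩
  filter_upwards [hf.2] with t h1 ht
  exact (hG' (f t)).comp t (h1 ht)

theorem cos (hf : HasACDeriv f f') :
    HasACDeriv (fun t => Real.cos (f t)) (fun t => -Real.sin (f t) * f' t) :=
  hf.comp Real.contDiff_cos Real.hasDerivAt_cos

theorem sin (hf : HasACDeriv f f') :
    HasACDeriv (fun t => Real.sin (f t)) (fun t => Real.cos (f t) * f' t) :=
  hf.comp Real.contDiff_sin Real.hasDerivAt_sin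

theorem exp (hf : HasACDeriv f f') :
    HasACDeriv (fun t => Real.exp (f t)) (fun t => Real.exp (f t) * f' t) :=
  hf.comp Real.contDiff_exp Real.hasDerivAt_exp

theorem ae_deriv_eq (hf : HasACDeriv f f') {a b : ℝ} (ha : a ∈ Icc (0 : ℝ) 1)
    (hb : b ∈ Icc (0 : ℝ) 1) : ∀ᵐ t, t ∈ uIoc a b → deriv f t = f' t := by
  have h1 : ∀ᵐ t : ℝ, t ≠ 1 := by simp [ae_iff]
  filter_upwards [hf.2, h1] with t h h1 ht
  have ht' : t ∈ Ioo (0 : ℝ) 1 := by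
    rcases le_total a b with hab | hab
    · rw [uIoc_of_le hab] at ht
      exact ⟨ha.1.trans_lt ht.1, lt_of_le_of_ne (ht.2.trans hb.2) h1⟩
    · rw [uIoc_of_ge hab] at ht
      exact ⟨hb.1.trans_lt ht.1, lt_of_le_of_ne (ht.2.trans ha.2) h1⟩
  exact (h ht').deriv

theorem absolutelyContinuous_sub (hf : HasACDeriv f f') {a b : ℝ} (ha : a ∈ Icc (0 : ℝ) 1)
    (hb : b ∈ Icc (0 : ℝ) 1) : AbsolutelyContinuousOnInterval f a b := by
  refine hf.1.mono ?_
  rw [uIcc_of_le zero_le_one]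
  exact (convex_Icc (0 : ℝ) 1).ordConnected.uIcc_subset ha hb

theorem intervalIntegrable (hf : HasACDeriv f f') {a b : ℝ} (ha : a ∈ Icc (0 : ℝ) 1)
    (hb : b ∈ Icc (0 : ℝ) 1) : IntervalIntegrable f' volume a b := by
  refine (hf.absolutelyContinuous_sub ha hb).intervalIntegrable_deriv.congr_ae ?_
  exact (ae_restrict_iff' measurableSet_uIoc).2 (hf.ae_deriv_eq ha hb)

theorem integral_eq (hf : HasACDeriv f f') {a b : ℝ} (ha : a ∈ Icc (0 : ℝ) 1)
    (hb : b ∈ Icc (0 : ℝ) 1) : ∫ t in a..b, f' t = f b - f a := by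
  rw [← (hf.absolutelyContinuous_sub ha hb).integral_deriv_eq_sub]
  refine intervalIntegral.integral_congr_ae ?_
  filter_upwards [hf.ae_deriv_eq ha hb] with t h ht
  exact (h ht).symm

theorem integral (h : IntervalIntegrable f' volume 0 1) (c : ℝ) :
    HasACDeriv (fun t => c + ∫ s in (0 : ℝ)..t, f' s) f' := by
  have h1 : HasACDeriv (fun t => ∫ s in (0 : ℝ)..t, f' s) f' := by
    refine ⟨h.absolutelyContinuousOnInterval_intervalIntegral (by simp), ?_⟩
    filter_upwards [h.ae_hasDerivAt_integral] with t h1 ht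
    refine h1 ?_ 0 (by simp)
    rw [uIcc_of_le zero_le_one]; exact Ioo_subset_Icc_self ht
  simpa using (const c).add h1

theorem of_integral (h : IntervalIntegrable f' volume 0 1)
    (hf : ∀ t ∈ Icc (0 : ℝ) 1, f t = f 0 + ∫ s in (0 : ℝ)..t, f' s) : HasACDeriv f f' :=
  (integral h (f 0)).congr hf

theorem lt_of_deriv_pos (hf : HasACDeriv f f') {a b : ℝ} (ha : 0 ≤ a) (hab : a < b) (hb : b ≤ 1)
    (h : ∀ᵐ t, t ∈ Ioo a b → 0 < f' t) : f a < f b := by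
  have ha' : a ∈ Icc (0 : ℝ) 1 := ⟨ha, hab.le.trans hb⟩
  have hb' : b ∈ Icc (0 : ℝ) 1 := ⟨ha.trans hab.le, hb⟩
  have hI := hf.integral_eq ha' hb'
  have hpos : 0 < ∫ t in a..b, f' t := by
    rw [intervalIntegral.integral_of_le hab.le]
    have hint : IntegrableOn f' (Ioo a b) :=
      ((intervalIntegrable_iff_integrableOn_Ioc_of_le hab.le).1
        (hf.intervalIntegrable ha' hb')).mono_set Ioo_subset_Ioc_self
    have hp : ∀ᵐ t ∂(volume.restrict (Ioo a b)), 0 < f' t :=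
      (ae_restrict_iff' measurableSet_Ioo).2 h
    rw [integral_Ioc_eq_integral_Ioo]
    rw [integral_pos_iff_support_of_nonneg_ae (hp.mono fun t ht => ht.le) hint]
    have hs : (volume.restrict (Ioo a b)) (Function.support f') =
        (volume.restrict (Ioo a b)) univ := by
      apply measure_congr
      filter_upwards [hp] with t ht
      exact propext ⟨fun _ => trivial, fun _ => ht.ne'⟩
    rw [hs]
    simp [hab]
  linarith

theorem eq_of_deriv_zero (hf : HasACDeriv f f') (h : ∀ᵐ t, t ∈ Ioo (0 : ℝ) 1 → f' t = 0)
    {t : ℝ} (ht : t ∈ Icc (0 : ℝ) 1) : f t = f 0 := by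
  have h0 := (hf.congr_deriv (g' := fun _ => 0) h).integral_eq (a := 0) (by simp) ht
  simp at h0; linarith

end HasACDeriv

/-- A nonvanishing absolutely continuous plane curve starting on the positive real axis winds by
the integral of the imaginary part of its logarithmic derivative. -/
theorem polar_of_hasACDeriv {x y x' y' : ℝ → ℝ} (hx : HasACDeriv x x') (hy : HasACDeriv y y')
    (hne : ∀ t ∈ Icc (0 : ℝ) 1, 0 < x t ^ 2 + y t ^ 2) (hx0 : 0 < x 0) (hy0 : y 0 = 0) :
    let β := fun t => ∫ s in (0 : ℝ)..t, (x s * y' s - y s * x' s) / (x s ^ 2 + y s ^ 2)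
    HasACDeriv β (fun s => (x s * y' s - y s * x' s) / (x s ^ 2 + y s ^ 2)) ∧
    ∀ t ∈ Icc (0 : ℝ) 1, x t = √(x t ^ 2 + y t ^ 2) * Real.cos (β t) ∧
      y t = √(x t ^ 2 + y t ^ 2) * Real.sin (β t) := by
  intro β
  have hc : ∀ {p p' q : ℝ → ℝ}, HasACDeriv p p' → ContinuousOn q (Icc 0 1) →
      IntervalIntegrable (fun s => q s * p' s / (x s ^ 2 + y s ^ 2)) volume 0 1 := by
    intro p p' q hp hq
    have h1 := (hp.intervalIntegrable (a := 0) (b := 1) (by simp) (by simp)).continuousOn_mul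
      (g := fun s => q s / (x s ^ 2 + y s ^ 2)) (by
        rw [uIcc_of_le zero_le_one]
        exact hq.div ((hx.continuousOn.pow 2).add (hy.continuousOn.pow 2))
          fun t ht => (hne t ht).ne')
    refine h1.congr fun t _ => ?_
    ring
  have hβi : IntervalIntegrable
      (fun s => (x s * y' s - y s * x' s) / (x s ^ 2 + y s ^ 2)) volume 0 1 := by
    refine ((hc hy hx.continuousOn).sub (hc hx hy.continuousOn)).congr fun t _ => ?_
    ring
  have hαi : IntervalIntegrable
      (fun s => (x s * x' s + y s * y' s) / (x s ^ 2 + y s ^ 2)) volume 0 1 := by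
    refine ((hc hx hx.continuousOn).add (hc hy hy.continuousOn)).congr fun t _ => ?_
    ring
  have hβ : HasACDeriv β (fun s => (x s * y' s - y s * x' s) / (x s ^ 2 + y s ^ 2)) := by
    simpa using HasACDeriv.integral hβi 0
  have hα := HasACDeriv.integral hαi 0
  simp only [zero_add] at hα
  refine ⟨hβ, ?_⟩
  set α := fun t => ∫ s in (0 : ℝ)..t, (x s * x' s + y s * y' s) / (x s ^ 2 + y s ^ 2) with hαdef
  have hE := hα.neg.exp
  have h1 := hE.mul ((hx.mul hβ.cos).add (hy.mul hβ.sin))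
  have h2 := hE.mul ((hy.mul hβ.cos).sub (hx.mul hβ.sin))
  have e1 : ∀ t ∈ Icc (0 : ℝ) 1, _ := fun t ht => h1.eq_of_deriv_zero (by
    refine Eventually.of_forall fun t ht => ?_
    have := (hne t (Ioo_subset_Icc_self ht)).ne'
    field_simp
    ring) ht
  have e2 : ∀ t ∈ Icc (0 : ℝ) 1, _ := fun t ht => h2.eq_of_deriv_zero (by
    refine Eventually.of_forall fun t ht => ?_
    have := (hne t (Ioo_subset_Icc_self ht)).ne'
    field_simp
    ring) ht
  have hβ0 : β 0 = 0 := by simp [β]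
  have hα0 : α 0 = 0 := by simp [α]
  intro t ht
  have h1t := e1 t ht
  have h2t := e2 t ht
  simp only [hβ0, hα0, hy0, Real.cos_zero, Real.sin_zero, neg_zero, Real.exp_zero] at h1t h2t
  have hep := Real.exp_pos (-α t)
  have hC : x t * Real.cos (β t) + y t * Real.sin (β t) = x 0 / Real.exp (-α t) := by
    field_simp; linarith
  have hS : y t * Real.cos (β t) - x t * Real.sin (β t) = 0 := by
    have : Real.exp (-α t) * (y t * Real.cos (β t) - x t * Real.sin (β t)) = 0 := by linarith
    exact (mul_eq_zero.1 this).resolve_left hep.ne'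
  set R := x 0 / Real.exp (-α t) with hR
  have hRpos : 0 < R := by positivity
  have hcs := Real.sin_sq_add_cos_sq (β t)
  have hxR : x t = R * Real.cos (β t) := by
    linear_combination (-x t) * hcs + Real.cos (β t) * hC - Real.sin (β t) * hS
  have hyR : y t = R * Real.sin (β t) := by
    linear_combination (-y t) * hcs + Real.sin (β t) * hC + Real.cos (β t) * hS
  have hsq : √(x t ^ 2 + y t ^ 2) = R := by
    rw [show x t ^ 2 + y t ^ 2 = R ^ 2 by rw [hxR, hyR]; linear_combination R ^ 2 * hcs]
    exact Real.sqrt_sq hRpos.le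
  rw [hsq]; exact ⟨hxR, hyR⟩

/-- Integrals over initial segments of the unit interval as interval integrals on the line. -/
theorem setIntegral_unitInterval_Iic (g : ℝ → ℝ) (t : unitInterval) :
    ∫ s in Set.Iic t, g s = ∫ x in (0 : ℝ)..t, g x := by
  have hemb : MeasurableEmbedding (Subtype.val : unitInterval → ℝ) :=
    MeasurableEmbedding.subtype_coe measurableSet_Icc
  have hmap : (volume : Measure unitInterval) = Measure.comap Subtype.val volume := rfl
  rw [intervalIntegral.integral_of_le t.2.1, ← integral_Icc_eq_integral_Ioc]
  have himg : (Subtype.val : unitInterval → ℝ) '' (Set.Iic t) = Icc 0 (t : ℝ) := by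
    ext x
    constructor
    · rintro ⟨s, hs, rfl⟩; exact ⟨s.2.1, hs⟩
    · rintro ⟨h0, h1⟩; exact ⟨⟨x, h0, h1.trans t.2.2⟩, h1, rfl⟩
  rw [← himg]
  have h := hemb.setIntegral_map (μ := (volume : Measure unitInterval)) g
    ((Subtype.val : unitInterval → ℝ) '' (Set.Iic t))
  rw [Subtype.val_injective.preimage_image] at h
  rw [← h, hmap, hemb.map_comap, Measure.restrict_restrict]
  · congr 2
    rw [himg, Subtype.range_val]
    have hsub : Icc 0 (t : ℝ) ⊆ unitInterval := fun x hx => ⟨hx.1, hx.2.trans t.2.2⟩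
    exact Set.inter_eq_left.2 hsub
  · rw [himg]; exact measurableSet_Icc

end

section

/-! ### Oscillation in a lune -/

/-- Two functions `X`, `P` of the tangent angle `L`, of period `2πk`, that oscillate in a lune.
Here `X` is the longitude in the lune and `P` the slope; the last two conditions say that the two
boundary curves of the caustic band, in horizontal projection, move forward and backward along the
tangent. -/
structure LuneOscillation (X P : ℝ → ℝ) (δ : ℝ) (k : ℕ) : Prop where
  periodic_X : ∀ L, X (L + 2 * Real.pi * k) = X L
  periodic_P : ∀ L, P (L + 2 * Real.pi * k) = P L
  bound : ∀ L, |X L| ≤ Real.pi / 2 - δ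
  incr : ∀ a L₁ L₂, a ≤ L₁ → L₁ < L₂ → L₂ ≤ a + Real.pi →
    P L₁ * Real.cos (X L₁ + δ) * Real.sin (L₁ - a) - Real.sin (X L₁ + δ) * Real.cos (L₁ - a) <
    P L₂ * Real.cos (X L₂ + δ) * Real.sin (L₂ - a) - Real.sin (X L₂ + δ) * Real.cos (L₂ - a)
  decr : ∀ a L₁ L₂, a ≤ L₁ → L₁ < L₂ → L₂ ≤ a + Real.pi →
    P L₂ * Real.cos (X L₂ - δ) * Real.sin (L₂ - a) - Real.sin (X L₂ - δ) * Real.cos (L₂ - a) <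
    P L₁ * Real.cos (X L₁ - δ) * Real.sin (L₁ - a) - Real.sin (X L₁ - δ) * Real.cos (L₁ - a)

theorem lt_of_sin_lt {x y : ℝ} (hx : x ≤ Real.pi / 2) (hy : -(Real.pi / 2) ≤ y)
    (h : Real.sin x < Real.sin y) : x < y := by
  by_contra! hc
  exact absurd h (not_lt.2 (Real.sin_le_sin_of_le_of_le_pi_div_two hy hx hc))

namespace LuneOscillation

variable {X P : ℝ → ℝ} {δ : ℝ} {k : ℕ}

/-- Reflection in the plane that bisects the lune exchanges the two boundary curves. -/
theorem neg (H : LuneOscillation X P δ k) :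
    LuneOscillation (fun L => -X L) (fun L => -P L) δ k := by
  have e1 : ∀ x : ℝ, -x + δ = -(x - δ) := fun x => by ring
  have e2 : ∀ x : ℝ, -x - δ = -(x + δ) := fun x => by ring
  refine ⟨fun L => by rw [H.periodic_X], fun L => by rw [H.periodic_P],
    fun L => by rw [abs_neg]; exact H.bound L, fun a L₁ L₂ h1 h2 h3 => ?_,
    fun a L₁ L₂ h1 h2 h3 => ?_⟩
  · have := H.decr a L₁ L₂ h1 h2 h3
    simp only [e1, Real.cos_neg, Real.sin_neg]
    linarith
  · have := H.incr a L₁ L₂ h1 h2 h3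
    simp only [e2, Real.cos_neg, Real.sin_neg]
    linarith

theorem neg_lt_add_half_turn (H : LuneOscillation X P δ k) (hδ : 0 < δ) (L : ℝ) :
    -(2 * δ) < X L + X (L + Real.pi) := by
  have h := H.incr L L (L + Real.pi) le_rfl (by linarith [Real.pi_pos]) le_rfl
  simp only [sub_self, Real.sin_zero, Real.cos_zero, add_sub_cancel_left, Real.sin_pi,
    Real.cos_pi] at h
  have h' : Real.sin (-(X L + δ)) < Real.sin (X (L + Real.pi) + δ) := by
    rw [Real.sin_neg]; linarith
  have b1 := abs_le.1 (H.bound L)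
  have b2 := abs_le.1 (H.bound (L + Real.pi))
  have := lt_of_sin_lt (by linarith) (by linarith) h'
  linarith

theorem abs_add_half_turn (H : LuneOscillation X P δ k) (hδ : 0 < δ) (L : ℝ) :
    |X L + X (L + Real.pi)| ≤ 2 * δ := by
  have h1 := H.neg_lt_add_half_turn hδ L
  have h2 := H.neg.neg_lt_add_half_turn hδ L
  rw [abs_le]; constructor <;> linarith

/-- Each half turn reverses the longitude up to an error `2δ`. -/
theorem abs_half_turns (H : LuneOscillation X P δ k) (hδ : 0 < δ) (L : ℝ) (j : ℕ) :
    |X (L + j * Real.pi) - (-1) ^ j * X L| ≤ 2 * δ * j := by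
  induction j with
  | zero => simp
  | succ j ih =>
    have h := H.abs_add_half_turn hδ (L + j * Real.pi)
    have e : L + j * Real.pi + Real.pi = L + (j + 1 : ℕ) * Real.pi := by push_cast; ring
    rw [e] at h
    have e2 : X (L + (j + 1 : ℕ) * Real.pi) - (-1) ^ (j + 1) * X L =
      (X (L + j * Real.pi) + X (L + (j + 1 : ℕ) * Real.pi)) -
        (X (L + j * Real.pi) - (-1) ^ j * X L) := by rw [pow_succ]; ring
    rw [e2]
    refine (abs_sub _ _).trans ?_
    push_cast at h ⊢
    linarith

/-- After a contact at the lower bound of the longitude, the latter can be neither too small nor too large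
during the next half turn. -/
theorem after_touch (H : LuneOscillation X P δ k) (hδ : 0 < δ) {L : ℝ}
    (hX : X L = -(Real.pi / 2 - δ)) (hP : P L = 0) {b : ℝ} (hb : 0 < b) (hbπ : b ≤ Real.pi) :
    -(Real.cos (2 * δ) * Real.cos b) < Real.sin (X (L + b) + δ) ∧
      X (L + b) < b - Real.pi / 2 + δ := by
  have ha1 : L + b - Real.pi ≤ L := by linarith
  have h1 := H.incr (L + b - Real.pi) L (L + b) ha1 (by linarith) (by linarith)
  have h2 := H.decr (L + b - Real.pi) L (L + b) ha1 (by linarith) (by linarith)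
  have e1 : L - (L + b - Real.pi) = Real.pi - b := by ring
  have e2 : L + b - (L + b - Real.pi) = Real.pi := by ring
  have e3 : -(Real.pi / 2 - δ) + δ = -(Real.pi / 2 - 2 * δ) := by ring
  have e4 : -(Real.pi / 2 - δ) - δ = -(Real.pi / 2) := by ring
  rw [hX, hP, e1, e2, e3] at h1
  rw [hX, hP, e1, e2, e4] at h2
  simp only [Real.sin_pi, Real.cos_pi, Real.cos_pi_sub, Real.sin_neg, Real.sin_pi_div_two_sub,
    Real.sin_pi_div_two] at h1 h2
  refine ⟨by linarith, ?_⟩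
  have h3 : Real.sin (X (L + b) - δ) < Real.sin (b - Real.pi / 2) := by
    rw [Real.sin_sub_pi_div_two]; linarith
  have b2 := abs_le.1 (H.bound (L + b))
  by_contra! hc
  have := Real.sin_le_sin_of_le_of_le_pi_div_two (x := b - Real.pi / 2) (y := X (L + b) - δ)
    (by linarith) (by linarith) (by linarith)
  linarith

theorem exists_nat_mul_pi_add {a : ℝ} (ha : 0 < a) :
    ∃ (j : ℕ) (b : ℝ), 0 < b ∧ b ≤ Real.pi ∧ a = j * Real.pi + b := by
  have hpi := Real.pi_pos
  have h1 : 0 < ⌈a / Real.pi⌉₊ := Nat.ceil_pos.2 (by positivity)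
  obtain ⟨j, hj⟩ : ∃ j, ⌈a / Real.pi⌉₊ = j + 1 := ⟨_, (Nat.succ_pred_eq_of_pos h1).symm⟩
  refine ⟨j, a - j * Real.pi, ?_, ?_, by ring⟩
  · have : (j : ℝ) < a / Real.pi := Nat.lt_ceil.1 (by omega)
    rw [lt_div_iff₀ hpi] at this; linarith
  · have : a / Real.pi ≤ (j + 1 : ℕ) := hj ▸ Nat.le_ceil _
    rw [div_le_iff₀ hpi] at this; push_cast at this; linarith

/-- The case `ε = -1` of `two_touches`, to which the other one reduces by reflection. -/
theorem two_touches_aux (H : LuneOscillation X P δ k) (hδ : 0 < δ) {L L' ε' : ℝ} (hL : L < L')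
    (hX : X L = -(Real.pi / 2 - δ)) (hP : P L = 0)
    (hε' : ε' = 1 ∨ ε' = -1) (hX' : X L' = ε' * (Real.pi / 2 - δ)) :
    ∃ (j : ℕ) (b : ℝ), 0 < b ∧ b ≤ Real.pi ∧ L' - L = j * Real.pi + b ∧
      (((∃ n : ℤ, L' - L - (ε' + 1) * (Real.pi / 2) = b + n * (2 * Real.pi)) ∧
        (2 * δ * (j + 1) ≤ Real.pi →
          Real.cos (2 * δ * (j + 1)) < Real.cos (2 * δ) * Real.cos b)) ∨
      ((∃ n : ℤ, L' - L - (ε' + 1) * (Real.pi / 2) = b - Real.pi + n * (2 * Real.pi)) ∧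
        Real.pi - b < 2 * δ * (j + 1))) := by
  obtain ⟨j, b, hb, hbπ, ha⟩ := exists_nat_mul_pi_add (sub_pos.2 hL)
  refine ⟨j, b, hb, hbπ, ha, ?_⟩
  obtain ⟨hs, hx⟩ := H.after_touch hδ hX hP hb hbπ
  -- the longitude at `L + b` determines the one at `L'`, which is `j` half turns later
  have hj := H.abs_half_turns hδ (L + b) j
  have eL : L + b + j * Real.pi = L' := by linarith
  rw [eL, hX'] at hj
  have hj := abs_le.1 hj
  have bd := abs_le.1 (H.bound (L + b))
  have same : X (L + b) + δ ≤ -(Real.pi / 2) + 2 * δ * (j + 1) → 2 * δ * (j + 1) ≤ Real.pi →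
      Real.cos (2 * δ * (j + 1)) < Real.cos (2 * δ) * Real.cos b := by
    intro h1 h2
    have := Real.sin_le_sin_of_le_of_le_pi_div_two (x := X (L + b) + δ)
      (y := -(Real.pi / 2) + 2 * δ * (j + 1)) (by linarith) (by linarith) h1
    have e : -(Real.pi / 2) + 2 * δ * (j + 1) = -(Real.pi / 2 - 2 * δ * (j + 1)) := by ring
    rw [e, Real.sin_neg, Real.sin_pi_div_two_sub] at this
    linarith
  -- the contact at `L'` is on the same side as that at `L`, up to the sign `(-1) ^ j`, or opposite
  rcases Nat.even_or_odd' j with ⟨i, rfl | rfl⟩ <;> rcases hε' with rfl | rfl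
  · refine Or.inr ⟨⟨i, ?_⟩, ?_⟩
    · rw [ha]; push_cast; ring
    · have e : ((-1 : ℝ)) ^ (2 * i) = 1 := by simp
      rw [e] at hj; linarith
  · refine Or.inl ⟨⟨i, ?_⟩, same ?_⟩
    · rw [ha]; push_cast; ring
    · have e : ((-1 : ℝ)) ^ (2 * i) = 1 := by simp
      rw [e] at hj; linarith
  · refine Or.inl ⟨⟨i, ?_⟩, same ?_⟩
    · rw [ha]; push_cast; ring
    · have e : ((-1 : ℝ)) ^ (2 * i + 1) = -1 := by simp [pow_succ]
      rw [e] at hj; linarith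
  · refine Or.inr ⟨⟨i + 1, ?_⟩, ?_⟩
    · rw [ha]; push_cast; ring
    · have e : ((-1 : ℝ)) ^ (2 * i + 1) = -1 := by simp [pow_succ]
      rw [e] at hj; linarith

/-- The relative position, on the horizontal circle, of two contact points of the caustic band with
the horizontal plane, where the tangent angle advances by `jπ + b` in between. The second point is at
the angle `b` or `b - π` from the first, and in both cases `b` is bounded in terms of `j`, because
the longitude after the fraction `b` of a half turn persists, with alternating sign, up to an error
`2δj`. -/
theorem two_touches (H : LuneOscillation X P δ k) (hδ : 0 < δ) {L L' ε ε' : ℝ} (hL : L < L')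
    (hε : ε = 1 ∨ ε = -1) (hX : X L = ε * (Real.pi / 2 - δ)) (hP : P L = 0)
    (hε' : ε' = 1 ∨ ε' = -1) (hX' : X L' = ε' * (Real.pi / 2 - δ)) :
    ∃ (j : ℕ) (b : ℝ), 0 < b ∧ b ≤ Real.pi ∧ L' - L = j * Real.pi + b ∧
      (((∃ n : ℤ, L' - ε' * (Real.pi / 2) - (L - ε * (Real.pi / 2)) = b + n * (2 * Real.pi)) ∧
        (2 * δ * (j + 1) ≤ Real.pi →
          Real.cos (2 * δ * (j + 1)) < Real.cos (2 * δ) * Real.cos b)) ∨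
      ((∃ n : ℤ, L' - ε' * (Real.pi / 2) - (L - ε * (Real.pi / 2)) =
          b - Real.pi + n * (2 * Real.pi)) ∧
        Real.pi - b < 2 * δ * (j + 1))) := by
  rcases hε with rfl | rfl
  · obtain ⟨j, b, h1, h2, h3, h4⟩ := H.neg.two_touches_aux hδ (ε' := -ε') hL
      (by simp only [hX]; ring) (by simp only [hP]; ring)
      (by rcases hε' with rfl | rfl <;> simp) (by simp only [hX']; ring)
    refine ⟨j, b, h1, h2, h3, ?_⟩
    have key : ∃ i : ℤ, L' - ε' * (Real.pi / 2) - (L - 1 * (Real.pi / 2)) =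
        L' - L - (-ε' + 1) * (Real.pi / 2) + i * (2 * Real.pi) := by
      rcases hε' with rfl | rfl
      · exact ⟨0, by push_cast; ring⟩
      · exact ⟨1, by push_cast; ring⟩
    obtain ⟨i, hi⟩ := key
    rcases h4 with ⟨⟨n, hn⟩, h5⟩ | ⟨⟨n, hn⟩, h5⟩
    · exact Or.inl ⟨⟨n + i, by rw [hi, hn]; push_cast; ring⟩, h5⟩
    · exact Or.inr ⟨⟨n + i, by rw [hi, hn]; push_cast; ring⟩, h5⟩
  · obtain ⟨j, b, h1, h2, h3, h4⟩ := H.two_touches_aux hδ hL (by rw [hX]; ring) hP hε' hX'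
    refine ⟨j, b, h1, h2, h3, ?_⟩
    have e : L' - ε' * (Real.pi / 2) - (L - -1 * (Real.pi / 2)) =
        L' - L - (ε' + 1) * (Real.pi / 2) := by ring
    rw [e]; exact h4

/-- A contact of the caustic band with the horizontal plane, at the tangent angle `L`; the sign
`ε` tells which of the two boundary curves touches. -/
def Touch (X P : ℝ → ℝ) (δ L ε : ℝ) : Prop :=
  (ε = 1 ∨ ε = -1) ∧ X L = ε * (Real.pi / 2 - δ) ∧ P L = 0

theorem Touch.add_period (H : LuneOscillation X P δ k) {L ε : ℝ} (h : Touch X P δ L ε) :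
    Touch X P δ (L + 2 * Real.pi * k) ε :=
  ⟨h.1, by rw [H.periodic_X, h.2.1], by rw [H.periodic_P, h.2.2]⟩

theorem no_antipodal_aux (H : LuneOscillation X P δ k) (hδ : 0 < δ)
    (hk : (k + 1) * (2 * δ) ≤ Real.pi) {L L' ε ε' : ℝ} (hL : L < L') (hk' : L' - L ≤ k * Real.pi)
    (hT : Touch X P δ L ε) (hT' : Touch X P δ L' ε') :
    Real.cos (L' - ε' * (Real.pi / 2) - (L - ε * (Real.pi / 2))) ≠ -1 := by
  intro hcos
  have hpi := Real.pi_pos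
  obtain ⟨j, b, hb, hbπ, ha, h⟩ := H.two_touches hδ hL hT.1 hT.2.1 hT.2.2 hT'.1 hT'.2.1
  rcases h with ⟨⟨n, hn⟩, h⟩ | ⟨⟨n, hn⟩, h⟩
  · rw [hn, Real.cos_add_int_mul_two_pi] at hcos
    have hb' : b = Real.pi := by
      have : Real.cos b = Real.cos Real.pi := by rw [hcos, Real.cos_pi]
      exact Real.injOn_cos ⟨hb.le, hbπ⟩ ⟨hpi.le, le_rfl⟩ this
    have hjk : (j : ℝ) + 1 ≤ k := by
      have : ((j : ℝ) + 1) * Real.pi ≤ k * Real.pi := by rw [hb'] at ha; linarith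
      exact le_of_mul_le_mul_right this hpi
    have h1 : 2 * δ * (j + 1) ≤ Real.pi - 2 * δ := by nlinarith
    have h2 := h (by linarith)
    rw [hcos] at h2
    have h3 := Real.cos_le_cos_of_nonneg_of_le_pi (x := 2 * δ * (j + 1)) (y := Real.pi - 2 * δ)
      (by positivity) (by linarith) h1
    rw [Real.cos_pi_sub] at h3
    linarith
  · rw [hn, Real.cos_add_int_mul_two_pi, Real.cos_sub_pi] at hcos
    have : Real.cos b = Real.cos 0 := by rw [Real.cos_zero]; linarith
    have := Real.injOn_cos ⟨hb.le, hbπ⟩ ⟨le_rfl, hpi.le⟩ this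
    linarith

/-- Contact points within one period are never antipodal. Of the two parts into which they divide
the period, the shorter one has at most `k` half turns. -/
theorem no_antipodal (H : LuneOscillation X P δ k) (hδ : 0 < δ)
    (hk : (k + 1) * (2 * δ) ≤ Real.pi) {L L' ε ε' : ℝ} (hL : L < L')
    (hk' : L' < L + 2 * Real.pi * k)
    (hT : Touch X P δ L ε) (hT' : Touch X P δ L' ε') :
    Real.cos (L' - ε' * (Real.pi / 2) - (L - ε * (Real.pi / 2))) ≠ -1 := by
  rcases le_total (L' - L) (k * Real.pi) with h | h
  · exact H.no_antipodal_aux hδ hk hL h hT hT'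
  · have := H.no_antipodal_aux hδ hk (L := L') (L' := L + 2 * Real.pi * k) hk' (by linarith)
      hT' (Touch.add_period H hT)
    intro hc
    apply this
    rw [← hc, ← Real.cos_neg, show -(L + 2 * Real.pi * k - ε * (Real.pi / 2) -
      (L' - ε' * (Real.pi / 2))) = L' - ε' * (Real.pi / 2) - (L - ε * (Real.pi / 2)) -
        k * (2 * Real.pi) by ring, Real.cos_sub_nat_mul_two_pi]

end LuneOscillation

/-! ### A trigonometric inequality for the angles of a triangle -/

theorem convexOn_arccos_mul_cos {c : ℝ} (h0 : 0 ≤ c) (h1 : c < 1) :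
    ConvexOn ℝ (Icc 0 (Real.pi / 2)) (fun B => Real.arccos (c * Real.cos B)) := by
  have hlt : ∀ B, |c * Real.cos B| < 1 := fun B => by
    rw [abs_mul, abs_of_nonneg h0]
    nlinarith [Real.abs_cos_le_one B, abs_nonneg (Real.cos B)]
  have hd : ∀ B, HasDerivAt (fun B => Real.arccos (c * Real.cos B))
      (c * Real.sin B / √(1 - (c * Real.cos B) ^ 2)) B := by
    intro B
    have := abs_lt.1 (hlt B)
    have h := (Real.hasDerivAt_arccos (x := c * Real.cos B) (by linarith) (by linarith)).comp B
      ((Real.hasDerivAt_cos B).const_mul c)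
    exact HasDerivAt.congr_deriv h (by ring)
  refine MonotoneOn.convexOn_of_deriv (convex_Icc _ _)
    (fun B _ => (hd B).continuousAt.continuousWithinAt)
    (fun B _ => (hd B).differentiableAt.differentiableWithinAt) ?_
  rw [interior_Icc]
  intro x hx y hy hxy
  rw [(hd x).deriv, (hd y).deriv]
  have hpos : ∀ B, 0 < 1 - (c * Real.cos B) ^ 2 := fun B => by
    have := hlt B; nlinarith [sq_abs (c * Real.cos B), abs_nonneg (c * Real.cos B)]
  have hsx : 0 ≤ Real.sin x := Real.sin_nonneg_of_nonneg_of_le_pi hx.1.le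
    (by linarith [hx.2, Real.pi_pos])
  have hsy : Real.sin x ≤ Real.sin y :=
    Real.sin_le_sin_of_le_of_le_pi_div_two (by linarith [hx.1, hx.2]) hy.2.le hxy
  rw [div_le_div_iff₀ (Real.sqrt_pos.2 (hpos x)) (Real.sqrt_pos.2 (hpos y))]
  have hy0 : 0 ≤ Real.sin y := hsx.trans hsy
  rw [mul_assoc, mul_assoc]
  refine mul_le_mul_of_nonneg_left ?_ h0
  rw [← Real.sqrt_sq hsx, ← Real.sqrt_sq hy0, ← Real.sqrt_mul (sq_nonneg _),
    ← Real.sqrt_mul (sq_nonneg _)]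
  apply Real.sqrt_le_sqrt
  have e : ∀ B, 1 - (c * Real.cos B) ^ 2 = 1 - c ^ 2 + c ^ 2 * Real.sin B ^ 2 := fun B => by
    rw [mul_pow, Real.cos_sq']; ring
  rw [e x, e y]
  have : Real.sin x ^ 2 ≤ Real.sin y ^ 2 := by gcongr
  nlinarith [mul_nonneg h0 h0, mul_le_mul_of_nonneg_right this (show 0 ≤ 1 - c ^ 2 by nlinarith)]

/-- For a triangle with angles `B₁`, `B₂`, `B₃` the angles `arccos (cos Δ cos Bᵢ)` add up to
at most `π + Δ`. -/
theorem sum_arccos_mul_cos_le {Δ B₁ B₂ B₃ : ℝ} (hΔ : 0 < Δ) (hΔ' : Δ ≤ Real.pi / 2)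
    (h1 : 0 ≤ B₁) (h2 : 0 ≤ B₂) (h3 : 0 ≤ B₃) (hs : B₁ + B₂ + B₃ = Real.pi) :
    Real.arccos (Real.cos Δ * Real.cos B₁) + Real.arccos (Real.cos Δ * Real.cos B₂) +
      Real.arccos (Real.cos Δ * Real.cos B₃) ≤ Real.pi + Δ := by
  have hpi := Real.pi_pos
  set g : ℝ → ℝ := fun B => Real.arccos (Real.cos Δ * Real.cos B) with hg
  have hc0 : 0 ≤ Real.cos Δ := Real.cos_nonneg_of_neg_pi_div_two_le_of_le (by linarith) hΔ'
  have hc1 : Real.cos Δ < 1 := by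
    rw [← Real.cos_zero]
    exact Real.cos_lt_cos_of_nonneg_of_le_pi_div_two le_rfl hΔ' hΔ
  have hconv := convexOn_arccos_mul_cos hc0 hc1
  have g0 : g 0 = Δ := by
    simp only [hg, Real.cos_zero, mul_one]
    exact Real.arccos_cos hΔ.le (by linarith)
  have g1 : g (Real.pi / 2) = Real.pi / 2 := by simp [hg]
  -- a convex function takes a larger sum of values at the more distant pair of points
  have maj : ∀ lo hi x y, 0 ≤ lo → hi ≤ Real.pi / 2 → lo ≤ x → x ≤ hi → x + y = lo + hi →
      g x + g y ≤ g lo + g hi := by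
    intro lo hi x y hlo hhi hx hx' hxy
    rcases eq_or_lt_of_le (hx.trans hx') with h | h
    · have e1 : x = lo := le_antisymm (by linarith) hx
      have e2 : y = hi := by linarith
      rw [e1, e2]
    · have hd : 0 < hi - lo := by linarith
      have hml : lo ∈ Icc (0 : ℝ) (Real.pi / 2) := ⟨hlo, by linarith⟩
      have hmh : hi ∈ Icc (0 : ℝ) (Real.pi / 2) := ⟨by linarith, hhi⟩
      have ha : 0 ≤ (hi - x) / (hi - lo) := div_nonneg (by linarith) hd.le
      have hb : 0 ≤ (x - lo) / (hi - lo) := div_nonneg (by linarith) hd.le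
      have hab : (hi - x) / (hi - lo) + (x - lo) / (hi - lo) = 1 := by field_simp; ring
      have k1 := hconv.2 hml hmh ha hb hab
      have k2 := hconv.2 hml hmh hb ha (by linarith)
      simp only [smul_eq_mul] at k1 k2
      have e1 : (hi - x) / (hi - lo) * lo + (x - lo) / (hi - lo) * hi = x := by field_simp; ring
      have e2 : (x - lo) / (hi - lo) * lo + (hi - x) / (hi - lo) * hi = y := by
        rw [show y = lo + hi - x by linarith]; field_simp; ring
      rw [e1] at k1
      rw [e2] at k2
      have : g x + g y ≤ ((hi - x) / (hi - lo) + (x - lo) / (hi - lo)) * (g lo + g hi) := by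
        simp only [hg]; linarith
      rwa [hab, one_mul] at this
  -- `g` is antisymmetric about `π / 2`, so an obtuse angle is traded for the sum of the others
  have obtuse : ∀ x y z, 0 ≤ x → 0 ≤ y → x + y + z = Real.pi → Real.pi / 2 ≤ z →
      g x + g y + g z ≤ Real.pi + Δ := by
    intro x y z hx hy hxyz hz
    have hgz : g z = Real.pi - g (x + y) := by
      simp only [hg]
      rw [show z = Real.pi - (x + y) by linarith, Real.cos_pi_sub, mul_neg, Real.arccos_neg]
    have := maj 0 (x + y) x y le_rfl (by linarith) hx (by linarith) (by ring)
    linarith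
  change g B₁ + g B₂ + g B₃ ≤ _
  rcases le_total (Real.pi / 2) B₃ with h | h3'
  · exact obtuse _ _ _ h1 h2 hs h
  rcases le_total (Real.pi / 2) B₂ with h | h2'
  · linarith [obtuse B₁ B₃ B₂ h1 h3 (by linarith) h]
  rcases le_total (Real.pi / 2) B₁ with h | h1'
  · linarith [obtuse B₂ B₃ B₁ h2 h3 (by linarith) h]
  -- in an acute triangle the angles are moved to `0`, `π / 2` and `π / 2`
  have m1 := maj (B₁ + B₂ - Real.pi / 2) (Real.pi / 2) B₁ B₂ (by linarith) le_rfl (by linarith)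
    h1' (by ring)
  have m2 := maj 0 (Real.pi / 2) (B₁ + B₂ - Real.pi / 2) B₃ le_rfl le_rfl (by linarith)
    (by linarith) (by linarith)
  linarith

/-- Angles `bᵢ` between three contact points that surround the origin are incompatible with the
bounds of `two_touches` when the `cᵢ` add up to at most `2π - Δ`. -/
theorem triangle_contradiction {Δ b₁ b₂ b₃ c₁ c₂ c₃ : ℝ} (hΔ : 0 < Δ) (hΔ' : Δ ≤ Real.pi / 2)
    (hb1 : b₁ ≤ Real.pi) (hb2 : b₂ ≤ Real.pi) (hb3 : b₃ ≤ Real.pi)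
    (hb : b₁ + b₂ + b₃ = 2 * Real.pi)
    (h1 : 0 ≤ c₁) (h1' : c₁ ≤ Real.pi) (h2 : 0 ≤ c₂) (h2' : c₂ ≤ Real.pi)
    (h3 : 0 ≤ c₃) (h3' : c₃ ≤ Real.pi) (hc : c₁ + c₂ + c₃ ≤ 2 * Real.pi - Δ)
    (k1 : Real.cos c₁ < Real.cos Δ * Real.cos b₁) (k2 : Real.cos c₂ < Real.cos Δ * Real.cos b₂)
    (k3 : Real.cos c₃ < Real.cos Δ * Real.cos b₃) : False := by
  have key : ∀ b c, 0 ≤ c → c ≤ Real.pi → Real.cos c < Real.cos Δ * Real.cos b →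
      Real.pi - c < Real.arccos (Real.cos Δ * Real.cos (Real.pi - b)) := by
    intro b c hc hc' h
    rw [← Real.arccos_cos (x := Real.pi - c) (by linarith) (by linarith), Real.cos_pi_sub,
      Real.cos_pi_sub]
    apply Real.arccos_lt_arccos
    · nlinarith [Real.cos_le_one b, Real.neg_one_le_cos b, Real.cos_le_one Δ,
        abs_le.1 (show |Real.cos Δ * Real.cos b| ≤ 1 by
          rw [abs_mul]; exact mul_le_one₀ (Real.abs_cos_le_one _) (abs_nonneg _)
            (Real.abs_cos_le_one _))]
    · linarith
    · linarith [Real.neg_one_le_cos c]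
  have := sum_arccos_mul_cos_le hΔ hΔ' (B₁ := Real.pi - b₁) (B₂ := Real.pi - b₂)
    (B₃ := Real.pi - b₃) (by linarith) (by linarith) (by linarith) (by linarith)
  linarith [key _ _ h1 h1' k1, key _ _ h2 h2' k2, key _ _ h3 h3' k3]

end

section

/-! ### Contacts of the caustic band with the bounding plane -/

namespace LuneOscillation

variable {X P : ℝ → ℝ} {δ : ℝ} {k : ℕ}

theorem int_eq_one_of_mul_two_pi {N : ℤ} {s : ℝ} (h : s = N * (2 * Real.pi)) (h0 : 0 < s)
    (h1 : s ≤ 3 * Real.pi) : N = 1 := by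
  have hpi := Real.pi_pos
  have h2 : (0 : ℝ) < N := (mul_pos_iff_of_pos_right (by positivity : 0 < 2 * Real.pi)).1 (h ▸ h0)
  have h3 : (N : ℝ) < 2 :=
    lt_of_mul_lt_mul_right (by linarith : (N : ℝ) * (2 * Real.pi) < 2 * (2 * Real.pi))
      (by positivity)
  have h2' : (0 : ℤ) < N := by exact_mod_cast h2
  have h3' : N < 2 := by exact_mod_cast h3
  omega

/-- Two of the bounds of `two_touches` with `c₁ + c₂ ≤ π` bound the sum of the angles. -/
theorem add_lt_pi_of_touches {Δ b₁ b₂ c₁ c₂ : ℝ} (hΔ : 0 ≤ Real.cos Δ)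
    (hb1' : b₁ ≤ Real.pi) (hb2' : b₂ ≤ Real.pi)
    (hc1 : 0 ≤ c₁) (hc2 : 0 ≤ c₂) (hc : c₁ + c₂ ≤ Real.pi)
    (k1 : Real.cos c₁ < Real.cos Δ * Real.cos b₁)
    (k2 : Real.cos c₂ < Real.cos Δ * Real.cos b₂) : b₁ + b₂ < Real.pi := by
  by_contra! h
  have h1 := Real.cos_le_cos_of_nonneg_of_le_pi (x := Real.pi - b₁) (y := b₂) (by linarith)
    hb2' (by linarith)
  have h2 := Real.cos_le_cos_of_nonneg_of_le_pi (x := c₁) (y := Real.pi - c₂) (by linarith)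
    (by linarith) (by linarith)
  rw [Real.cos_pi_sub] at h1 h2
  have := mul_nonneg hΔ (show 0 ≤ -(Real.cos b₁ + Real.cos b₂) by linarith)
  nlinarith

/-- No three contact points, met in this order, surround the origin counterclockwise. -/
theorem no_positive_triangle (H : LuneOscillation X P δ k) (hδ : 0 < δ) (hk1 : 1 ≤ k)
    (hk : (k + 1) * (2 * δ) ≤ Real.pi) {L₀ L₁ L₂ ε₀ ε₁ ε₂ : ℝ} (h01 : L₀ < L₁) (h12 : L₁ < L₂)
    (h20 : L₂ < L₀ + 2 * Real.pi * k) (T0 : Touch X P δ L₀ ε₀) (T1 : Touch X P δ L₁ ε₁)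
    (T2 : Touch X P δ L₂ ε₂)
    (s01 : 0 < Real.sin (L₁ - ε₁ * (Real.pi / 2) - (L₀ - ε₀ * (Real.pi / 2))))
    (s12 : 0 < Real.sin (L₂ - ε₂ * (Real.pi / 2) - (L₁ - ε₁ * (Real.pi / 2))))
    (s20 : 0 < Real.sin (L₀ - ε₀ * (Real.pi / 2) - (L₂ - ε₂ * (Real.pi / 2)))) : False := by
  have hpi := Real.pi_pos
  have hkr : (1 : ℝ) ≤ k := by exact_mod_cast hk1
  have s20' : 0 < Real.sin (L₀ + 2 * Real.pi * k - ε₀ * (Real.pi / 2) -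
      (L₂ - ε₂ * (Real.pi / 2))) := by
    rw [show L₀ + 2 * Real.pi * k - ε₀ * (Real.pi / 2) - (L₂ - ε₂ * (Real.pi / 2)) =
      L₀ - ε₀ * (Real.pi / 2) - (L₂ - ε₂ * (Real.pi / 2)) + k * (2 * Real.pi) by ring,
      Real.sin_add_nat_mul_two_pi]
    exact s20
  have pos : ∀ {L L' ε ε' : ℝ}, L < L' → Touch X P δ L ε → Touch X P δ L' ε' →
      0 < Real.sin (L' - ε' * (Real.pi / 2) - (L - ε * (Real.pi / 2))) →
      ∃ (j : ℕ) (b : ℝ), 0 < b ∧ b ≤ Real.pi ∧ L' - L = j * Real.pi + b ∧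
      (∃ n : ℤ, L' - ε' * (Real.pi / 2) - (L - ε * (Real.pi / 2)) = b + n * (2 * Real.pi)) ∧
        (2 * δ * (j + 1) ≤ Real.pi →
          Real.cos (2 * δ * (j + 1)) < Real.cos (2 * δ) * Real.cos b) := by
    intro L L' ε ε' hL T T' hs
    obtain ⟨j, b, hb, hbπ, ha, h | ⟨⟨n, hn⟩, -⟩⟩ :=
      H.two_touches hδ hL T.1 T.2.1 T.2.2 T'.1 T'.2.1
    · exact ⟨j, b, hb, hbπ, ha, h⟩
    · rw [hn, Real.sin_add_int_mul_two_pi, Real.sin_sub_pi] at hs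
      linarith [Real.sin_nonneg_of_nonneg_of_le_pi hb.le hbπ]
  obtain ⟨j₀, b₀, hb0, hb0π, ha0, ⟨n₀, hn0⟩, hc0⟩ := pos h01 T0 T1 s01
  obtain ⟨j₁, b₁, hb1, hb1π, ha1, ⟨n₁, hn1⟩, hc1⟩ := pos h12 T1 T2 s12
  obtain ⟨j₂, b₂, hb2, hb2π, ha2, ⟨n₂, hn2⟩, hc2⟩ := pos h20 T2 (Touch.add_period H T0) s20'
  have hsum : b₀ + b₁ + b₂ = ((k - n₀ - n₁ - n₂ : ℤ) : ℝ) * (2 * Real.pi) := by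
    push_cast; linarith
  have hN : (k - n₀ - n₁ - n₂ : ℤ) = 1 :=
    int_eq_one_of_mul_two_pi hsum (by linarith) (by linarith)
  rw [hN] at hsum
  push_cast at hsum
  have hj : j₀ + j₁ + j₂ + 2 = 2 * k := by
    have : ((j₀ : ℝ) + j₁ + j₂ + 2) * Real.pi = (2 * k) * Real.pi := by linarith
    have := mul_right_cancel₀ hpi.ne' this
    exact_mod_cast this
  have hcos : 0 ≤ Real.cos (2 * δ) :=
    Real.cos_nonneg_of_neg_pi_div_two_le_of_le (by linarith) (by nlinarith)
  have small : ∀ j : ℕ, j + 1 ≤ k → 2 * δ * ((j : ℝ) + 1) ≤ Real.pi := by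
    intro j hj
    have : (j : ℝ) + 1 ≤ k := by exact_mod_cast hj
    have := mul_le_mul_of_nonneg_left this (by linarith : 0 ≤ 2 * δ)
    linarith
  -- when one gap is longer than half of the curve, the other two are short enough
  have long : ∀ (j j' : ℕ) (b b' : ℝ), 0 < b → b ≤ Real.pi → b' ≤ Real.pi → j + j' + 2 ≤ k →
      (2 * δ * ((j : ℝ) + 1) ≤ Real.pi →
          Real.cos (2 * δ * (j + 1)) < Real.cos (2 * δ) * Real.cos b) →
      (2 * δ * ((j' : ℝ) + 1) ≤ Real.pi →
          Real.cos (2 * δ * (j' + 1)) < Real.cos (2 * δ) * Real.cos b') → b + b' < Real.pi := by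
    intro j j' b b' hb hbπ hbπ' hjj h h'
    have : (j : ℝ) + j' + 2 ≤ k := by exact_mod_cast hjj
    have hle := mul_le_mul_of_nonneg_left this (by linarith : 0 ≤ 2 * δ)
    exact add_lt_pi_of_touches hcos hbπ hbπ' (by positivity) (by positivity)
      (by linarith) (h (small j (by omega))) (h' (small j' (by omega)))
  by_cases c0 : j₀ + 1 ≤ k
  · by_cases c1 : j₁ + 1 ≤ k
    · by_cases c2 : j₂ + 1 ≤ k
      · have hjr : (j₀ : ℝ) + j₁ + j₂ + 2 = 2 * k := by exact_mod_cast hj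
        refine triangle_contradiction (Δ := 2 * δ) (by linarith) (by nlinarith) hb0π hb1π hb2π
          (by linarith) (by positivity) (small _ c0) (by positivity) (small _ c1)
          (by positivity) (small _ c2) ?_ (hc0 (small _ c0)) (hc1 (small _ c1)) (hc2 (small _ c2))
        have : 2 * δ * ((j₀ : ℝ) + 1) + 2 * δ * (j₁ + 1) + 2 * δ * (j₂ + 1) =
          2 * δ * (2 * k + 1) := by rw [← hjr]; ring
        rw [this]; linarith
      · linarith [long j₀ j₁ b₀ b₁ hb0 hb0π hb1π (by omega) hc0 hc1]
    · linarith [long j₀ j₂ b₀ b₂ hb0 hb0π hb2π (by omega) hc0 hc2]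
  · linarith [long j₁ j₂ b₁ b₂ hb1 hb1π hb2π (by omega) hc1 hc2]

/-- No three contact points, met in this order, surround the origin clockwise. -/
theorem no_negative_triangle (H : LuneOscillation X P δ k) (hδ : 0 < δ)
    (hk : (k + 1) * (2 * δ) ≤ Real.pi) {L₀ L₁ L₂ ε₀ ε₁ ε₂ : ℝ} (h01 : L₀ < L₁) (h12 : L₁ < L₂)
    (h20 : L₂ < L₀ + 2 * Real.pi * k) (T0 : Touch X P δ L₀ ε₀) (T1 : Touch X P δ L₁ ε₁)
    (T2 : Touch X P δ L₂ ε₂)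
    (s01 : Real.sin (L₁ - ε₁ * (Real.pi / 2) - (L₀ - ε₀ * (Real.pi / 2))) < 0)
    (s12 : Real.sin (L₂ - ε₂ * (Real.pi / 2) - (L₁ - ε₁ * (Real.pi / 2))) < 0)
    (s20 : Real.sin (L₀ - ε₀ * (Real.pi / 2) - (L₂ - ε₂ * (Real.pi / 2))) < 0) : False := by
  have hpi := Real.pi_pos
  have s20' : Real.sin (L₀ + 2 * Real.pi * k - ε₀ * (Real.pi / 2) -
      (L₂ - ε₂ * (Real.pi / 2))) < 0 := by
    rw [show L₀ + 2 * Real.pi * k - ε₀ * (Real.pi / 2) - (L₂ - ε₂ * (Real.pi / 2)) =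
      L₀ - ε₀ * (Real.pi / 2) - (L₂ - ε₂ * (Real.pi / 2)) + k * (2 * Real.pi) by ring,
      Real.sin_add_nat_mul_two_pi]
    exact s20
  have neg : ∀ {L L' ε ε' : ℝ}, L < L' → Touch X P δ L ε → Touch X P δ L' ε' →
      Real.sin (L' - ε' * (Real.pi / 2) - (L - ε * (Real.pi / 2))) < 0 →
      ∃ (j : ℕ) (b : ℝ), 0 < b ∧ b < Real.pi ∧ L' - L = j * Real.pi + b ∧
      (∃ n : ℤ, L' - ε' * (Real.pi / 2) - (L - ε * (Real.pi / 2)) =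
        b - Real.pi + n * (2 * Real.pi)) ∧ Real.pi - b < 2 * δ * (j + 1) := by
    intro L L' ε ε' hL T T' hs
    obtain ⟨j, b, hb, hbπ, ha, ⟨⟨n, hn⟩, -⟩ | h⟩ :=
      H.two_touches hδ hL T.1 T.2.1 T.2.2 T'.1 T'.2.1
    · rw [hn, Real.sin_add_int_mul_two_pi] at hs
      linarith [Real.sin_nonneg_of_nonneg_of_le_pi hb.le hbπ]
    · refine ⟨j, b, hb, lt_of_le_of_ne hbπ ?_, ha, h⟩
      rintro rfl
      obtain ⟨⟨n, hn⟩, -⟩ := h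
      rw [hn, Real.sin_add_int_mul_two_pi, sub_self, Real.sin_zero] at hs
      exact lt_irrefl _ hs
  obtain ⟨j₀, b₀, hb0, hb0π, ha0, ⟨n₀, hn0⟩, hc0⟩ := neg h01 T0 T1 s01
  obtain ⟨j₁, b₁, hb1, hb1π, ha1, ⟨n₁, hn1⟩, hc1⟩ := neg h12 T1 T2 s12
  obtain ⟨j₂, b₂, hb2, hb2π, ha2, ⟨n₂, hn2⟩, hc2⟩ := neg h20 T2 (Touch.add_period H T0) s20'
  have hsum : (Real.pi - b₀) + (Real.pi - b₁) + (Real.pi - b₂) =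
      ((n₀ + n₁ + n₂ - k : ℤ) : ℝ) * (2 * Real.pi) := by
    push_cast; linarith
  have hN : (n₀ + n₁ + n₂ - k : ℤ) = 1 :=
    int_eq_one_of_mul_two_pi hsum (by linarith) (by linarith)
  rw [hN] at hsum
  push_cast at hsum
  have hj : (j₀ : ℝ) + j₁ + j₂ + 1 = 2 * k := by
    have : ((j₀ : ℝ) + j₁ + j₂ + 1) * Real.pi = (2 * k) * Real.pi := by linarith
    exact mul_right_cancel₀ hpi.ne' this
  have : 2 * δ * ((j₀ : ℝ) + 1) + 2 * δ * (j₁ + 1) + 2 * δ * (j₂ + 1) =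
    2 * ((k + 1) * (2 * δ)) := by linear_combination 2 * δ * hj
  linarith

/-- Three contact points are not positively dependent. -/
theorem no_triangle (H : LuneOscillation X P δ k) (hδ : 0 < δ) (hk1 : 1 ≤ k)
    (hk : (k + 1) * (2 * δ) ≤ Real.pi) {L₀ L₁ L₂ ε₀ ε₁ ε₂ w₀ w₁ w₂ : ℝ}
    (h01 : L₀ < L₁) (h12 : L₁ < L₂)
    (h20 : L₂ < L₀ + 2 * Real.pi * k) (T0 : Touch X P δ L₀ ε₀) (T1 : Touch X P δ L₁ ε₁)
    (T2 : Touch X P δ L₂ ε₂) (hw0 : 0 < w₀) (hw1 : 0 < w₁) (hw2 : 0 < w₂)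
    (hc : w₀ * Real.cos (L₀ - ε₀ * (Real.pi / 2)) + w₁ * Real.cos (L₁ - ε₁ * (Real.pi / 2)) +
      w₂ * Real.cos (L₂ - ε₂ * (Real.pi / 2)) = 0)
    (hs : w₀ * Real.sin (L₀ - ε₀ * (Real.pi / 2)) + w₁ * Real.sin (L₁ - ε₁ * (Real.pi / 2)) +
      w₂ * Real.sin (L₂ - ε₂ * (Real.pi / 2)) = 0) : False := by
  have n01 := H.no_antipodal hδ hk h01 (by linarith) T0 T1
  have n02 := H.no_antipodal hδ hk (h01.trans h12) h20 T0 T2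
  have key1 := H.no_positive_triangle hδ hk1 hk h01 h12 h20 T0 T1 T2
  have key2 := H.no_negative_triangle hδ hk h01 h12 h20 T0 T1 T2
  generalize L₀ - ε₀ * (Real.pi / 2) = α₀ at *
  generalize L₁ - ε₁ * (Real.pi / 2) = α₁ at *
  generalize L₂ - ε₂ * (Real.pi / 2) = α₂ at *
  have e1 : w₁ * Real.sin (α₁ - α₀) = w₂ * Real.sin (α₀ - α₂) := by
    rw [Real.sin_sub, Real.sin_sub]
    linear_combination Real.cos α₀ * hs - Real.sin α₀ * hc
  have e2 : w₂ * Real.sin (α₂ - α₁) = w₀ * Real.sin (α₁ - α₀) := by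
    rw [Real.sin_sub, Real.sin_sub]
    linear_combination Real.cos α₁ * hs - Real.sin α₁ * hc
  rcases lt_trichotomy (Real.sin (α₁ - α₀)) 0 with h | h | h
  · have f1 : Real.sin (α₀ - α₂) < 0 := by
      by_contra! hh; nlinarith [mul_nonneg hw2.le hh]
    have f2 : Real.sin (α₂ - α₁) < 0 := by
      by_contra! hh; nlinarith [mul_nonneg hw2.le hh]
    exact key2 h f2 f1
  · have f1 : Real.sin (α₂ - α₀) = 0 := by
      have h' : Real.sin (α₀ - α₂) = 0 := by
        rw [h, mul_zero] at e1
        exact (mul_eq_zero.1 e1.symm).resolve_left hw2.ne'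
      rw [← neg_sub, Real.sin_neg, h', neg_zero]
    have e3 : w₀ + w₁ * Real.cos (α₁ - α₀) + w₂ * Real.cos (α₂ - α₀) = 0 := by
      rw [Real.cos_sub, Real.cos_sub]
      linear_combination Real.cos α₀ * hc + Real.sin α₀ * hs - w₀ * Real.sin_sq_add_cos_sq α₀
    have g : ∀ x : ℝ, Real.sin x = 0 → Real.cos x ≠ -1 → Real.cos x = 1 := by
      intro x hx hx'
      have := Real.sin_sq_add_cos_sq x
      rw [hx] at this
      have h2 : (Real.cos x - 1) * (Real.cos x + 1) = 0 := by linarith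
      rcases mul_eq_zero.1 h2 with h2 | h2
      · linarith
      · exact absurd (by linarith) hx'
    rw [g _ h n01, g _ f1 n02] at e3
    linarith
  · have f1 : 0 < Real.sin (α₀ - α₂) := by
      by_contra! hh; nlinarith [mul_nonneg hw2.le (neg_nonneg.2 hh), mul_pos hw1 h]
    have f2 : 0 < Real.sin (α₂ - α₁) := by
      by_contra! hh; nlinarith [mul_nonneg hw2.le (neg_nonneg.2 hh), mul_pos hw0 h]
    exact key1 h f2 f1

/-- The contact points of the caustic band with the horizontal plane lie in an open half of the
horizontal circle. -/
theorem zero_notMem_convexHull (H : LuneOscillation X P δ k) (hδ : 0 < δ) (hk1 : 1 ≤ k)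
    (hk : (k + 1) * (2 * δ) ≤ Real.pi) {S : Set ℂ}
    (hS : ∀ z ∈ S, ∃ L ε, 0 ≤ L ∧ L < 2 * Real.pi * k ∧ Touch X P δ L ε ∧
      z = ⟨Real.cos (L - ε * (Real.pi / 2)), Real.sin (L - ε * (Real.pi / 2))⟩) :
    (0 : ℂ) ∉ convexHull ℝ S := by
  intro h0
  obtain ⟨ι, hι, z, w, hz, hind, hw, hw1, hwz⟩ := eq_pos_convex_span_of_mem_convexHull h0
  -- a shortest convex combination has at most three points, by Carathéodory
  have hcard : Fintype.card ι ≤ 3 := by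
    have := hind.card_le_finrank_succ
    have h2 := Submodule.finrank_le (vectorSpan ℝ (Set.range z))
    rw [Complex.finrank_real_complex] at h2
    omega
  choose! L ε hL0 hLk hT hzL using fun i => hS (z i) (hz ⟨i, rfl⟩)
  have hre : ∑ i, w i * Real.cos (L i - ε i * (Real.pi / 2)) = 0 := by
    have := congrArg Complex.re hwz
    simp only [Complex.re_sum, Complex.smul_re, Complex.zero_re, smul_eq_mul] at this
    rw [← this]
    exact Finset.sum_congr rfl fun i _ => by rw [hzL i]
  have him : ∑ i, w i * Real.sin (L i - ε i * (Real.pi / 2)) = 0 := by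
    have := congrArg Complex.im hwz
    simp only [Complex.im_sum, Complex.smul_im, Complex.zero_im, smul_eq_mul] at this
    rw [← this]
    exact Finset.sum_congr rfl fun i _ => by rw [hzL i]
  have hinj : ∀ i j, i ≠ j → L i ≠ L j := by
    intro i j hij hl
    apply hij
    apply hind.injective
    have hε : ε i = ε j := by
      have h1 := (hT i).2.1
      rw [hl, (hT j).2.1] at h1
      have hb := (abs_nonneg _).trans (H.bound 0)
      have hkr : (1 : ℝ) ≤ k := by exact_mod_cast hk1
      have : (0 : ℝ) < Real.pi / 2 - δ := by nlinarith [Real.pi_pos]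
      exact (mul_right_cancel₀ this.ne' h1).symm
    rw [hzL i, hzL j, hl, hε]
  obtain ⟨n, hcard, ⟨e⟩⟩ : ∃ n ≤ 3, Nonempty (Fin n ≃ ι) :=
    ⟨_, hcard, ⟨(Fintype.equivFin ι).symm⟩⟩
  rw [← e.sum_comp] at hre him hw1
  have hij : ∀ a b : Fin n, a ≠ b → L (e a) ≠ L (e b) := fun a b hab =>
    hinj _ _ fun h => hab (e.injective h)
  have wrap : ∀ i j, L j < L i + 2 * Real.pi * k := fun i j => by linarith [hL0 i, hLk j]
  interval_cases n
  · simp at hw1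
  · simp only [Fin.sum_univ_one] at hre him hw1
    rw [hw1, one_mul] at hre him
    have := Real.sin_sq_add_cos_sq (L (e 0) - ε (e 0) * (Real.pi / 2))
    rw [hre, him] at this
    norm_num at this
  · simp only [Fin.sum_univ_two] at hre him
    have key : ∀ i j, L i < L j →
        w i * Real.cos (L i - ε i * (Real.pi / 2)) + w j * Real.cos (L j - ε j * (Real.pi / 2)) = 0 →
        w i * Real.sin (L i - ε i * (Real.pi / 2)) + w j * Real.sin (L j - ε j * (Real.pi / 2)) = 0 →
        False := by
      intro i j hlt h1 h2
      apply H.no_antipodal hδ hk hlt (wrap i j) (hT i) (hT j)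
      have hi := hw i
      have hj := hw j
      generalize L i - ε i * (Real.pi / 2) = α at *
      generalize L j - ε j * (Real.pi / 2) = β at *
      have q1 := Real.sin_sq_add_cos_sq α
      have q2 := Real.sin_sq_add_cos_sq β
      have q3 : w i + w j * Real.cos (β - α) = 0 := by
        rw [Real.cos_sub]
        linear_combination Real.cos α * h1 + Real.sin α * h2 - w i * q1
      have q4 : w j + w i * Real.cos (β - α) = 0 := by
        rw [Real.cos_sub]
        linear_combination Real.cos β * h1 + Real.sin β * h2 - w j * q2
      have q5 : (w i + w j) * (Real.cos (β - α) + 1) = 0 := by linarith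
      have := (mul_eq_zero.1 q5).resolve_left (by positivity)
      linarith
    rcases lt_or_gt_of_ne (hij 0 1 (by decide)) with h | h
    · exact key _ _ h hre him
    · exact key _ _ h (by linarith) (by linarith)
  · simp only [Fin.sum_univ_three] at hre him
    have key : ∀ i j l, L i < L j → L j < L l →
        w i * Real.cos (L i - ε i * (Real.pi / 2)) + w j * Real.cos (L j - ε j * (Real.pi / 2)) +
          w l * Real.cos (L l - ε l * (Real.pi / 2)) = 0 →
        w i * Real.sin (L i - ε i * (Real.pi / 2)) + w j * Real.sin (L j - ε j * (Real.pi / 2)) +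
          w l * Real.sin (L l - ε l * (Real.pi / 2)) = 0 → False :=
      fun i j l h1 h2 h3 h4 => H.no_triangle hδ hk1 hk h1 h2 (wrap i l) (hT i) (hT j) (hT l)
        (hw i) (hw j) (hw l) h3 h4
    rcases lt_or_gt_of_ne (hij 0 1 (by decide)) with a | a <;>
    rcases lt_or_gt_of_ne (hij 1 2 (by decide)) with b | b <;>
    rcases lt_or_gt_of_ne (hij 0 2 (by decide)) with c | c <;>
    first
    | exact key _ _ _ a b (by linarith) (by linarith)
    | exact key _ _ _ c b (by linarith) (by linarith)
    | exact key _ _ _ b c (by linarith) (by linarith)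
    | exact key _ _ _ a c (by linarith) (by linarith)
    | exact key _ _ _ c a (by linarith) (by linarith)
    | exact key _ _ _ b a (by linarith) (by linarith)

end LuneOscillation

end

section

/-! ### Frames in a closed hemisphere -/

/-- The identities between the entries of a rotation matrix that are used below. -/
theorem so3_entries {M : Matrix (Fin 3) (Fin 3) ℝ} (hM : M ∈ Matrix.specialOrthogonalGroup (Fin 3) ℝ) :
    (∀ i j, ∑ l, M i l * M j l = if i = j then 1 else 0) ∧
    (∀ i j, ∑ l, M l i * M l j = if i = j then 1 else 0) ∧
    M 0 0 * M 1 1 - M 1 0 * M 0 1 = M 2 2 ∧ M 0 1 * M 1 2 - M 1 1 * M 0 2 = M 2 0 := by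
  obtain ⟨h1, h2⟩ := Matrix.mem_specialOrthogonalGroup_iff.1 hM
  have hr : M * M.transpose = 1 := by
    simpa [Matrix.star_eq_conjTranspose] using (Matrix.mem_orthogonalGroup_iff (Fin 3) ℝ).1 h1
  have hc : M.transpose * M = 1 := by
    simpa [Matrix.star_eq_conjTranspose] using (Matrix.mem_orthogonalGroup_iff' (Fin 3) ℝ).1 h1
  have hr' : ∀ i j, ∑ l, M i l * M j l = if i = j then 1 else 0 := fun i j => by
    have := congrFun (congrFun hr i) j
    simpa [Matrix.mul_apply, Matrix.one_apply] using this
  have hc' : ∀ i j, ∑ l, M l i * M l j = if i = j then 1 else 0 := fun i j => by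
    have := congrFun (congrFun hc i) j
    simpa [Matrix.mul_apply, Matrix.one_apply] using this
  refine ⟨hr', hc', ?_⟩
  have had : M.adjugate = M.transpose := by
    have h3 : M * M.adjugate = 1 := by rw [Matrix.mul_adjugate, h2, one_smul]
    calc M.adjugate = (M.transpose * M) * M.adjugate := by rw [hc, one_mul]
      _ = M.transpose := by rw [mul_assoc, h3, mul_one]
  have e : ∀ i j, M.adjugate i j = M j i := fun i j => by rw [had, Matrix.transpose_apply]
  have e22 := e 2 2
  have e02 := e 0 2
  rw [Matrix.adjugate_fin_three] at e22 e02
  simp at e22 e02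
  constructor <;> linarith

/-- The `i`-th coordinate of the point at the angle `θ` from the position vector towards the normal
vector of the frame `M`: a point of the caustic band. -/
def band (M : Matrix (Fin 3) (Fin 3) ℝ) (θ : ℝ) (i : Fin 3) : ℝ :=
  Real.cos θ * M i 0 + Real.sin θ * M i 2

/-- `A` is, on `[0, 1]`, the frame of a curve of speed `v` and of curvature `w / v`. -/
structure IsFrame (A : ℝ → Matrix (Fin 3) (Fin 3) ℝ) (v w : ℝ → ℝ) : Prop where
  mem : ∀ t, A t ∈ Matrix.specialOrthogonalGroup (Fin 3) ℝ
  deriv_pos : ∀ i, HasACDeriv (fun t => A t i 0) (fun t => v t * A t i 1)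
  deriv_tan : ∀ i, HasACDeriv (fun t => A t i 1) (fun t => -v t * A t i 0 + w t * A t i 2)
  deriv_nor : ∀ i, HasACDeriv (fun t => A t i 2) (fun t => -w t * A t i 1)

theorem IsFrame.band {A : ℝ → Matrix (Fin 3) (Fin 3) ℝ} {v w : ℝ → ℝ} (hA : IsFrame A v w)
    (θ : ℝ) (i : Fin 3) : HasACDeriv (fun t => band (A t) θ i)
      (fun t => (v t * Real.cos θ - w t * Real.sin θ) * A t i 1) := by
  refine (((hA.deriv_pos i).const_mul (Real.cos θ)).add
    ((hA.deriv_nor i).const_mul (Real.sin θ))).congr_deriv (Eventually.of_forall fun t _ => ?_)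
  ring

/-- The speed and the curvature lie in the range given by the band `[θ₂, θ₁]`: the boundary curve
at `θ₂` moves along the tangent and the one at `θ₁` moves against it. -/
def InBand (v w : ℝ → ℝ) (θ₁ θ₂ : ℝ) : Prop :=
  ∀ᵐ t, t ∈ Ioo (0 : ℝ) 1 →
    0 < v t * Real.cos θ₂ - w t * Real.sin θ₂ ∧ v t * Real.cos θ₁ - w t * Real.sin θ₁ < 0

/-- A nonnegative function with derivative `c g`, `c > 0`, on a circle vanishes only
where `g` vanishes. -/
theorem eq_zero_of_touch {f g c : ℝ → ℝ} (hf : HasACDeriv f (fun t => c t * g t))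
    (hg : ContinuousOn g (Icc 0 1)) (hc : ∀ᵐ t, t ∈ Ioo (0 : ℝ) 1 → 0 < c t)
    (hf0 : ∀ t ∈ Icc (0 : ℝ) 1, 0 ≤ f t) (hper : f 0 = f 1) (hper' : g 0 = g 1)
    {t : ℝ} (ht : t ∈ Icc (0 : ℝ) 1) (hft : f t = 0) : g t = 0 := by
  -- if `g < 0` at a zero of `f`, then `f` is negative right of it
  have right : ∀ t ∈ Ico (0 : ℝ) 1, f t = 0 → 0 ≤ g t := by
    intro t ht hft
    by_contra! hgt
    have hcont := hg t ⟨ht.1, ht.2.le⟩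
    have hev : ∀ᶠ s in 𝓝[Icc 0 1] t, g s < 0 := hcont.eventually_lt_const hgt
    obtain ⟨η, hη, hball⟩ := Metric.mem_nhdsWithin_iff.1 hev
    set b := min 1 (t + η / 2) with hb
    have htb : t < b := lt_min ht.2 (by linarith)
    have := hf.neg.lt_of_deriv_pos (a := t) (b := b) ht.1 htb (min_le_left _ _) (by
      filter_upwards [hc] with s hs hst
      have hs1 : s < 1 := hst.2.trans_le (min_le_left _ _)
      have hs2 : s < t + η / 2 := hst.2.trans_le (min_le_right _ _)
      have hs0 : 0 < s := ht.1.trans_lt hst.1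
      have hgs : g s < 0 := hball ⟨by
        rw [Metric.mem_ball, Real.dist_eq, abs_of_pos (by linarith [hst.1])]; linarith,
        hs0.le, hs1.le⟩
      have := hs ⟨hs0, hs1⟩
      nlinarith)
    have h0 := hf0 b ⟨ht.1.trans htb.le, min_le_left _ _⟩
    linarith
  -- if `g > 0` at a zero of `f`, then `f` is negative left of it
  have left : ∀ t ∈ Ioc (0 : ℝ) 1, f t = 0 → g t ≤ 0 := by
    intro t ht hft
    by_contra! hgt
    have hcont := hg t ⟨ht.1.le, ht.2⟩
    have hev : ∀ᶠ s in 𝓝[Icc 0 1] t, 0 < g s := hcont.eventually_const_lt hgt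
    obtain ⟨η, hη, hball⟩ := Metric.mem_nhdsWithin_iff.1 hev
    set b := max 0 (t - η / 2) with hb
    have htb : b < t := max_lt ht.1 (by linarith)
    have := hf.lt_of_deriv_pos (a := b) (b := t) (le_max_left _ _) htb ht.2 (by
      filter_upwards [hc] with s hs hst
      have hs0 : 0 < s := (le_max_left _ _).trans_lt hst.1
      have hs2 : t - η / 2 < s := (le_max_right _ _).trans_lt hst.1
      have hs1 : s < 1 := hst.2.trans_le ht.2
      have hgs : 0 < g s := hball ⟨by
        rw [Metric.mem_ball, Real.dist_eq, abs_of_neg (by linarith [hst.2])]; linarith,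
        hs0.le, hs1.le⟩
      exact mul_pos (hs ⟨hs0, hs1⟩) hgs)
    have h0 := hf0 b ⟨le_max_left _ _, htb.le.trans ht.2⟩
    linarith
  rcases eq_or_lt_of_le ht.1 with h0 | h0
  · subst h0
    refine le_antisymm ?_ (right 0 ⟨le_rfl, one_pos⟩ hft)
    rw [hper']
    exact left 1 ⟨one_pos, le_rfl⟩ (by rw [← hper, hft])
  · rcases eq_or_lt_of_le ht.2 with h1 | h1
    · subst h1
      refine le_antisymm (left 1 ⟨one_pos, le_rfl⟩ hft) ?_
      rw [← hper']
      exact right 0 ⟨le_rfl, one_pos⟩ (by rw [hper, hft])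
    · exact le_antisymm (left t ⟨h0, ht.2⟩ hft) (right t ⟨ht.1, h1⟩ hft)

/-- The components, in the moving frame, of a fixed vector `h`. -/
def bodyComp (M : Matrix (Fin 3) (Fin 3) ℝ) (h : Fin 3 → ℝ) (j : Fin 3) : ℝ := ∑ i, h i * M i j

/-- The height of a point of the band in the direction `h`. -/
def bandHeight (M : Matrix (Fin 3) (Fin 3) ℝ) (h : Fin 3 → ℝ) (θ : ℝ) : ℝ := ∑ i, h i * band M θ i

theorem bandHeight_eq (M : Matrix (Fin 3) (Fin 3) ℝ) (h : Fin 3 → ℝ) (θ : ℝ) :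
    bandHeight M h θ = Real.cos θ * bodyComp M h 0 + Real.sin θ * bodyComp M h 2 := by
  simp only [bandHeight, bodyComp, band, Fin.sum_univ_three]; ring

theorem sum_sq_bodyComp {M : Matrix (Fin 3) (Fin 3) ℝ}
    (hM : M ∈ Matrix.specialOrthogonalGroup (Fin 3) ℝ) (h : Fin 3 → ℝ) :
    bodyComp M h 0 ^ 2 + bodyComp M h 1 ^ 2 + bodyComp M h 2 ^ 2 = ∑ i, h i ^ 2 := by
  have o := (so3_entries hM).1
  have o00 := o 0 0
  have o11 := o 1 1
  have o22 := o 2 2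
  have o01 := o 0 1
  have o02 := o 0 2
  have o12 := o 1 2
  simp [Fin.sum_univ_three] at o00 o11 o22 o01 o02 o12
  simp only [bodyComp, Fin.sum_univ_three]
  linear_combination h 0 ^ 2 * o00 + h 1 ^ 2 * o11 + h 2 ^ 2 * o22 + 2 * h 0 * h 1 * o01 +
    2 * h 0 * h 2 * o02 + 2 * h 1 * h 2 * o12

namespace IsFrame

variable {A : ℝ → Matrix (Fin 3) (Fin 3) ℝ} {v w : ℝ → ℝ} {θ₁ θ₂ : ℝ}

theorem bodyComp_continuousOn (hA : IsFrame A v w) (h : Fin 3 → ℝ) (j : Fin 3) :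
    ContinuousOn (fun t => bodyComp (A t) h j) (Icc 0 1) := by
  refine continuousOn_finsetSum _ fun i _ => continuousOn_const.mul ?_
  fin_cases j
  · exact (hA.deriv_pos i).continuousOn
  · exact (hA.deriv_tan i).continuousOn
  · exact (hA.deriv_nor i).continuousOn

theorem bandHeight (hA : IsFrame A v w) (h : Fin 3 → ℝ) (θ : ℝ) :
    HasACDeriv (fun t => bandHeight (A t) h θ)
      (fun t => (v t * Real.cos θ - w t * Real.sin θ) * bodyComp (A t) h 1) := by
  refine (HasACDeriv.sum Finset.univ fun i _ => (hA.band θ i).const_mul (h i)).congr_deriv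
    (Eventually.of_forall fun t _ => ?_)
  simp only [bodyComp, Fin.sum_univ_three]; ring

/-- Where the band of a closed curve in the closed half space `h ≥ 0` touches the boundary plane,
the tangent is parallel to this plane. -/
theorem tangent_perp (hA : IsFrame A v w) (hB : InBand v w θ₁ θ₂) (hcl : A 0 = A 1)
    {h : Fin 3 → ℝ} (n₁ : ∀ t ∈ Icc (0 : ℝ) 1, 0 ≤ SphereCurves.bandHeight (A t) h θ₁)
    (n₂ : ∀ t ∈ Icc (0 : ℝ) 1, 0 ≤ SphereCurves.bandHeight (A t) h θ₂)
    {t : ℝ} (ht : t ∈ Icc (0 : ℝ) 1)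
    (hz : SphereCurves.bandHeight (A t) h θ₁ = 0 ∨ SphereCurves.bandHeight (A t) h θ₂ = 0) :
    bodyComp (A t) h 1 = 0 := by
  have hcont := hA.bodyComp_continuousOn h 1
  rcases hz with hz | hz
  · have := eq_zero_of_touch (f := fun t => SphereCurves.bandHeight (A t) h θ₁)
      (g := fun t => -bodyComp (A t) h 1)
      (c := fun t => -(v t * Real.cos θ₁ - w t * Real.sin θ₁))
      ((hA.bandHeight h θ₁).congr_deriv (Eventually.of_forall fun t _ => by ring)) hcont.neg
      (by filter_upwards [hB] with t h ht; linarith [(h ht).2]) n₁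
      (by simp only [hcl]) (by simp only [hcl]) ht hz
    linarith
  · exact eq_zero_of_touch (f := fun t => SphereCurves.bandHeight (A t) h θ₂)
      (g := fun t => bodyComp (A t) h 1)
      (c := fun t => (v t * Real.cos θ₂ - w t * Real.sin θ₂))
      (hA.bandHeight h θ₂) hcont
      (by filter_upwards [hB] with t h ht; exact (h ht).1) n₂
      (by simp only [hcl]) (by simp only [hcl]) ht hz

/-- If both ends of an arc of the band have height zero, so has the whole great circle. -/
theorem eq_zero_of_bandHeight {M : Matrix (Fin 3) (Fin 3) ℝ} {h : Fin 3 → ℝ}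
    (hs : Real.sin (θ₁ - θ₂) ≠ 0) (h₁ : SphereCurves.bandHeight M h θ₁ = 0)
    (h₂ : SphereCurves.bandHeight M h θ₂ = 0) : bodyComp M h 0 = 0 ∧ bodyComp M h 2 = 0 := by
  rw [bandHeight_eq] at h₁ h₂
  have k1 : Real.sin (θ₁ - θ₂) * bodyComp M h 0 = 0 := by
    rw [Real.sin_sub]; linear_combination Real.sin θ₁ * h₂ - Real.sin θ₂ * h₁
  have k2 : Real.sin (θ₁ - θ₂) * bodyComp M h 2 = 0 := by
    rw [Real.sin_sub]; linear_combination Real.cos θ₂ * h₁ - Real.cos θ₁ * h₂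
  exact ⟨(mul_eq_zero.1 k1).resolve_left hs, (mul_eq_zero.1 k2).resolve_left hs⟩

/-- The tangent is never parallel to `h`, so that its projection along `h` has a direction. -/
theorem normal_part_pos (hA : IsFrame A v w) (hB : InBand v w θ₁ θ₂) (hcl : A 0 = A 1)
    {h : Fin 3 → ℝ} (hh : 0 < ∑ i, h i ^ 2)
    (n₁ : ∀ t ∈ Icc (0 : ℝ) 1, 0 ≤ SphereCurves.bandHeight (A t) h θ₁)
    (n₂ : ∀ t ∈ Icc (0 : ℝ) 1, 0 ≤ SphereCurves.bandHeight (A t) h θ₂)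
    {t : ℝ} (ht : t ∈ Icc (0 : ℝ) 1) :
    0 < bodyComp (A t) h 0 ^ 2 + bodyComp (A t) h 2 ^ 2 := by
  by_contra! hc
  have h0 : bodyComp (A t) h 0 = 0 := by
    nlinarith [sq_nonneg (bodyComp (A t) h 0), sq_nonneg (bodyComp (A t) h 2)]
  have h2 : bodyComp (A t) h 2 = 0 := by
    nlinarith [sq_nonneg (bodyComp (A t) h 0), sq_nonneg (bodyComp (A t) h 2)]
  have h1 := hA.tangent_perp hB hcl n₁ n₂ ht (Or.inl (by rw [bandHeight_eq, h0, h2]; ring))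
  have := sum_sq_bodyComp (hA.mem t) h
  rw [h0, h1, h2] at this
  norm_num at this
  linarith

end IsFrame

/-- The frame of a closed curve whose band `[θ₂, θ₁]` stays in the closed upper half space; the
height is the third coordinate. -/
structure UpperFrame (A : ℝ → Matrix (Fin 3) (Fin 3) ℝ) (v w : ℝ → ℝ) (θ₁ θ₂ : ℝ) : Prop
    extends IsFrame A v w where
  inBand : InBand v w θ₁ θ₂
  closed : A 0 = A 1
  lt : θ₂ < θ₁
  sub_lt : θ₁ - θ₂ < Real.pi
  nonneg₁ : ∀ t ∈ Icc (0 : ℝ) 1, 0 ≤ band (A t) θ₁ 2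
  nonneg₂ : ∀ t ∈ Icc (0 : ℝ) 1, 0 ≤ band (A t) θ₂ 2

namespace UpperFrame

variable {A : ℝ → Matrix (Fin 3) (Fin 3) ℝ} {v w : ℝ → ℝ} {θ₁ θ₂ : ℝ}

theorem tangent_horizontal (hA : UpperFrame A v w θ₁ θ₂) {t : ℝ} (ht : t ∈ Icc (0 : ℝ) 1)
    (h : band (A t) θ₁ 2 = 0 ∨ band (A t) θ₂ 2 = 0) : A t 2 1 = 0 := by
  have := hA.tangent_perp hA.inBand hA.closed (h := ![0, 0, 1])
    (by simpa [SphereCurves.bandHeight, Fin.sum_univ_three] using hA.nonneg₁)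
    (by simpa [SphereCurves.bandHeight, Fin.sum_univ_three] using hA.nonneg₂) ht
    (by simpa [SphereCurves.bandHeight, Fin.sum_univ_three] using h)
  simpa [bodyComp, Fin.sum_univ_three] using this

theorem sin_sub_pos (hA : UpperFrame A v w θ₁ θ₂) : 0 < Real.sin (θ₁ - θ₂) :=
  Real.sin_pos_of_pos_of_lt_pi (by linarith [hA.lt]) hA.sub_lt

theorem normal_part_pos (hA : UpperFrame A v w θ₁ θ₂) {t : ℝ} (ht : t ∈ Icc (0 : ℝ) 1) :
    0 < A t 2 0 ^ 2 + A t 2 2 ^ 2 := by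
  have := hA.toIsFrame.normal_part_pos hA.inBand hA.closed (h := ![0, 0, 1])
    (by simp [Fin.sum_univ_three])
    (by simpa [SphereCurves.bandHeight, Fin.sum_univ_three] using hA.nonneg₁)
    (by simpa [SphereCurves.bandHeight, Fin.sum_univ_three] using hA.nonneg₂) ht
  simpa [bodyComp, Fin.sum_univ_three] using this

theorem horizontal_sq (hA : UpperFrame A v w θ₁ θ₂) (t : ℝ) :
    A t 0 1 ^ 2 + A t 1 1 ^ 2 = A t 2 0 ^ 2 + A t 2 2 ^ 2 := by
  have h1 := (so3_entries (hA.mem t)).1 2 2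
  have h2 := (so3_entries (hA.mem t)).2.1 1 1
  simp only [Fin.sum_univ_three, if_true] at h1 h2
  linarith

/-- The horizontal projection of the tangent rotates counterclockwise. -/
theorem angular_speed_pos (hA : UpperFrame A v w θ₁ θ₂) : ∀ᵐ t, t ∈ Ioo (0 : ℝ) 1 →
    0 < v t * A t 2 2 + w t * A t 2 0 := by
  filter_upwards [hA.inBand] with t h ht
  obtain ⟨ha, hb⟩ := h ht
  have ht' := Ioo_subset_Icc_self ht
  have n1 := hA.nonneg₁ t ht'
  have n2 := hA.nonneg₂ t ht'
  have hs := hA.sin_sub_pos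
  have e : Real.sin (θ₁ - θ₂) * (v t * A t 2 2 + w t * A t 2 0) =
      (v t * Real.cos θ₂ - w t * Real.sin θ₂) * band (A t) θ₁ 2 +
      -(v t * Real.cos θ₁ - w t * Real.sin θ₁) * band (A t) θ₂ 2 := by
    rw [Real.sin_sub]; simp only [SphereCurves.band]; ring
  have hpos : 0 < band (A t) θ₁ 2 ∨ 0 < band (A t) θ₂ 2 := by
    by_contra! hc
    have z1 : band (A t) θ₁ 2 = 0 := le_antisymm hc.1 n1
    have z2 : band (A t) θ₂ 2 = 0 := le_antisymm hc.2 n2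
    have hp := hA.normal_part_pos ht'
    have hz := IsFrame.eq_zero_of_bandHeight (M := A t) (h := ![0, 0, 1]) hs.ne'
      (by simpa [SphereCurves.bandHeight, Fin.sum_univ_three] using z1)
      (by simpa [SphereCurves.bandHeight, Fin.sum_univ_three] using z2)
    simp only [bodyComp, Fin.sum_univ_three] at hz
    simp at hz
    rw [hz.1, hz.2] at hp
    norm_num at hp
  have : 0 < Real.sin (θ₁ - θ₂) * (v t * A t 2 2 + w t * A t 2 0) := by
    rw [e]
    rcases hpos with hp | hp
    · exact add_pos_of_pos_of_nonneg (mul_pos ha hp) (mul_nonneg (by linarith) n2)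
    · exact add_pos_of_nonneg_of_pos (mul_nonneg ha.le n1) (mul_pos (by linarith) hp)
  exact (pos_iff_pos_of_mul_pos this).1 hs

end UpperFrame

/-- The angle by which the projection of the tangent along the direction `u` (in body
coordinates) rotates. -/
def turning (v w : ℝ → ℝ) (u : ℝ → Fin 3 → ℝ) (t : ℝ) : ℝ :=
  ∫ s in (0 : ℝ)..t, (v s * u s 2 + w s * u s 0) / (u s 0 ^ 2 + u s 2 ^ 2)

/-- `turning` is the polar angle of the horizontal projection of the tangent. -/
theorem IsFrame.turning_polar {A : ℝ → Matrix (Fin 3) (Fin 3) ℝ} {v w : ℝ → ℝ}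
    (hA : IsFrame A v w) (hne : ∀ t ∈ Icc (0 : ℝ) 1, 0 < A t 2 0 ^ 2 + A t 2 2 ^ 2)
    (h0 : 0 < A 0 0 1) (h0' : A 0 1 1 = 0) :
    HasACDeriv (turning v w fun t => A t 2)
      (fun s => (v s * A s 2 2 + w s * A s 2 0) / (A s 2 0 ^ 2 + A s 2 2 ^ 2)) ∧
    ∀ t ∈ Icc (0 : ℝ) 1,
      A t 0 1 = √(A t 2 0 ^ 2 + A t 2 2 ^ 2) * Real.cos (turning v w (fun t => A t 2) t) ∧
      A t 1 1 = √(A t 2 0 ^ 2 + A t 2 2 ^ 2) * Real.sin (turning v w (fun t => A t 2) t) := by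
  have hsq : ∀ t, A t 0 1 ^ 2 + A t 1 1 ^ 2 = A t 2 0 ^ 2 + A t 2 2 ^ 2 := fun t => by
    have h1 := (so3_entries (hA.mem t)).1 2 2
    have h2 := (so3_entries (hA.mem t)).2.1 1 1
    simp only [Fin.sum_univ_three, if_true] at h1 h2
    linarith
  have h := polar_of_hasACDeriv (hA.deriv_tan 0) (hA.deriv_tan 1)
    (fun t ht => by rw [hsq]; exact hne t ht) h0 h0'
  have e : ∀ s, (A s 0 1 * (-v s * A s 1 0 + w s * A s 1 2) -
      A s 1 1 * (-v s * A s 0 0 + w s * A s 0 2)) / (A s 2 0 ^ 2 + A s 2 2 ^ 2) =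
      (v s * A s 2 2 + w s * A s 2 0) / (A s 2 0 ^ 2 + A s 2 2 ^ 2) := fun s => by
    obtain ⟨-, -, e1, e2⟩ := so3_entries (hA.mem s)
    rw [← e1, ← e2]; ring
  simp only [hsq, e] at h
  exact h

end

section

/-! ### The longitude as a function of the tangent angle -/

/-- The longitude, in the lune dual to the band with middle angle `m`, of the vertical direction
as seen from the moving frame. -/
def longitude (M : Matrix (Fin 3) (Fin 3) ℝ) (m : ℝ) : ℝ :=
  Real.arcsin ((Real.cos m * M 2 2 - Real.sin m * M 2 0) / √(M 2 0 ^ 2 + M 2 2 ^ 2))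

namespace UpperFrame

variable {A : ℝ → Matrix (Fin 3) (Fin 3) ℝ} {v w : ℝ → ℝ} {m δ : ℝ}

theorem half_pos (hA : UpperFrame A v w (m + δ) (m - δ)) : 0 < δ := by linarith [hA.lt]

theorem half_lt (hA : UpperFrame A v w (m + δ) (m - δ)) : δ < Real.pi / 2 := by
  linarith [hA.sub_lt]

/-- The components of the vertical direction in the normal plane of the curve, in polar
coordinates. The projection of the vertical direction lies in the half plane around the middle of the
band, so that the arcsine in `longitude` is its angle. -/
theorem longitude_spec (hA : UpperFrame A v w (m + δ) (m - δ)) {t : ℝ} (ht : t ∈ Icc (0 : ℝ) 1) :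
    √(A t 2 0 ^ 2 + A t 2 2 ^ 2) * Real.cos (longitude (A t) m) =
      Real.cos m * A t 2 0 + Real.sin m * A t 2 2 ∧
    √(A t 2 0 ^ 2 + A t 2 2 ^ 2) * Real.sin (longitude (A t) m) =
      Real.cos m * A t 2 2 - Real.sin m * A t 2 0 := by
  have hpos := hA.normal_part_pos ht
  set r := √(A t 2 0 ^ 2 + A t 2 2 ^ 2) with hr
  have hr0 : 0 < r := Real.sqrt_pos.2 hpos
  have hr2 : r ^ 2 = A t 2 0 ^ 2 + A t 2 2 ^ 2 := Real.sq_sqrt hpos.le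
  have hcs := Real.sin_sq_add_cos_sq m
  set p := Real.cos m * A t 2 0 + Real.sin m * A t 2 2 with hp
  set q := Real.cos m * A t 2 2 - Real.sin m * A t 2 0 with hq
  have hpq : p ^ 2 + q ^ 2 = r ^ 2 := by
    rw [hr2, hp, hq]; linear_combination (A t 2 0 ^ 2 + A t 2 2 ^ 2) * hcs
  have hp0 : 0 ≤ p := by
    have h1 := hA.nonneg₁ t ht
    have h2 := hA.nonneg₂ t ht
    have hc : 0 < Real.cos δ :=
      Real.cos_pos_of_mem_Ioo ⟨by linarith [hA.half_pos, Real.pi_pos], hA.half_lt⟩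
    simp only [SphereCurves.band, Real.cos_add, Real.cos_sub, Real.sin_add, Real.sin_sub] at h1 h2
    have : 0 ≤ 2 * Real.cos δ * p := by rw [hp]; linarith
    by_contra! hh
    nlinarith
  have hb1 : -1 ≤ q / r := by
    rw [le_div_iff₀ hr0]; nlinarith [sq_nonneg p, abs_le_of_sq_le_sq' (show q ^ 2 ≤ r ^ 2 by nlinarith [sq_nonneg p]) hr0.le]
  have hb2 : q / r ≤ 1 := by
    rw [div_le_one₀ hr0]; exact (abs_le_of_sq_le_sq' (show q ^ 2 ≤ r ^ 2 by nlinarith [sq_nonneg p]) hr0.le).2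
  constructor
  · have : longitude (A t) m = Real.arcsin (q / r) := rfl
    rw [this, Real.cos_arcsin, show 1 - (q / r) ^ 2 = (p / r) ^ 2 by
      field_simp; linarith, Real.sqrt_sq (by positivity)]
    field_simp
  · have : longitude (A t) m = Real.arcsin (q / r) := rfl
    rw [this, Real.sin_arcsin hb1 hb2]
    field_simp

theorem longitude_shift (hA : UpperFrame A v w (m + δ) (m - δ)) {t : ℝ} (ht : t ∈ Icc (0 : ℝ) 1)
    (η : ℝ) :
    √(A t 2 0 ^ 2 + A t 2 2 ^ 2) * Real.cos (longitude (A t) m - η) = band (A t) (m + η) 2 ∧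
    √(A t 2 0 ^ 2 + A t 2 2 ^ 2) * Real.sin (longitude (A t) m - η) =
      Real.cos (m + η) * A t 2 2 - Real.sin (m + η) * A t 2 0 := by
  obtain ⟨h1, h2⟩ := hA.longitude_spec ht
  simp only [SphereCurves.band, Real.cos_sub, Real.sin_sub, Real.cos_add, Real.sin_add]
  constructor
  · linear_combination Real.cos η * h1 + Real.sin η * h2
  · linear_combination Real.cos η * h2 - Real.sin η * h1

theorem abs_longitude_le (hA : UpperFrame A v w (m + δ) (m - δ)) {t : ℝ}
    (ht : t ∈ Icc (0 : ℝ) 1) : |longitude (A t) m| ≤ Real.pi / 2 - δ := by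
  have hr0 : 0 < √(A t 2 0 ^ 2 + A t 2 2 ^ 2) := Real.sqrt_pos.2 (hA.normal_part_pos ht)
  have h1 := (hA.longitude_shift ht δ).1
  have h2 := (hA.longitude_shift ht (-δ)).1
  have n1 := hA.nonneg₁ t ht
  have n2 := hA.nonneg₂ t ht
  rw [← sub_eq_add_neg] at h2
  rw [← h1] at n1
  rw [← h2] at n2
  have c1 := nonneg_of_mul_nonneg_right n1 hr0
  have c2 := nonneg_of_mul_nonneg_right n2 hr0
  have l1 : -(Real.pi / 2) ≤ longitude (A t) m := Real.neg_pi_div_two_le_arcsin _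
  have l2 : longitude (A t) m ≤ Real.pi / 2 := Real.arcsin_le_pi_div_two _
  have := hA.half_pos
  have := hA.half_lt
  rw [abs_le]
  constructor
  · by_contra! hc
    have := Real.cos_neg_of_pi_div_two_lt_of_lt (x := -(longitude (A t) m - δ)) (by linarith)
      (by linarith)
    rw [Real.cos_neg] at this
    linarith
  · by_contra! hc
    have := Real.cos_neg_of_pi_div_two_lt_of_lt (x := longitude (A t) m - -δ) (by linarith)
      (by linarith)
    linarith

/-- The horizontal projection of the band in polar coordinates. -/
theorem band_horizontal (hA : UpperFrame A v w (m + δ) (m - δ)) (h0 : 0 < A 0 0 1)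
    (h0' : A 0 1 1 = 0) {t : ℝ} (ht : t ∈ Icc (0 : ℝ) 1) (η a : ℝ) :
    Real.cos a * band (A t) (m + η) 1 - Real.sin a * band (A t) (m + η) 0 =
      -A t 2 1 * Real.cos (longitude (A t) m - η) *
          Real.sin (turning v w (fun t => A t 2) t - a) -
        Real.sin (longitude (A t) m - η) * Real.cos (turning v w (fun t => A t 2) t - a) := by
  obtain ⟨h1, h2⟩ := hA.longitude_shift ht η
  obtain ⟨h3, h4⟩ := (hA.toIsFrame.turning_polar (fun t ht => hA.normal_part_pos ht) h0 h0').2 t ht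
  have hpos := hA.normal_part_pos ht
  have hr0 : 0 < √(A t 2 0 ^ 2 + A t 2 2 ^ 2) := Real.sqrt_pos.2 hpos
  have hr2 : √(A t 2 0 ^ 2 + A t 2 2 ^ 2) ^ 2 = A t 0 1 ^ 2 + A t 1 1 ^ 2 := by
    rw [Real.sq_sqrt hpos.le, hA.horizontal_sq]
  obtain ⟨-, o, e1, e2⟩ := so3_entries (hA.mem t)
  have o01 := o 0 1
  have o12 := o 1 2
  simp [Fin.sum_univ_three] at o01 o12
  generalize √(A t 2 0 ^ 2 + A t 2 2 ^ 2) = r at *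
  generalize longitude (A t) m = x at *
  generalize turning v w (fun t => A t 2) t = β at *
  have hs : r * Real.sin (β - a) = A t 1 1 * Real.cos a - A t 0 1 * Real.sin a := by
    rw [Real.sin_sub, h3, h4]; ring
  have hc : r * Real.cos (β - a) = A t 0 1 * Real.cos a + A t 1 1 * Real.sin a := by
    rw [Real.cos_sub, h3, h4]; ring
  apply mul_left_cancel₀ (pow_pos hr0 2).ne'
  have : r ^ 2 * (-A t 2 1 * Real.cos (x - η) * Real.sin (β - a) -
      Real.sin (x - η) * Real.cos (β - a)) =
      -A t 2 1 * (r * Real.cos (x - η)) * (r * Real.sin (β - a)) -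
      (r * Real.sin (x - η)) * (r * Real.cos (β - a)) := by ring
  rw [this, h1, h2, hs, hc, hr2]
  simp only [SphereCurves.band]
  have k0 : A t 2 1 * A t 2 0 = -(A t 0 0 * A t 0 1 + A t 1 0 * A t 1 1) := by linarith
  have k2 : A t 2 1 * A t 2 2 = -(A t 0 1 * A t 0 2 + A t 1 1 * A t 1 2) := by linarith
  have : -A t 2 1 * (Real.cos (m + η) * A t 2 0 + Real.sin (m + η) * A t 2 2) =
    -(Real.cos (m + η) * (A t 2 1 * A t 2 0) + Real.sin (m + η) * (A t 2 1 * A t 2 2)) := by ring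
  rw [this, k0, k2, ← e1, ← e2]
  ring

/-- The tangent angle is a strictly increasing function of the parameter. -/
theorem turning_lt (hA : UpperFrame A v w (m + δ) (m - δ)) (h0 : 0 < A 0 0 1)
    (h0' : A 0 1 1 = 0) {s t : ℝ} (hs : 0 ≤ s) (hst : s < t) (ht : t ≤ 1) :
    turning v w (fun t => A t 2) s < turning v w (fun t => A t 2) t := by
  refine (hA.toIsFrame.turning_polar (fun t ht => hA.normal_part_pos ht) h0
    h0').1.lt_of_deriv_pos hs hst ht ?_
  filter_upwards [hA.angular_speed_pos] with x hx hxst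
  have hx1 : x ∈ Ioo (0 : ℝ) 1 := ⟨hs.trans_lt hxst.1, hxst.2.trans_le ht⟩
  exact div_pos (hx hx1) (hA.normal_part_pos (Ioo_subset_Icc_self hx1))

/-- During a half turn of the tangent the boundary curves of the band advance (`η = -δ`),
respectively retreat (`η = δ`), in the horizontal direction across the initial tangent. -/
theorem band_monotone (hA : UpperFrame A v w (m + δ) (m - δ)) (h0 : 0 < A 0 0 1)
    (h0' : A 0 1 1 = 0) {s t a : ℝ} (hs : 0 ≤ s) (hst : s < t) (ht : t ≤ 1)
    (ha : a ≤ turning v w (fun t => A t 2) s)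
    (ha' : turning v w (fun t => A t 2) t ≤ a + Real.pi) :
    Real.cos a * band (A s) (m - δ) 1 - Real.sin a * band (A s) (m - δ) 0 <
      Real.cos a * band (A t) (m - δ) 1 - Real.sin a * band (A t) (m - δ) 0 ∧
    Real.cos a * band (A t) (m + δ) 1 - Real.sin a * band (A t) (m + δ) 0 <
      Real.cos a * band (A s) (m + δ) 1 - Real.sin a * band (A s) (m + δ) 0 := by
  have hd : ∀ θ, HasACDeriv
      (fun t => Real.cos a * SphereCurves.band (A t) θ 1 - Real.sin a * SphereCurves.band (A t) θ 0)
      (fun t => (v t * Real.cos θ - w t * Real.sin θ) *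
        (Real.cos a * A t 1 1 - Real.sin a * A t 0 1)) := fun θ =>
    (((hA.band θ 1).const_mul _).sub ((hA.band θ 0).const_mul _)).congr_deriv
      (Eventually.of_forall fun t _ => by ring)
  have hdir : ∀ x ∈ Ioo s t, 0 < Real.cos a * A x 1 1 - Real.sin a * A x 0 1 := by
    intro x hx
    have hx1 : x ∈ Icc (0 : ℝ) 1 := ⟨hs.trans hx.1.le, hx.2.le.trans ht⟩
    obtain ⟨h3, h4⟩ :=
      (hA.toIsFrame.turning_polar (fun t ht => hA.normal_part_pos ht) h0 h0').2 x hx1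
    have hr0 : 0 < √(A x 2 0 ^ 2 + A x 2 2 ^ 2) := Real.sqrt_pos.2 (hA.normal_part_pos hx1)
    have l1 := hA.turning_lt h0 h0' hs hx.1 hx1.2
    have l2 := hA.turning_lt h0 h0' hx1.1 hx.2 ht
    rw [h3, h4]
    have := Real.sin_pos_of_pos_of_lt_pi
      (x := turning v w (fun t => A t 2) x - a) (by linarith) (by linarith)
    rw [Real.sin_sub] at this
    have := mul_pos hr0 this
    linarith
  constructor
  · refine (hd (m - δ)).lt_of_deriv_pos hs hst ht ?_
    filter_upwards [hA.inBand] with x hx hxst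
    exact mul_pos (hx ⟨hs.trans_lt hxst.1, hxst.2.trans_le ht⟩).1 (hdir x hxst)
  · have := (hd (m + δ)).neg.lt_of_deriv_pos hs hst ht (by
      filter_upwards [hA.inBand] with x hx hxst
      have h1 := (hx ⟨hs.trans_lt hxst.1, hxst.2.trans_le ht⟩).2
      have h2 := hdir x hxst
      nlinarith)
    linarith

/-- The longitude and the slope as functions of the tangent angle form a lune oscillation, and each
point of the curve occurs at some tangent angle in `[0, 2πk]`. -/
theorem exists_luneOscillation (hA : UpperFrame A v w (m + δ) (m - δ)) (h0 : 0 < A 0 0 1)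
    (h0' : A 0 1 1 = 0) {k : ℕ} (hk : 1 ≤ k)
    (hW : turning v w (fun t => A t 2) 1 = 2 * Real.pi * k) :
    ∃ X P : ℝ → ℝ, LuneOscillation X P δ k ∧ ∀ t ∈ Icc (0 : ℝ) 1,
      X (turning v w (fun t => A t 2) t) = longitude (A t) m ∧
      P (turning v w (fun t => A t 2) t) = -A t 2 1 := by
  have hpi := Real.pi_pos
  have hkr : (1 : ℝ) ≤ k := by exact_mod_cast hk
  set β := turning v w (fun t => A t 2) with hβ
  set T := 2 * Real.pi * k with hT
  have hT0 : 0 < T := by positivity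
  have hTpi : Real.pi < T := by nlinarith
  have hβ0 : β 0 = 0 := by simp [β, turning]
  have hcont : ContinuousOn β (Icc 0 1) :=
    (hA.toIsFrame.turning_polar (fun t ht => hA.normal_part_pos ht) h0 h0').1.continuousOn
  have hmono : ∀ s t, 0 ≤ s → s < t → t ≤ 1 → β s < β t := fun s t => hA.turning_lt h0 h0'
  have hsurj : ∀ L, L ∈ Icc 0 T → ∃ t ∈ Icc (0 : ℝ) 1, β t = L := by
    intro L hL
    have := intermediate_value_Icc zero_le_one hcont
    rw [hβ0, hW] at this
    obtain ⟨t, ht, h⟩ := this hL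
    exact ⟨t, ht, h⟩
  choose! τ hτ hβτ using hsurj
  have hmem : ∀ L, toIcoMod hT0 0 L ∈ Icc 0 T := fun L => by
    have := toIcoMod_mem_Ico hT0 0 L
    rw [zero_add] at this
    exact ⟨this.1, this.2.le⟩
  set X : ℝ → ℝ := fun L => longitude (A (τ (toIcoMod hT0 0 L))) m with hX
  set P : ℝ → ℝ := fun L => -A (τ (toIcoMod hT0 0 L)) 2 1 with hP
  have hinj : ∀ s ∈ Icc (0 : ℝ) 1, ∀ t ∈ Icc (0 : ℝ) 1, β s = β t → s = t := by
    intro s hs t ht hst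
    rcases lt_trichotomy s t with h | h | h
    · exact absurd hst (hmono s t hs.1 h ht.2).ne
    · exact h
    · exact absurd hst (hmono t s ht.1 h hs.2).ne'
  -- at the right end of a period the frame is the same as at the left end
  have rep : ∀ (n : ℤ) (L : ℝ), n * T ≤ L → L ≤ (n + 1) * T →
      ∃ t ∈ Icc (0 : ℝ) 1, β t = L - n * T ∧ X L = longitude (A t) m ∧ P L = -A t 2 1 := by
    intro n L h1 h2
    rcases eq_or_lt_of_le h2 with h | h
    · have e : toIcoMod hT0 0 L = 0 := by
        rw [h]
        have : ((n : ℝ) + 1) * T = 0 + (n + 1 : ℤ) • T := by simp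
        rw [this, toIcoMod_add_zsmul, toIcoMod_apply_left]
      have e2 : τ 0 = 0 := hinj _ (hτ 0 ⟨le_rfl, hT0.le⟩) 0 (by simp)
        (by rw [hβτ 0 ⟨le_rfl, hT0.le⟩, hβ0])
      refine ⟨1, by simp, by rw [hW, h]; ring, ?_, ?_⟩
      · simp only [hX, e, e2, hA.closed]
      · simp only [hP, e, e2, hA.closed]
    · have e : toIcoMod hT0 0 L = L - n * T := by
        rw [toIcoMod_eq_iff]
        refine ⟨⟨by linarith, by linarith⟩, n, by simp⟩
      have hm : L - n * T ∈ Icc 0 T := ⟨by linarith, by linarith⟩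
      refine ⟨τ (L - n * T), hτ _ hm, hβτ _ hm, ?_, ?_⟩
      · simp only [hX, e]
      · simp only [hP, e]
  have repT : ∀ L, ∃ t ∈ Icc (0 : ℝ) 1, X L = longitude (A t) m := fun L =>
    ⟨_, hτ _ (hmem L), rfl⟩
  have block : ∀ (n : ℤ) (a L₁ L₂ : ℝ), n * T ≤ L₁ → L₂ ≤ (n + 1) * T → a ≤ L₁ → L₁ < L₂ →
      L₂ ≤ a + Real.pi →
      (P L₁ * Real.cos (X L₁ + δ) * Real.sin (L₁ - a) - Real.sin (X L₁ + δ) * Real.cos (L₁ - a) <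
       P L₂ * Real.cos (X L₂ + δ) * Real.sin (L₂ - a) - Real.sin (X L₂ + δ) * Real.cos (L₂ - a)) ∧
      (P L₂ * Real.cos (X L₂ - δ) * Real.sin (L₂ - a) - Real.sin (X L₂ - δ) * Real.cos (L₂ - a) <
       P L₁ * Real.cos (X L₁ - δ) * Real.sin (L₁ - a) -
        Real.sin (X L₁ - δ) * Real.cos (L₁ - a)) := by
    intro n a L₁ L₂ hn1 hn2 ha1 h12 ha2
    obtain ⟨s, hs, hβs, hXs, hPs⟩ := rep n L₁ hn1 (by linarith)
    obtain ⟨t, ht, hβt, hXt, hPt⟩ := rep n L₂ (by linarith) hn2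
    have hst : s < t := by
      by_contra! hc
      rcases eq_or_lt_of_le hc with h | h
      · rw [h] at hβt; linarith
      · have := hmono t s ht.1 h hs.2; linarith
    have hm := hA.band_monotone h0 h0' (a := a - n * T) hs.1 hst ht.2
      (by rw [← hβ, hβs]; linarith) (by rw [← hβ, hβt]; linarith)
    have e1 := fun η => hA.band_horizontal h0 h0' hs η (a - n * T)
    have e2 := fun η => hA.band_horizontal h0 h0' ht η (a - n * T)
    have f1 : β s - (a - n * T) = L₁ - a := by rw [hβs]; ring
    have f2 : β t - (a - n * T) = L₂ - a := by rw [hβt]; ring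
    simp only [← hβ, f1, f2, ← hXs, ← hXt, ← hPs, ← hPt] at e1 e2
    have g1 := e1 (-δ)
    have g2 := e2 (-δ)
    rw [← sub_eq_add_neg, sub_neg_eq_add] at g1 g2
    rw [g1, g2, e1 δ, e2 δ] at hm
    exact hm
  -- a window of length `π` meets at most one end point of a period
  have all : ∀ (a L₁ L₂ : ℝ), a ≤ L₁ → L₁ < L₂ → L₂ ≤ a + Real.pi →
      (P L₁ * Real.cos (X L₁ + δ) * Real.sin (L₁ - a) - Real.sin (X L₁ + δ) * Real.cos (L₁ - a) <
       P L₂ * Real.cos (X L₂ + δ) * Real.sin (L₂ - a) - Real.sin (X L₂ + δ) * Real.cos (L₂ - a)) ∧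
      (P L₂ * Real.cos (X L₂ - δ) * Real.sin (L₂ - a) - Real.sin (X L₂ - δ) * Real.cos (L₂ - a) <
       P L₁ * Real.cos (X L₁ - δ) * Real.sin (L₁ - a) -
        Real.sin (X L₁ - δ) * Real.cos (L₁ - a)) := by
    intro a L₁ L₂ ha1 h12 ha2
    set n := ⌊L₁ / T⌋ with hn
    have hn1 : n * T ≤ L₁ := by rw [← le_div_iff₀ hT0]; exact Int.floor_le _
    have hn2 : L₁ < (n + 1) * T := by rw [← div_lt_iff₀ hT0]; exact Int.lt_floor_add_one _
    rcases le_or_gt L₂ ((n + 1) * T) with h | h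
    · exact block n a L₁ L₂ hn1 h ha1 h12 ha2
    · have b1 := block n a L₁ ((n + 1) * T) hn1 le_rfl ha1 hn2 (by linarith)
      have b2 := block (n + 1) a ((n + 1) * T) L₂ (by push_cast; exact le_rfl)
        (by push_cast; linarith) (by linarith) h ha2
      exact ⟨b1.1.trans b2.1, b2.2.trans b1.2⟩
  have hper : ∀ L, toIcoMod hT0 0 (L + T) = toIcoMod hT0 0 L := fun L => toIcoMod_add_right _ _ _
  refine ⟨X, P, ⟨fun L => ?_, fun L => ?_, fun L => ?_, fun a L₁ L₂ h1 h2 h3 =>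
    (all a L₁ L₂ h1 h2 h3).1, fun a L₁ L₂ h1 h2 h3 => (all a L₁ L₂ h1 h2 h3).2⟩, ?_⟩
  · simp only [hX]; rw [hper]
  · simp only [hP]; rw [hper]
  · obtain ⟨t, ht, h⟩ := repT L
    rw [h]; exact hA.abs_longitude_le ht
  · intro t ht
    have hb : β t ∈ Icc 0 T := by
      constructor
      · rcases eq_or_lt_of_le ht.1 with h | h
        · rw [← h, hβ0]
        · rw [← hβ0]; exact (hmono 0 t le_rfl h ht.2).le
      · rcases eq_or_lt_of_le ht.2 with h | h
        · rw [h, hW]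
        · rw [← hW]; exact (hmono t 1 ht.1 h le_rfl).le
    obtain ⟨s, hs, hβs, hXs, hPs⟩ := rep 0 (β t) (by simpa using hb.1) (by simpa using hb.2)
    have : s = t := hinj s hs t ht (by rw [hβs]; simp)
    rw [← this] at hXs hPs ⊢
    rw [this] at hXs hPs ⊢
    exact ⟨hXs, hPs⟩

end UpperFrame

end

section

/-! ### Bands in a closed hemisphere that lie in an open half space -/

theorem isCompact_convexHull_of_isCompact {E : Type*} [NormedAddCommGroup E] [NormedSpace ℝ E]
    [FiniteDimensional ℝ E] {K : Set E} (hK : IsCompact K) : IsCompact (convexHull ℝ K) := by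
  have heq : convexHull ℝ K = ⋃ n ∈ Finset.range (Module.finrank ℝ E + 2),
      (fun p : (Fin n → ℝ) × (Fin n → E) => ∑ i, p.1 i • p.2 i) ''
        (stdSimplex ℝ (Fin n) ×ˢ Set.pi univ fun _ => K) := by
    apply Subset.antisymm
    · intro x hx
      obtain ⟨ι, hι, z, w, hz, hind, hw, hw1, hwz⟩ := eq_pos_convex_span_of_mem_convexHull hx
      have hcard : Fintype.card ι < Module.finrank ℝ E + 2 := by
        have := hind.card_le_finrank_succ
        have h2 := Submodule.finrank_le (vectorSpan ℝ (Set.range z))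
        omega
      simp only [mem_iUnion, Finset.mem_range]
      let e := (Fintype.equivFin ι).symm
      refine ⟨_, hcard, ⟨fun i => w (e i), fun i => z (e i)⟩, ⟨⟨fun i => (hw _).le, ?_⟩,
        fun i _ => hz ⟨_, rfl⟩⟩, ?_⟩
      · change ∑ i, w (e i) = 1
        rw [e.sum_comp, hw1]
      · change ∑ i, w (e i) • z (e i) = x
        rw [e.sum_comp fun i => w i • z i, hwz]
    · intro x hx
      simp only [mem_iUnion] at hx
      obtain ⟨n, -, p, ⟨hp1, hp2⟩, rfl⟩ := hx
      exact (convex_convexHull ℝ K).sum_mem (fun i _ => hp1.1 i) hp1.2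
        fun i _ => subset_convexHull ℝ K (hp2 i (mem_univ i))
  rw [heq]
  refine (Finset.range _).isCompact_biUnion fun n _ => ?_
  refine ((isCompact_stdSimplex ℝ (Fin n)).prod (isCompact_univ_pi fun _ => hK)).image ?_
  fun_prop

namespace UpperFrame

variable {A : ℝ → Matrix (Fin 3) (Fin 3) ℝ} {v w : ℝ → ℝ} {m δ : ℝ}

/-- The contact points of the band with the horizontal plane lie in an open half plane. -/
theorem zero_notMem_contact (hA : UpperFrame A v w (m + δ) (m - δ)) (h0 : 0 < A 0 0 1)
    (h0' : A 0 1 1 = 0) {k : ℕ} (hk : 1 ≤ k)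
    (hW : turning v w (fun t => A t 2) 1 = 2 * Real.pi * k) (hkδ : (k + 1) * (2 * δ) ≤ Real.pi) :
    (0 : ℂ) ∉ convexHull ℝ {z : ℂ | ∃ t ∈ Icc (0 : ℝ) 1, ∃ θ, (θ = m + δ ∨ θ = m - δ) ∧
      band (A t) θ 2 = 0 ∧ z = ⟨band (A t) θ 0, band (A t) θ 1⟩} := by
  obtain ⟨X, P, H, hXP⟩ := hA.exists_luneOscillation h0 h0' hk hW
  refine H.zero_notMem_convexHull hA.half_pos hk hkδ ?_
  have hdist : ∀ t ∈ Ico (0 : ℝ) 1, ∀ θ, (θ = m + δ ∨ θ = m - δ) → band (A t) θ 2 = 0 →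
      ∃ L ε, 0 ≤ L ∧ L < 2 * Real.pi * k ∧ LuneOscillation.Touch X P δ L ε ∧
        (⟨band (A t) θ 0, band (A t) θ 1⟩ : ℂ) =
          ⟨Real.cos (L - ε * (Real.pi / 2)), Real.sin (L - ε * (Real.pi / 2))⟩ := by
    intro t ht θ hθ hz
    have ht' := Ico_subset_Icc_self ht
    have hr0 : 0 < √(A t 2 0 ^ 2 + A t 2 2 ^ 2) := Real.sqrt_pos.2 (hA.normal_part_pos ht')
    have hdelta := hA.half_pos
    have hdelta' := hA.half_lt
    have hlon := abs_le.1 (hA.abs_longitude_le ht')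
    have htan : A t 2 1 = 0 := hA.tangent_horizontal ht' (by
      rcases hθ with rfl | rfl
      · exact Or.inl hz
      · exact Or.inr hz)
    obtain ⟨hX, hP⟩ := hXP t ht'
    have hL1 : turning v w (fun t => A t 2) t < 2 * Real.pi * k := by
      rw [← hW]; exact hA.turning_lt h0 h0' ht.1 ht.2 le_rfl
    have hL0 : 0 ≤ turning v w (fun t => A t 2) t := by
      have e0 : turning v w (fun t => A t 2) 0 = 0 := by simp [turning]
      rcases eq_or_lt_of_le ht.1 with h | h
      · rw [← h, e0]
      · rw [← e0]; exact (hA.turning_lt h0 h0' le_rfl h ht.2.le).le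
    rcases hθ with rfl | rfl
    · have hc := (hA.longitude_shift ht' δ).1
      rw [hz] at hc
      have hcos := (mul_eq_zero.1 hc).resolve_left hr0.ne'
      have hx : longitude (A t) m - δ = -(Real.pi / 2) := by
        rcases eq_or_lt_of_le hlon.1 with h | h
        · linarith
        · have := Real.cos_pos_of_mem_Ioo (x := longitude (A t) m - δ)
            ⟨by linarith, by linarith⟩
          linarith
      refine ⟨_, -1, hL0, hL1, ⟨Or.inr rfl, by rw [hX]; linarith, by rw [hP, htan]; simp⟩, ?_⟩
      have b1 := hA.band_horizontal h0 h0' ht' δ 0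
      have b2 := hA.band_horizontal h0 h0' ht' δ (Real.pi / 2)
      rw [htan, hx] at b1 b2
      simp only [Real.cos_zero, Real.sin_zero, Real.cos_pi_div_two, Real.sin_pi_div_two,
        Real.sin_neg, sub_zero, Real.cos_sub_pi_div_two] at b1 b2
      rw [neg_one_mul, sub_neg_eq_add, Real.cos_add_pi_div_two, Real.sin_add_pi_div_two]
      congr 1 <;> linarith
    · have hc := (hA.longitude_shift ht' (-δ)).1
      rw [← sub_eq_add_neg, hz] at hc
      have hcos := (mul_eq_zero.1 hc).resolve_left hr0.ne'
      have hx : longitude (A t) m - -δ = Real.pi / 2 := by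
        rcases eq_or_lt_of_le hlon.2 with h | h
        · linarith
        · have := Real.cos_pos_of_mem_Ioo (x := longitude (A t) m - -δ)
            ⟨by linarith, by linarith⟩
          linarith
      refine ⟨_, 1, hL0, hL1, ⟨Or.inl rfl, by rw [hX]; linarith, by rw [hP, htan]; simp⟩, ?_⟩
      have b1 := hA.band_horizontal h0 h0' ht' (-δ) 0
      have b2 := hA.band_horizontal h0 h0' ht' (-δ) (Real.pi / 2)
      rw [htan, hx, ← sub_eq_add_neg] at b1 b2
      simp only [Real.cos_zero, Real.sin_zero, Real.cos_pi_div_two, Real.sin_pi_div_two,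
        sub_zero, Real.cos_sub_pi_div_two] at b1 b2
      rw [one_mul, Real.cos_sub_pi_div_two, Real.sin_sub_pi_div_two]
      congr 1 <;> linarith
  rintro z ⟨t, ht, θ, hθ, hz, rfl⟩
  rcases eq_or_lt_of_le ht.2 with h | h
  · rw [h, ← hA.closed] at hz ⊢
    exact hdist 0 ⟨le_rfl, one_pos⟩ θ hθ hz
  · exact hdist t ⟨ht.1, h⟩ θ hθ hz

/-- If the origin were in the convex hull of the band, it would be in that of the contact points
with the horizontal plane; so it can be separated from the band by a plane. -/
theorem exists_open_halfSpace (hA : UpperFrame A v w (m + δ) (m - δ)) (h0 : 0 < A 0 0 1)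
    (h0' : A 0 1 1 = 0) {k : ℕ} (hk : 1 ≤ k)
    (hW : turning v w (fun t => A t 2) 1 = 2 * Real.pi * k) (hkδ : (k + 1) * (2 * δ) ≤ Real.pi) :
    ∃ h : Fin 3 → ℝ, ∀ t ∈ Icc (0 : ℝ) 1,
      0 < bandHeight (A t) h (m + δ) ∧ 0 < bandHeight (A t) h (m - δ) := by
  have hcont := hA.zero_notMem_contact h0 h0' hk hW hkδ
  set K : Set (Fin 3 → ℝ) := (fun t i => SphereCurves.band (A t) (m + δ) i) '' Icc 0 1 ∪
    (fun t i => SphereCurves.band (A t) (m - δ) i) '' Icc 0 1 with hK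
  have hKc : IsCompact K := by
    refine (isCompact_Icc.image_of_continuousOn ?_).union (isCompact_Icc.image_of_continuousOn ?_)
    · exact continuousOn_pi.2 fun i => (hA.band _ i).continuousOn
    · exact continuousOn_pi.2 fun i => (hA.band _ i).continuousOn
  have hK2 : ∀ z ∈ K, 0 ≤ z 2 := by
    rintro z (⟨t, ht, rfl⟩ | ⟨t, ht, rfl⟩)
    · exact hA.nonneg₁ t ht
    · exact hA.nonneg₂ t ht
  have h0K : (0 : Fin 3 → ℝ) ∉ convexHull ℝ K := by
    intro hmem
    obtain ⟨ι, hι, z, w', hz, -, hw, hw1, hwz⟩ := eq_pos_convex_span_of_mem_convexHull hmem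
    have hzK : ∀ i, z i ∈ K := fun i => hz ⟨i, rfl⟩
    have hcoord : ∀ j, ∑ i, w' i * z i j = 0 := fun j => by
      have := congrFun hwz j
      simpa using this
    have hz2 : ∀ i, z i 2 = 0 := by
      intro i
      have := (Finset.sum_eq_zero_iff_of_nonneg
        (fun i _ => mul_nonneg (hw i).le (hK2 _ (hzK i)))).1 (hcoord 2) i (Finset.mem_univ i)
      exact (mul_eq_zero.1 this).resolve_left (hw i).ne'
    apply hcont
    have hsum : (0 : ℂ) = ∑ i, w' i • (⟨z i 0, z i 1⟩ : ℂ) := by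
      apply Complex.ext
      · rw [Complex.re_sum]; simp only [Complex.smul_re, smul_eq_mul, Complex.zero_re]
        exact (hcoord 0).symm
      · rw [Complex.im_sum]; simp only [Complex.smul_im, smul_eq_mul, Complex.zero_im]
        exact (hcoord 1).symm
    rw [hsum]
    refine (convex_convexHull ℝ _).sum_mem (fun i _ => (hw i).le) hw1 fun i _ =>
      subset_convexHull ℝ _ ?_
    rcases hzK i with ⟨t, ht, h⟩ | ⟨t, ht, h⟩
    · refine ⟨t, ht, _, Or.inl rfl, ?_, ?_⟩
      · rw [← hz2 i, ← h]
      · rw [← h]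
    · refine ⟨t, ht, _, Or.inr rfl, ?_, ?_⟩
      · rw [← hz2 i, ← h]
      · rw [← h]
  obtain ⟨f, u, hf0, hfu⟩ := geometric_hahn_banach_point_closed (convex_convexHull ℝ K)
    (isCompact_convexHull_of_isCompact hKc).isClosed h0K
  rw [map_zero] at hf0
  have hfK : ∀ z ∈ K, 0 < ∑ i, f (Pi.single i 1) * z i := by
    intro z hz
    have h1 := hfu z (subset_convexHull ℝ _ hz)
    have h2 : f z = ∑ i, f (Pi.single i 1) * z i := by
      conv_lhs => rw [pi_eq_sum_univ' z]
      rw [map_sum]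
      refine Finset.sum_congr rfl fun i _ => ?_
      rw [map_smul, smul_eq_mul, mul_comm]
    linarith
  refine ⟨fun i => f (Pi.single i 1), fun t ht => ⟨?_, ?_⟩⟩
  · exact hfK _ (Or.inl ⟨t, ht, rfl⟩)
  · exact hfK _ (Or.inr ⟨t, ht, rfl⟩)

end UpperFrame

theorem mem_so3_iff {M : Matrix (Fin 3) (Fin 3) ℝ} :
    M ∈ Matrix.specialOrthogonalGroup (Fin 3) ℝ ↔ M * M.transpose = 1 ∧ M.det = 1 := by
  rw [Matrix.mem_specialOrthogonalGroup_iff, Matrix.mem_orthogonalGroup_iff]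

theorem band_mul (Q M : Matrix (Fin 3) (Fin 3) ℝ) (θ : ℝ) (i : Fin 3) :
    band (Q * M) θ i = ∑ l, Q i l * band M θ l := by
  simp only [band, Matrix.mul_apply, Fin.sum_univ_three]; ring

theorem IsFrame.mul_left {A : ℝ → Matrix (Fin 3) (Fin 3) ℝ} {v w : ℝ → ℝ} (hA : IsFrame A v w)
    {Q : Matrix (Fin 3) (Fin 3) ℝ} (hQ : Q ∈ Matrix.specialOrthogonalGroup (Fin 3) ℝ) :
    IsFrame (fun t => Q * A t) v w := by
  refine ⟨fun t => mul_mem hQ (hA.mem t), fun i => ?_, fun i => ?_, fun i => ?_⟩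
  · have := (HasACDeriv.sum Finset.univ fun l _ => (hA.deriv_pos l).const_mul (Q i l))
    refine this.congr_deriv (Eventually.of_forall fun t _ => ?_)
    simp only [Matrix.mul_apply, Fin.sum_univ_three]; ring
  · have := (HasACDeriv.sum Finset.univ fun l _ => (hA.deriv_tan l).const_mul (Q i l))
    refine this.congr_deriv (Eventually.of_forall fun t _ => ?_)
    simp only [Matrix.mul_apply, Fin.sum_univ_three]; ring
  · have := (HasACDeriv.sum Finset.univ fun l _ => (hA.deriv_nor l).const_mul (Q i l))
    refine this.congr_deriv (Eventually.of_forall fun t _ => ?_)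
    simp only [Matrix.mul_apply, Fin.sum_univ_three]; ring

/-- Coordinates in which `h` is vertical and the tangent of the frame `M` lies above the positive
first axis. -/
theorem exists_adapted_rotation {M : Matrix (Fin 3) (Fin 3) ℝ}
    (hM : M ∈ Matrix.specialOrthogonalGroup (Fin 3) ℝ) {h : Fin 3 → ℝ} (hh : ∑ i, h i ^ 2 = 1)
    (hpos : 0 < bodyComp M h 0 ^ 2 + bodyComp M h 2 ^ 2) :
    ∃ Q ∈ Matrix.specialOrthogonalGroup (Fin 3) ℝ, Q 2 = h ∧ 0 < (Q * M) 0 1 ∧ (Q * M) 1 1 = 0 := by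
  set u := bodyComp M h 1 with hu
  set r := √(bodyComp M h 0 ^ 2 + bodyComp M h 2 ^ 2) with hr
  have hr0 : 0 < r := Real.sqrt_pos.2 hpos
  have hr2 : r ^ 2 = bodyComp M h 0 ^ 2 + bodyComp M h 2 ^ 2 := Real.sq_sqrt hpos.le
  set a := bodyComp M h 0 / r with ha
  set b := bodyComp M h 2 / r with hb
  have hra : r * a = bodyComp M h 0 := by rw [ha]; field_simp
  have hrb : r * b = bodyComp M h 2 := by rw [hb]; field_simp
  have hab : a ^ 2 + b ^ 2 = 1 := by
    have : r ^ 2 * (a ^ 2 + b ^ 2) = r ^ 2 := by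
      have : r ^ 2 = (r * a) ^ 2 + (r * b) ^ 2 := by rw [hra, hrb, hr2]
      linear_combination -this
    exact mul_left_cancel₀ (pow_pos hr0 2).ne' (by rw [this, mul_one])
  have hru : r ^ 2 + u ^ 2 = 1 := by
    have := sum_sq_bodyComp hM h
    rw [hh] at this; rw [hr2, hu]; linarith
  set R : Matrix (Fin 3) (Fin 3) ℝ := !![-(a * u), r, -(b * u); -b, 0, a; r * a, u, r * b] with hR
  have hRmem : R ∈ Matrix.specialOrthogonalGroup (Fin 3) ℝ := by
    rw [mem_so3_iff]
    constructor
    · ext i j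
      fin_cases i <;> fin_cases j <;>
        simp [hR, Matrix.mul_apply, Fin.sum_univ_three] 
      · linear_combination u ^ 2 * hab + hru
      · ring
      · linear_combination -u * r * hab
      · ring
      · linear_combination hab
      · ring
      · linear_combination -u * r * hab
      · ring
      · linear_combination r ^ 2 * hab + hru
    · rw [hR, Matrix.det_fin_three]
      simp
      linear_combination (u ^ 2 + r ^ 2) * hab + hru
  have hMt : M.transpose * M = 1 := by
    have := (Matrix.mem_orthogonalGroup_iff' (Fin 3) ℝ).1 (Matrix.mem_specialOrthogonalGroup_iff.1 hM).1
    simpa [Matrix.star_eq_conjTranspose] using this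
  have hMt' : M * M.transpose = 1 := (mem_so3_iff.1 hM).1
  have hQmem : M.transpose ∈ Matrix.specialOrthogonalGroup (Fin 3) ℝ := by
    rw [mem_so3_iff]
    exact ⟨by rw [Matrix.transpose_transpose, hMt], by
      rw [Matrix.det_transpose]; exact (mem_so3_iff.1 hM).2⟩
  have hQM : R * M.transpose * M = R := by rw [mul_assoc, hMt, mul_one]
  refine ⟨R * M.transpose, mul_mem hRmem hQmem, ?_, ?_, ?_⟩
  · ext j
    have hrow : ∀ l, R 2 l = ∑ i, h i * M i l := by
      intro l; fin_cases l
      · exact hra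
      · rfl
      · exact hrb
    have e : ∀ i, ∑ l, M i l * M j l = if i = j then 1 else 0 := fun i => (so3_entries hM).1 i j
    calc (R * M.transpose) 2 j = ∑ l, (∑ i, h i * M i l) * M j l := by
          rw [Matrix.mul_apply]
          exact Finset.sum_congr rfl fun l _ => by rw [hrow, Matrix.transpose_apply]
      _ = ∑ i, h i * ∑ l, M i l * M j l := by
          simp only [Fin.sum_univ_three]; ring
      _ = h j := by simp [e]
  · rw [hQM]; simpa [hR] using hr0
  · rw [hQM]; simp [hR]

/-- If the band of a closed curve of rotation number `k` about `h` lies in the closed half space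
`h ≥ 0`, and `(k + 1)` times the width of the band is at most `π`, then the band lies in
some open half space. -/
theorem exists_open_halfSpace {A : ℝ → Matrix (Fin 3) (Fin 3) ℝ} {v w : ℝ → ℝ} {m δ : ℝ}
    (hA : IsFrame A v w) (hB : InBand v w (m + δ) (m - δ)) (hcl : A 0 = A 1) (hδ : 0 < δ)
    {k : ℕ} (hk : 1 ≤ k) (hkδ : (k + 1) * (2 * δ) ≤ Real.pi) {h : Fin 3 → ℝ}
    (hh : ∑ i, h i ^ 2 = 1)
    (n₁ : ∀ t ∈ Icc (0 : ℝ) 1, 0 ≤ bandHeight (A t) h (m + δ))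
    (n₂ : ∀ t ∈ Icc (0 : ℝ) 1, 0 ≤ bandHeight (A t) h (m - δ))
    (hW : turning v w (fun t => bodyComp (A t) h) 1 = 2 * Real.pi * k) :
    ∃ h' : Fin 3 → ℝ, ∀ t ∈ Icc (0 : ℝ) 1,
      0 < bandHeight (A t) h' (m + δ) ∧ 0 < bandHeight (A t) h' (m - δ) := by
  have hpos := hA.normal_part_pos hB hcl (by rw [hh]; norm_num) n₁ n₂ (t := 0) (by simp)
  obtain ⟨Q, hQ, hQh, h0, h0'⟩ := exists_adapted_rotation (hA.mem 0) hh hpos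
  have hrow : ∀ t, (fun j => bodyComp (A t) h j) = (Q * A t) 2 := fun t => by
    ext j; rw [Matrix.mul_apply, hQh]; rfl
  have hb2 : ∀ t θ, band (Q * A t) θ 2 = bandHeight (A t) h θ := fun t θ => by
    rw [band_mul, hQh]; rfl
  have hkr : (1 : ℝ) ≤ k := by exact_mod_cast hk
  have hU : UpperFrame (fun t => Q * A t) v w (m + δ) (m - δ) :=
    { hA.mul_left hQ with
      inBand := hB
      closed := by simp only [hcl]
      lt := by linarith
      sub_lt := by nlinarith [Real.pi_pos]
      nonneg₁ := fun t ht => by rw [hb2]; exact n₁ t ht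
      nonneg₂ := fun t ht => by rw [hb2]; exact n₂ t ht }
  have hW' : turning v w (fun t => (Q * A t) 2) 1 = 2 * Real.pi * k := by
    rw [← hW]; congr 1; ext t : 1; exact (hrow t).symm
  obtain ⟨h', hh'⟩ := hU.exists_open_halfSpace h0 h0' hk hW' hkδ
  have e : ∀ t θ, bandHeight (Q * A t) h' θ = bandHeight (A t) (fun l => ∑ i, h' i * Q i l) θ := by
    intro t θ
    simp only [bandHeight, band_mul, Fin.sum_univ_three]; ring
  exact ⟨fun l => ∑ i, h' i * Q i l, fun t ht => by simpa only [e] using hh' t ht⟩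

end

section

/-! ### The diffeomorphisms that encode speed and curvature -/

section ExpandingInverse

variable {h : ℝ → ℝ} {S : Set ℝ} {c : ℝ}

theorem injOn_of_expanding (hc : 0 < c) (hexp : ∀ s ∈ S, ∀ t ∈ S, s < t → c * (t - s) ≤ h t - h s) :
    InjOn h S := by
  intro s hs t ht hst
  rcases lt_trichotomy s t with hlt | hlt | hlt
  · have := hexp s hs t ht hlt
    have := mul_pos hc (sub_pos.2 hlt); linarith
  · exact hlt
  · have := hexp t ht s hs hlt
    have := mul_pos hc (sub_pos.2 hlt); linarith

theorem abs_invFunOn_sub_le (hc : 0 < c)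
    (hexp : ∀ s ∈ S, ∀ t ∈ S, s < t → c * (t - s) ≤ h t - h s) (hsurj : ∀ x, ∃ t ∈ S, h t = x)
    (x y : ℝ) : |Function.invFunOn h S x - Function.invFunOn h S y| ≤ c⁻¹ * |x - y| := by
  have hmem : ∀ x, Function.invFunOn h S x ∈ S := fun x => Function.invFunOn_mem (hsurj x)
  have heq : ∀ x, h (Function.invFunOn h S x) = x := fun x => Function.invFunOn_eq (hsurj x)
  have key : ∀ x y, Function.invFunOn h S x < Function.invFunOn h S y →
      |Function.invFunOn h S x - Function.invFunOn h S y| ≤ c⁻¹ * |x - y| := by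
    intro x y hlt
    have := hexp _ (hmem x) _ (hmem y) hlt
    rw [heq, heq] at this
    rw [abs_sub_comm, abs_of_pos (sub_pos.2 hlt), abs_sub_comm x y, ← div_eq_inv_mul,
      le_div_iff₀ hc]
    have := le_abs_self (y - x)
    linarith
  rcases lt_trichotomy (Function.invFunOn h S x) (Function.invFunOn h S y) with hlt | hlt | hlt
  · exact key x y hlt
  · rw [hlt, sub_self, abs_zero]; positivity
  · rw [abs_sub_comm, abs_sub_comm x y]; exact key y x hlt

end ExpandingInverse

theorem hSpeed_expanding : ∀ s ∈ Ioi (0 : ℝ), ∀ t ∈ Ioi (0 : ℝ), s < t →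
    1 * (t - s) ≤ hSpeed t - hSpeed s := by
  intro s hs t ht hst
  have : t⁻¹ ≤ s⁻¹ := inv_anti₀ hs hst.le
  simp only [hSpeed]; linarith

theorem hSpeed_surj (x : ℝ) : ∃ t ∈ Ioi (0 : ℝ), hSpeed t = x := by
  have hs : √(x ^ 2 + 4) ^ 2 = x ^ 2 + 4 := Real.sq_sqrt (by positivity)
  have hpos : 0 < x + √(x ^ 2 + 4) := by
    have : |x| < √(x ^ 2 + 4) := by
      rw [← Real.sqrt_sq_eq_abs]; exact Real.sqrt_lt_sqrt (sq_nonneg _) (by linarith)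
    linarith [neg_abs_le x]
  refine ⟨(x + √(x ^ 2 + 4)) / 2, half_pos hpos, ?_⟩
  simp only [hSpeed]
  have hne := hpos.ne'
  field_simp
  nlinarith

theorem hSpeedInv_pos (x : ℝ) : 0 < hSpeedInv x := Function.invFunOn_mem (hSpeed_surj x)

theorem hSpeed_hSpeedInv (x : ℝ) : hSpeed (hSpeedInv x) = x := Function.invFunOn_eq (hSpeed_surj x)

theorem hSpeedInv_hSpeed {t : ℝ} (ht : 0 < t) : hSpeedInv (hSpeed t) = t :=
  (injOn_of_expanding one_pos hSpeed_expanding).leftInvOn_invFunOn ht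

theorem abs_hSpeedInv_sub_le (x y : ℝ) : |hSpeedInv x - hSpeedInv y| ≤ 1 * |x - y| := by
  have h := abs_invFunOn_sub_le one_pos hSpeed_expanding hSpeed_surj x y
  rw [inv_one] at h
  exact h

theorem hSpeedInv_le (x : ℝ) : hSpeedInv x ≤ |x| + 1 := by
  have h := hSpeed_hSpeedInv x
  have hp := hSpeedInv_pos x
  simp only [hSpeed] at h
  by_contra! hc
  have h1 : 1 < hSpeedInv x := by linarith [abs_nonneg x]
  have := inv_lt_one_of_one_lt₀ h1
  linarith [le_abs_self x]

theorem inv_hSpeedInv_le (x : ℝ) : (hSpeedInv x)⁻¹ ≤ |x| + 1 := by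
  have h := hSpeed_hSpeedInv x
  have hp := hSpeedInv_pos x
  simp only [hSpeed] at h
  by_contra! hc
  have h1 : 1 < (hSpeedInv x)⁻¹ := by linarith [abs_nonneg x]
  have := (one_lt_inv₀ hp).1 h1
  linarith [neg_abs_le x]

/-- `hCurv` expands distances by some factor, so that its inverse is Lipschitz. -/
theorem hCurv_expanding {κ₁ κ₂ : EReal} (hκ : κ₁ < κ₂) : ∃ c > 0,
    ∀ s ∈ curvInterval κ₁ κ₂, ∀ t ∈ curvInterval κ₁ κ₂, s < t →
      c * (t - s) ≤ hCurv κ₁ κ₂ t - hCurv κ₁ κ₂ s := by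
  have hinv : ∀ x y : ℝ, x < y → (0 < x ∨ y < 0) → y⁻¹ ≤ x⁻¹ := by
    rintro x y hxy (h | h)
    · exact inv_anti₀ h hxy.le
    · exact (inv_le_inv_of_neg h (hxy.trans h)).2 hxy.le
  induction κ₁ with
  | top => exact absurd hκ not_top_lt
  | bot =>
    induction κ₂ with
    | bot => exact absurd hκ (lt_irrefl _)
    | top => exact ⟨1, one_pos, fun s _ t _ _ => by simp [hCurv]⟩
    | coe b =>
      refine ⟨1, one_pos, fun s hs t ht hst => ?_⟩
      have hs' : s < b := by exact_mod_cast hs.2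
      have ht' : t < b := by exact_mod_cast ht.2
      have := hinv (b - t) (b - s) (by linarith) (Or.inl (by linarith))
      simp [hCurv]
      linarith
  | coe a =>
    induction κ₂ with
    | bot => exact absurd hκ not_lt_bot
    | top =>
      refine ⟨1, one_pos, fun s hs t ht hst => ?_⟩
      have hs' : a < s := by exact_mod_cast hs.1
      have ht' : a < t := by exact_mod_cast ht.1
      have := hinv (a - t) (a - s) (by linarith) (Or.inr (by linarith))
      simp [hCurv]
      linarith
    | coe b =>
      have hab : a < b := by exact_mod_cast hκ
      refine ⟨1 / (b - a) ^ 2, by have := sub_pos.2 hab; positivity, fun s hs t ht hst => ?_⟩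
      have hs1 : a < s := by exact_mod_cast hs.1
      have ht1 : a < t := by exact_mod_cast ht.1
      have hs2 : s < b := by exact_mod_cast hs.2
      have ht2 : t < b := by exact_mod_cast ht.2
      have h1 := hinv (b - t) (b - s) (by linarith) (Or.inl (by linarith))
      have h2 : (a - t)⁻¹ - (a - s)⁻¹ = (t - s) / ((t - a) * (s - a)) := by
        have e1 : a - t ≠ 0 := by linarith
        have e2 : a - s ≠ 0 := by linarith
        have e3 : t - a ≠ 0 := by linarith
        have e4 : s - a ≠ 0 := by linarith
        rw [show (t - a) * (s - a) = (a - t) * (a - s) by ring]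
        field_simp
        ring
      have h3 : (t - s) / (b - a) ^ 2 ≤ (t - s) / ((t - a) * (s - a)) := by
        apply div_le_div_of_nonneg_left (by linarith)
          (mul_pos (by linarith) (by linarith))
        nlinarith
      simp only [hCurv, EReal.coe_ne_bot, EReal.coe_ne_top, if_false, EReal.toReal_coe]
      have h4 : 1 / (b - a) ^ 2 * (t - s) = (t - s) / (b - a) ^ 2 := by ring
      rw [h4]
      linarith

theorem hCurv_surj {κ₁ κ₂ : EReal} (hκ : κ₁ < κ₂) (x : ℝ) :
    ∃ t ∈ curvInterval κ₁ κ₂, hCurv κ₁ κ₂ t = x := by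
  induction κ₁ with
  | top => exact absurd hκ not_top_lt
  | bot =>
    induction κ₂ with
    | bot => exact absurd hκ (lt_irrefl _)
    | top => exact ⟨x, ⟨EReal.bot_lt_coe x, EReal.coe_lt_top x⟩, by simp [hCurv]⟩
    | coe b =>
      obtain ⟨y, hy, hyx⟩ := hSpeed_surj (b - x)
      have hy : 0 < y := hy
      refine ⟨b - y, ⟨EReal.bot_lt_coe _, ?_⟩, ?_⟩
      · exact_mod_cast (by linarith : b - y < b)
      · simp only [hSpeed] at hyx
        simp [hCurv]; linarith
  | coe a =>
    induction κ₂ with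
    | bot => exact absurd hκ not_lt_bot
    | top =>
      obtain ⟨y, hy, hyx⟩ := hSpeed_surj (x - a)
      have hy : 0 < y := hy
      refine ⟨a + y, ⟨?_, EReal.coe_lt_top _⟩, ?_⟩
      · exact_mod_cast (by linarith : a < a + y)
      · simp only [hSpeed] at hyx
        simp [hCurv, inv_neg]; linarith
    | coe b =>
      have hab : a < b := by exact_mod_cast hκ
      set d := (b - a) / 2 with hd
      have hd0 : 0 < d := by rw [hd]; linarith
      set R := √(1 + (x * d) ^ 2) with hR
      have hR2 : R ^ 2 = 1 + (x * d) ^ 2 := Real.sq_sqrt (by positivity)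
      have hR0 : 0 ≤ R := Real.sqrt_nonneg _
      have hxR : |x * d| < 1 + R := by
        have : |x * d| ≤ R := by
          rw [← Real.sqrt_sq_eq_abs]; exact Real.sqrt_le_sqrt (by linarith)
        linarith
      have hne : (1 + R) ≠ 0 := by positivity
      set τ := d * ((x * d) / (1 + R)) with hτ
      have hlt : |(x * d) / (1 + R)| < 1 := by
        rw [abs_div, abs_of_pos (by positivity : 0 < 1 + R), div_lt_one (by positivity)]
        exact hxR
      have hτ1 := abs_lt.1 hlt
      have h1 : -d < τ := by rw [hτ]; nlinarith
      have h2 : τ < d := by rw [hτ]; nlinarith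
      have hq : x * (d ^ 2 - τ ^ 2) = 2 * τ := by
        have e : τ * (1 + R) = x * d ^ 2 := by rw [hτ]; field_simp
        apply mul_right_cancel₀ (pow_ne_zero 2 hne)
        have : τ ^ 2 * (1 + R) ^ 2 = (x * d ^ 2) ^ 2 := by rw [← e]; ring
        linear_combination (-x) * this - 2 * (1 + R) * e + x * d ^ 2 * hR2
      refine ⟨(a + b) / 2 + τ, ⟨?_, ?_⟩, ?_⟩
      · exact_mod_cast (by rw [hd] at h1; linarith : a < (a + b) / 2 + τ)
      · exact_mod_cast (by rw [hd] at h2; linarith : (a + b) / 2 + τ < b)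
      · simp only [hCurv, EReal.coe_ne_bot, EReal.coe_ne_top, if_false, EReal.toReal_coe]
        have e1 : a - ((a + b) / 2 + τ) = -(d + τ) := by rw [hd]; ring
        have e2 : b - ((a + b) / 2 + τ) = d - τ := by rw [hd]; ring
        rw [e1, e2]
        have e3 : d + τ ≠ 0 := by linarith
        have e4 : d - τ ≠ 0 := by linarith
        rw [inv_neg]
        field_simp
        linear_combination -hq

theorem hCurvInv_mem {κ₁ κ₂ : EReal} (hκ : κ₁ < κ₂) (x : ℝ) :
    hCurvInv κ₁ κ₂ x ∈ curvInterval κ₁ κ₂ := Function.invFunOn_mem (hCurv_surj hκ x)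

theorem hCurvInv_hCurv {κ₁ κ₂ : EReal} (hκ : κ₁ < κ₂) {t : ℝ} (ht : t ∈ curvInterval κ₁ κ₂) :
    hCurvInv κ₁ κ₂ (hCurv κ₁ κ₂ t) = t := by
  obtain ⟨c, hc, hexp⟩ := hCurv_expanding hκ
  exact (injOn_of_expanding hc hexp).leftInvOn_invFunOn ht

theorem exists_abs_hCurvInv_sub_le {κ₁ κ₂ : EReal} (hκ : κ₁ < κ₂) : ∃ c, 0 ≤ c ∧
    ∀ x y, |hCurvInv κ₁ κ₂ x - hCurvInv κ₁ κ₂ y| ≤ c * |x - y| := by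
  obtain ⟨c, hc, hexp⟩ := hCurv_expanding hκ
  exact ⟨c⁻¹, by positivity, fun x y => abs_invFunOn_sub_le hc hexp (hCurv_surj hκ) x y⟩

theorem continuousOn_hCurv (κ₁ κ₂ : EReal) : ContinuousOn (hCurv κ₁ κ₂) (curvInterval κ₁ κ₂) := by
  have h1 : κ₁ ≠ ⊥ → ContinuousOn (fun t : ℝ => (κ₁.toReal - t)⁻¹) (curvInterval κ₁ κ₂) := by
    intro h
    refine ContinuousOn.inv₀ (by fun_prop) fun t ht => ?_
    have : κ₁ ≠ ⊤ := fun h => not_top_lt (h ▸ ht.1)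
    have h2 := ht.1
    rw [← EReal.coe_toReal this h, EReal.coe_lt_coe_iff] at h2
    linarith
  have h2 : κ₂ ≠ ⊤ → ContinuousOn (fun t : ℝ => (κ₂.toReal - t)⁻¹) (curvInterval κ₁ κ₂) := by
    intro h
    refine ContinuousOn.inv₀ (by fun_prop) fun t ht => ?_
    have : κ₂ ≠ ⊥ := fun h => not_lt_bot (h ▸ ht.2)
    have h2 := ht.2
    rw [← EReal.coe_toReal h this, EReal.coe_lt_coe_iff] at h2
    linarith
  unfold hCurv
  split_ifs with a b b
  · exact continuousOn_id
  · exact continuousOn_id.add (h2 b)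
  · exact continuousOn_id.add (h1 a)
  · exact (h1 a).add (h2 b)

/-! ### The inverse cotangent -/

theorem arccot_coe (a : ℝ) : arccot (a : EReal) = Real.pi / 2 - Real.arctan a := by
  simp [arccot]

theorem arccot_top : arccot ⊤ = 0 := by simp [arccot]

theorem arccot_bot : arccot ⊥ = Real.pi := by simp [arccot]

theorem arccot_coe_mem (a : ℝ) : arccot (a : EReal) ∈ Ioo 0 Real.pi := by
  rw [arccot_coe]
  constructor <;> linarith [Real.arctan_lt_pi_div_two a, Real.neg_pi_div_two_lt_arctan a]

theorem arccot_strictAnti : StrictAnti arccot := by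
  intro κ₁ κ₂ hκ
  induction κ₁ with
  | top => exact absurd hκ not_top_lt
  | bot =>
    induction κ₂ with
    | bot => exact absurd hκ (lt_irrefl _)
    | top => rw [arccot_bot, arccot_top]; exact Real.pi_pos
    | coe b => rw [arccot_bot]; exact (arccot_coe_mem b).2
  | coe a =>
    induction κ₂ with
    | bot => exact absurd hκ not_lt_bot
    | top => rw [arccot_top]; exact (arccot_coe_mem a).1
    | coe b =>
      rw [arccot_coe, arccot_coe]
      have := Real.arctan_strictMono (EReal.coe_lt_coe_iff.1 hκ)
      linarith

theorem arccot_nonneg (κ : EReal) : 0 ≤ arccot κ := by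
  rw [← arccot_top]; exact arccot_strictAnti.antitone le_top

theorem arccot_le_pi (κ : EReal) : arccot κ ≤ Real.pi := by
  rw [← arccot_bot]; exact arccot_strictAnti.antitone bot_le

theorem arccot_cot {ρ : ℝ} (h0 : 0 < ρ) (h1 : ρ < Real.pi) :
    arccot ((Real.cos ρ / Real.sin ρ : ℝ) : EReal) = ρ := by
  have h : Real.cos ρ / Real.sin ρ = Real.tan (Real.pi / 2 - ρ) := by
    rw [Real.tan_eq_sin_div_cos, Real.sin_pi_div_two_sub, Real.cos_pi_div_two_sub]
  rw [arccot_coe, h, Real.arctan_tan]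
  · ring
  · linarith
  · linarith

theorem mem_curvInterval_iff {κ₁ κ₂ : EReal} {t : ℝ} : t ∈ curvInterval κ₁ κ₂ ↔
    arccot κ₂ < arccot (t : EReal) ∧ arccot (t : EReal) < arccot κ₁ := by
  rw [arccot_strictAnti.lt_iff_gt, arccot_strictAnti.lt_iff_gt]
  exact And.comm

theorem cot_mem_curvInterval {κ₁ κ₂ : EReal} {ρ : ℝ} (h2 : arccot κ₂ < ρ) (h1 : ρ < arccot κ₁) :
    Real.cos ρ / Real.sin ρ ∈ curvInterval κ₁ κ₂ := by
  rw [mem_curvInterval_iff, arccot_cot ((arccot_nonneg κ₂).trans_lt h2)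
    (h1.trans_le (arccot_le_pi κ₁))]
  exact ⟨h2, h1⟩

theorem sin_sub_arccot_coe (t θ : ℝ) :
    0 < Real.sin (arccot (t : EReal)) ∧ Real.sin (arccot (t : EReal)) * (Real.cos θ - t * Real.sin θ) =
      Real.sin (arccot (t : EReal) - θ) := by
  have hm := arccot_coe_mem t
  have hs := Real.sin_pos_of_pos_of_lt_pi hm.1 hm.2
  refine ⟨hs, ?_⟩
  have hc : Real.cos (arccot (t : EReal)) = t * Real.sin (arccot (t : EReal)) := by
    rw [arccot_coe, Real.cos_pi_div_two_sub, Real.sin_pi_div_two_sub]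
    have := Real.tan_arctan t
    rw [Real.tan_eq_sin_div_cos, div_eq_iff (Real.cos_arctan_pos t).ne'] at this
    exact this
  rw [Real.sin_sub, hc]; ring

/-- A curvature between the bounds moves the boundary curve of the band at `ρ₂` along the tangent,
and the one at `ρ₁` against it. -/
theorem band_speed_signs {κ₁ κ₂ : EReal} {v t : ℝ} (hv : 0 < v) (ht : t ∈ curvInterval κ₁ κ₂) :
    0 < v * Real.cos (arccot κ₂) - v * t * Real.sin (arccot κ₂) ∧
      v * Real.cos (arccot κ₁) - v * t * Real.sin (arccot κ₁) < 0 := by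
  obtain ⟨h2, h1⟩ := mem_curvInterval_iff.1 ht
  obtain ⟨hs, e2⟩ := sin_sub_arccot_coe t (arccot κ₂)
  obtain ⟨-, e1⟩ := sin_sub_arccot_coe t (arccot κ₁)
  have hm := arccot_coe_mem t
  have p2 := Real.sin_pos_of_pos_of_lt_pi (x := arccot (t : EReal) - arccot κ₂) (by linarith)
    (by linarith [hm.2, arccot_nonneg κ₂])
  have p1 := Real.sin_neg_of_neg_of_neg_pi_lt (x := arccot (t : EReal) - arccot κ₁) (by linarith)
    (by linarith [hm.1, arccot_le_pi κ₁])
  rw [← e2] at p2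
  rw [← e1] at p1
  have q2 := (mul_pos_iff_of_pos_left hs).1 p2
  have q1 := neg_of_mul_neg_right p1 hs.le
  constructor
  · have := mul_pos hv q2; linarith
  · have := mul_neg_of_pos_of_neg hv q1; linarith

end

section

/-! ### Frames of admissible curves -/

theorem integral_unitInterval (g : ℝ → ℝ) : ∫ s : unitInterval, g s = ∫ x in (0 : ℝ)..1, g x := by
  have h := setIntegral_unitInterval_Iic g 1
  have hI : Set.Iic (1 : unitInterval) = Set.univ := by
    ext x; simp [unitInterval.le_one']
  rwa [hI, setIntegral_univ, Set.Icc.coe_one] at h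

theorem integrable_unitInterval_iff {g : ℝ → ℝ} :
    Integrable (fun s : unitInterval => g s) ↔ IntervalIntegrable g volume 0 1 := by
  rw [intervalIntegrable_iff_integrableOn_Icc_of_le zero_le_one]
  exact (measurePreserving_subtype_coe (μa := (volume : Measure ℝ))
    (measurableSet_Icc (a := (0 : ℝ)) (b := 1))).integrable_comp_emb
      (MeasurableEmbedding.subtype_coe measurableSet_Icc)

theorem ae_unitInterval_iff {p : ℝ → Prop} :
    (∀ᵐ s : unitInterval, p s) ↔ ∀ᵐ x : ℝ, x ∈ Ioo (0 : ℝ) 1 → p x := by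
  have h : (∀ᵐ s : unitInterval, p s) ↔ ∀ᵐ x ∂(volume.restrict (Icc (0 : ℝ) 1)), p x := by
    rw [← map_comap_subtype_coe (μ := (volume : Measure ℝ)) measurableSet_Icc,
      (MeasurableEmbedding.subtype_coe measurableSet_Icc).ae_map_iff]
    rfl
  rw [h, ← restrict_Ioo_eq_restrict_Icc, ae_restrict_iff' measurableSet_Ioo]

theorem continuous_of_abs_sub_le {g : ℝ → ℝ} {c : ℝ} (hg : ∀ x y, |g x - g y| ≤ c * |x - y|) :
    Continuous g := by
  have hc : 0 ≤ c := by have := (abs_nonneg _).trans (hg 1 0); simpa using this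
  exact (LipschitzWith.of_dist_le_mul (K := ⟨c, hc⟩) fun x y => by
    rw [Real.dist_eq, Real.dist_eq]; exact hg x y).continuous

section
variable {g : ℝ → ℝ} {c : ℝ}

theorem memLp_comp (hg : ∀ x y, |g x - g y| ≤ c * |x - y|) (f : L2I) :
    MemLp (fun s => g (f s)) 2 (volume : Measure unitInterval) := by
  have hm0 : MemLp (fun s => c * |f s|) 2 (volume : Measure unitInterval) :=
    ((Lp.memLp f).norm).const_mul c
  have hm : MemLp (fun s => |g 0| + c * |f s|) 2 (volume : Measure unitInterval) :=
    (memLp_const |g 0|).add hm0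
  refine hm.mono ((continuous_of_abs_sub_le hg).comp_aestronglyMeasurable
    (Lp.aestronglyMeasurable f)) (Eventually.of_forall fun s => ?_)
  have h := hg (f s) 0
  rw [sub_zero] at h
  have h1 := abs_sub_abs_le_abs_sub (g (f s)) (g 0)
  rw [Real.norm_eq_abs, Real.norm_eq_abs]
  exact le_trans (by linarith) (le_abs_self _)

theorem tendsto_eLpNorm_comp_sub {ι : Type*} {l : Filter ι} (hg : ∀ x y, |g x - g y| ≤ c * |x - y|)
    {F : ι → L2I} {f : L2I} (h : Tendsto F l (𝓝 f)) :
    Tendsto (fun n => eLpNorm (fun s => g (F n s) - g (f s)) 2 (volume : Measure unitInterval)) l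
      (𝓝 0) := by
  have h1 := (Lp.tendsto_Lp_iff_tendsto_eLpNorm' F f).1 h
  have h2 : Tendsto (fun n => ENNReal.ofReal c *
      eLpNorm (⇑(F n) - ⇑f) 2 (volume : Measure unitInterval)) l (𝓝 0) := by
    have := ENNReal.Tendsto.const_mul (a := ENNReal.ofReal c) h1 (Or.inr ENNReal.ofReal_ne_top)
    rwa [mul_zero] at this
  refine tendsto_of_tendsto_of_tendsto_of_le_of_le tendsto_const_nhds h2 (fun _ => zero_le)
    fun n => ?_
  exact eLpNorm_le_mul_eLpNorm_of_ae_le_mul (Eventually.of_forall fun s => by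
    simpa [Real.norm_eq_abs] using hg (F n s) (f s)) 2
end

/-- Products of convergent sequences in `L²` converge in `L¹`. -/
theorem tendsto_eLpNorm_mul_sub {ι : Type*} {l : Filter ι} {F G : ι → unitInterval → ℝ}
    {f g : unitInterval → ℝ} (hF : ∀ n, MemLp (F n) 2) (hG : ∀ n, MemLp (G n) 2) (hf : MemLp f 2)
    (hg : MemLp g 2) (hFf : Tendsto (fun n => eLpNorm (fun s => F n s - f s) 2 volume) l (𝓝 0))
    (hGg : Tendsto (fun n => eLpNorm (fun s => G n s - g s) 2 volume) l (𝓝 0)) :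
    Tendsto (fun n => eLpNorm (fun s => F n s * G n s - f s * g s) 1 volume) l (𝓝 0) := by
  have hol : ∀ {p q : unitInterval → ℝ}, MemLp p 2 → MemLp q 2 →
      eLpNorm (fun s => p s * q s) 1 volume ≤ eLpNorm p 2 volume * eLpNorm q 2 volume :=
    fun {p q} hp hq => eLpNorm_smul_le_mul_eLpNorm (φ := p) (f := q) (p := 2) (q := 2) (r := 1)
      hq.1 hp.1
  have hbd : ∀ n, eLpNorm (fun s => F n s * G n s - f s * g s) 1 volume ≤
      eLpNorm (fun s => F n s - f s) 2 volume * eLpNorm (fun s => G n s - g s) 2 volume +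
      (eLpNorm (fun s => F n s - f s) 2 volume * eLpNorm g 2 volume +
        eLpNorm f 2 volume * eLpNorm (fun s => G n s - g s) 2 volume) := fun n => by
    have hFn : MemLp (fun s => F n s - f s) 2 := (hF n).sub hf
    have hGn : MemLp (fun s => G n s - g s) 2 := (hG n).sub hg
    have e : (fun s => F n s * G n s - f s * g s) =
        (fun s => (F n s - f s) * (G n s - g s)) +
          ((fun s => (F n s - f s) * g s) + fun s => f s * (G n s - g s)) := by
      ext s; simp only [Pi.add_apply]; ring
    rw [e]
    refine (eLpNorm_add_le (hFn.1.mul hGn.1) ((hFn.1.mul hg.1).add (hf.1.mul hGn.1)) le_rfl).trans ?_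
    refine add_le_add (hol hFn hGn) ?_
    exact (eLpNorm_add_le (hFn.1.mul hg.1) (hf.1.mul hGn.1) le_rfl).trans
      (add_le_add (hol hFn hg) (hol hf hGn))
  refine tendsto_of_tendsto_of_tendsto_of_le_of_le tendsto_const_nhds ?_ (fun _ => zero_le) hbd
  have h1 := ENNReal.Tendsto.mul hFf (Or.inr ENNReal.zero_ne_top) hGg (Or.inr ENNReal.zero_ne_top)
  have h2 := ENNReal.Tendsto.mul_const hFf (b := eLpNorm g 2 volume) (Or.inr hg.2.ne)
  have h3 := ENNReal.Tendsto.const_mul hGg (a := eLpNorm f 2 volume) (Or.inr hf.2.ne)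
  simpa using h1.add (h2.add h3)

theorem tendsto_integral_abs_of_eLpNorm {ι : Type*} {l : Filter ι} {F : ι → ℝ → ℝ}
    (h : Tendsto (fun n => eLpNorm (fun s : unitInterval => F n s) 1 volume) l (𝓝 0))
    (hF : ∀ n, AEStronglyMeasurable (fun s : unitInterval => F n s) volume) :
    Tendsto (fun n => ∫ t in (0 : ℝ)..1, |F n t|) l (𝓝 0) := by
  have h1 := (ENNReal.tendsto_toReal ENNReal.zero_ne_top).comp h
  refine h1.congr fun n => ?_
  rw [← integral_unitInterval fun t => |F n t|]
  simp only [Function.comp, eLpNorm_one_eq_lintegral_enorm]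
  exact (integral_norm_eq_lintegral_enorm (hF n)).symm

namespace AdmissibleCurve

variable {κ₁ κ₂ : EReal}

/-- The speed of an admissible curve, extended to the real line. -/
def speed (γ : AdmissibleCurve κ₁ κ₂) (x : ℝ) : ℝ :=
  hSpeedInv (γ.vHat (Set.projIcc 0 1 zero_le_one x))

/-- The geodesic curvature of an admissible curve, extended to the real line. -/
def curvature (γ : AdmissibleCurve κ₁ κ₂) (x : ℝ) : ℝ :=
  hCurvInv κ₁ κ₂ (γ.wHat (Set.projIcc 0 1 zero_le_one x))

/-- The frame of an admissible curve as a matrix function on the real line. -/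
def frameMatrix (γ : AdmissibleCurve κ₁ κ₂) (x : ℝ) : Matrix (Fin 3) (Fin 3) ℝ :=
  (γ.frame (Set.projIcc 0 1 zero_le_one x) : Matrix (Fin 3) (Fin 3) ℝ)

theorem speed_coe (γ : AdmissibleCurve κ₁ κ₂) (s : unitInterval) :
    γ.speed s = hSpeedInv (γ.vHat s) := by rw [speed, Set.projIcc_val]

theorem curvature_coe (γ : AdmissibleCurve κ₁ κ₂) (s : unitInterval) :
    γ.curvature s = hCurvInv κ₁ κ₂ (γ.wHat s) := by rw [curvature, Set.projIcc_val]

theorem frameMatrix_coe (γ : AdmissibleCurve κ₁ κ₂) (s : unitInterval) :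
    γ.frameMatrix s = γ.frame s := by rw [frameMatrix, Set.projIcc_val]

theorem speed_pos (γ : AdmissibleCurve κ₁ κ₂) (x : ℝ) : 0 < γ.speed x := hSpeedInv_pos _

theorem memLp_speed (γ : AdmissibleCurve κ₁ κ₂) :
    MemLp (fun s : unitInterval => γ.speed s) 2 := by
  simp only [speed_coe]; exact memLp_comp abs_hSpeedInv_sub_le _

theorem memLp_curvature (hκ : κ₁ < κ₂) (γ : AdmissibleCurve κ₁ κ₂) :
    MemLp (fun s : unitInterval => γ.curvature s) 2 := by
  obtain ⟨c, -, hc⟩ := exists_abs_hCurvInv_sub_le hκ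
  simp only [curvature_coe]; exact memLp_comp hc _

theorem intervalIntegrable_speed (γ : AdmissibleCurve κ₁ κ₂) :
    IntervalIntegrable γ.speed volume 0 1 :=
  integrable_unitInterval_iff.1 (γ.memLp_speed.integrable one_le_two)

theorem intervalIntegrable_speed_mul_curvature (hκ : κ₁ < κ₂) (γ : AdmissibleCurve κ₁ κ₂) :
    IntervalIntegrable (fun x => γ.speed x * γ.curvature x) volume 0 1 :=
  integrable_unitInterval_iff.1 (γ.memLp_speed.integrable_mul (γ.memLp_curvature hκ))

theorem inBand (hκ : κ₁ < κ₂) (γ : AdmissibleCurve κ₁ κ₂) :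
    InBand γ.speed (fun x => γ.speed x * γ.curvature x) (arccot κ₁) (arccot κ₂) :=
  Eventually.of_forall fun x _ => band_speed_signs (γ.speed_pos x) (hCurvInv_mem hκ _)

theorem isFrame (hκ : κ₁ < κ₂) (γ : AdmissibleCurve κ₁ κ₂) :
    IsFrame γ.frameMatrix γ.speed (fun x => γ.speed x * γ.curvature x) := by
  have hmem : ∀ t, γ.frameMatrix t ∈ Matrix.specialOrthogonalGroup (Fin 3) ℝ := fun t =>
    (γ.frame _).2
  have hcont : ∀ i j, Continuous fun t => γ.frameMatrix t i j := fun i j => by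
    have h1 : Continuous fun t : ℝ => γ.frame (Set.projIcc 0 1 zero_le_one t) :=
      γ.frame.continuous.comp continuous_projIcc
    exact (continuous_subtype_val.comp h1).matrix_elem i j
  have hv := γ.intervalIntegrable_speed
  have hw := γ.intervalIntegrable_speed_mul_curvature hκ
  have hint : ∀ {f : ℝ → ℝ} (i j), IntervalIntegrable f volume 0 1 →
      IntervalIntegrable (fun t => f t * γ.frameMatrix t i j) volume 0 1 := fun i j hf =>
    hf.mul_continuousOn (hcont i j).continuousOn
  have key : ∀ i j, IntervalIntegrable (fun x => (γ.frameMatrix x *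
      logDeriv (γ.speed x) (γ.speed x * γ.curvature x)) i j) volume 0 1 →
      HasACDeriv (fun t => γ.frameMatrix t i j)
      (fun x => (γ.frameMatrix x * logDeriv (γ.speed x) (γ.speed x * γ.curvature x)) i j) := by
    intro i j hij
    refine HasACDeriv.of_integral hij fun t ht => ?_
    have h := γ.frame_eq ⟨t, ht⟩ i j
    have h2 := setIntegral_unitInterval_Iic (fun x => (γ.frameMatrix x *
      logDeriv (γ.speed x) (γ.speed x * γ.curvature x)) i j) ⟨t, ht⟩
    simp only [speed_coe, curvature_coe, frameMatrix_coe] at h2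
    have e0 : γ.frameMatrix 0 = γ.frame 0 := γ.frameMatrix_coe 0
    have et : γ.frameMatrix t = γ.frame ⟨t, ht⟩ := γ.frameMatrix_coe ⟨t, ht⟩
    simp only [e0, et, h, ← h2]
  have e0 : ∀ i x, (γ.frameMatrix x * logDeriv (γ.speed x) (γ.speed x * γ.curvature x)) i 0 =
      γ.speed x * γ.frameMatrix x i 1 := fun i x => by
    simp [Matrix.mul_apply, Fin.sum_univ_three, logDeriv]; ring
  have e1 : ∀ i x, (γ.frameMatrix x * logDeriv (γ.speed x) (γ.speed x * γ.curvature x)) i 1 =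
      -γ.speed x * γ.frameMatrix x i 0 + (γ.speed x * γ.curvature x) * γ.frameMatrix x i 2 :=
    fun i x => by simp [Matrix.mul_apply, Fin.sum_univ_three, logDeriv]; ring
  have e2 : ∀ i x, (γ.frameMatrix x * logDeriv (γ.speed x) (γ.speed x * γ.curvature x)) i 2 =
      -(γ.speed x * γ.curvature x) * γ.frameMatrix x i 1 := fun i x => by
    simp [Matrix.mul_apply, Fin.sum_univ_three, logDeriv]; ring
  refine ⟨hmem, fun i => ?_, fun i => ?_, fun i => ?_⟩
  · have := key i 0
    simp only [e0] at this
    exact this (hint i 1 hv)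
  · have := key i 1
    simp only [e1] at this
    exact this ((hint i 0 hv.neg).add (hint i 2 hw))
  · have := key i 2
    simp only [e2] at this
    exact this (hint i 1 hw.neg)

theorem tendsto_speed {ι : Type*} {l : Filter ι} {Γ : ι → AdmissibleCurve κ₁ κ₂}
    {γ : AdmissibleCurve κ₁ κ₂} (h : Tendsto Γ l (𝓝 γ)) :
    Tendsto (fun n => eLpNorm (fun s : unitInterval => (Γ n).speed s - γ.speed s) 2 volume) l
      (𝓝 0) := by
  rw [(Topology.IsInducing.mk rfl : IsInducing fun γ : AdmissibleCurve κ₁ κ₂ =>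
    (γ.frame 0, γ.vHat, γ.wHat)).tendsto_nhds_iff] at h
  simp only [speed_coe]
  exact tendsto_eLpNorm_comp_sub abs_hSpeedInv_sub_le
    ((continuous_fst.comp continuous_snd).tendsto _ |>.comp h)

theorem tendsto_curvature (hκ : κ₁ < κ₂) {ι : Type*} {l : Filter ι} {Γ : ι → AdmissibleCurve κ₁ κ₂}
    {γ : AdmissibleCurve κ₁ κ₂} (h : Tendsto Γ l (𝓝 γ)) :
    Tendsto (fun n => eLpNorm (fun s : unitInterval => (Γ n).curvature s - γ.curvature s) 2 volume) l
      (𝓝 0) := by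
  rw [(Topology.IsInducing.mk rfl : IsInducing fun γ : AdmissibleCurve κ₁ κ₂ =>
    (γ.frame 0, γ.vHat, γ.wHat)).tendsto_nhds_iff] at h
  obtain ⟨c, -, hc⟩ := exists_abs_hCurvInv_sub_le hκ
  simp only [curvature_coe]
  exact tendsto_eLpNorm_comp_sub hc ((continuous_snd.comp continuous_snd).tendsto _ |>.comp h)

end AdmissibleCurve

end

section

/-! ### Continuous dependence of frames and of the turning -/

theorem abs_entry_le_one {M : Matrix (Fin 3) (Fin 3) ℝ}
    (hM : M ∈ Matrix.specialOrthogonalGroup (Fin 3) ℝ) (i j : Fin 3) : |M i j| ≤ 1 := by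
  have h := (so3_entries hM).1 i i
  simp only [Fin.sum_univ_three, if_true] at h
  have h0 := mul_self_nonneg (M i 0)
  have h1 := mul_self_nonneg (M i 1)
  have h2 := mul_self_nonneg (M i 2)
  refine (sq_le_one_iff_abs_le_one _).1 ?_
  rw [pow_two]
  fin_cases j <;> [change M i 0 * M i 0 ≤ 1; change M i 1 * M i 1 ≤ 1; change M i 2 * M i 2 ≤ 1] <;>
    linarith

/-- Frames depend Lipschitz continuously on their initial value and on the `L¹` norm of their
logarithmic derivative, because `(A Bᵀ)' = A (Λ_A - Λ_B) Bᵀ`. -/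
theorem IsFrame.abs_sub_le {A B : ℝ → Matrix (Fin 3) (Fin 3) ℝ} {v w v' w' : ℝ → ℝ}
    (hA : IsFrame A v w) (hB : IsFrame B v' w')
    (hv : IntervalIntegrable (fun t => |v t - v' t|) volume 0 1)
    (hw : IntervalIntegrable (fun t => |w t - w' t|) volume 0 1)
    {t : ℝ} (ht : t ∈ Icc (0 : ℝ) 1) (i j : Fin 3) :
    |A t i j - B t i j| ≤ 6 * ((∫ s in (0 : ℝ)..1, |v s - v' s|) + ∫ s in (0 : ℝ)..1, |w s - w' s|) +
      3 * ∑ l, |A 0 i l - B 0 i l| := by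
  have hE : ∀ a b, HasACDeriv (fun t => ∑ j, A t a j * B t b j)
      (fun s => (v s - v' s) * (A s a 1 * B s b 0 - A s a 0 * B s b 1) +
        (w s - w' s) * (A s a 2 * B s b 1 - A s a 1 * B s b 2)) := fun a b => by
    have := (((hA.deriv_pos a).mul (hB.deriv_pos b)).add ((hA.deriv_tan a).mul
      (hB.deriv_tan b))).add ((hA.deriv_nor a).mul (hB.deriv_nor b))
    refine (this.congr fun t _ => ?_).congr_deriv (Eventually.of_forall fun s _ => ?_)
    · rw [Fin.sum_univ_three]
    · ring
  have hbd : ∀ a b, |∑ j, A t a j * B t b j - ∑ j, A 0 a j * B 0 b j| ≤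
      2 * ((∫ s in (0 : ℝ)..1, |v s - v' s|) + ∫ s in (0 : ℝ)..1, |w s - w' s|) := fun a b => by
    rw [← (hE a b).integral_eq (by simp) ht, ← intervalIntegral.integral_add hv hw,
      ← intervalIntegral.integral_const_mul]
    have hvw : IntervalIntegrable (fun s => 2 * (|v s - v' s| + |w s - w' s|)) volume 0 1 :=
      (hv.add hw).const_mul 2
    rw [← Real.norm_eq_abs]
    refine le_trans (intervalIntegral.norm_integral_le_of_norm_le
      (g := fun s => 2 * (|v s - v' s| + |w s - w' s|)) ht.1
      (Eventually.of_forall fun s _ => ?_) (hvw.mono_set ?_)) ?_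
    · rw [Real.norm_eq_abs]
      have e : ∀ a' b' c d : ℝ, |a'| ≤ 1 → |b'| ≤ 1 → |c| ≤ 1 → |d| ≤ 1 → |a' * b' - c * d| ≤ 2 :=
        fun a' b' c d ha hb hc hd => by
          refine (abs_sub _ _).trans ?_
          rw [abs_mul, abs_mul]
          nlinarith [abs_nonneg a', abs_nonneg b', abs_nonneg c, abs_nonneg d]
      have a1 := abs_entry_le_one (hA.mem s)
      have b1 := abs_entry_le_one (hB.mem s)
      refine (abs_add_le _ _).trans ?_
      rw [abs_mul, abs_mul]
      have e1 := e _ _ _ _ (a1 a 1) (b1 b 0) (a1 a 0) (b1 b 1)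
      have e2 := e _ _ _ _ (a1 a 2) (b1 b 1) (a1 a 1) (b1 b 2)
      nlinarith [abs_nonneg (v s - v' s), abs_nonneg (w s - w' s)]
    · rw [uIcc_of_le ht.1, uIcc_of_le zero_le_one]; exact Icc_subset_Icc_right ht.2
    · refine intervalIntegral.integral_mono_interval le_rfl ht.1 ht.2
        (Eventually.of_forall fun s => ?_) hvw
      simp only [Pi.zero_apply]; positivity
  obtain ⟨ot, oc, -, -⟩ := so3_entries (hB.mem t)
  have hdec : A t i j - B t i j =
      ∑ l, (∑ m, A t i m * B t l m - ∑ m, A 0 i m * B 0 l m + ∑ m, (A 0 i m - B 0 i m) * B 0 l m)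
        * B t l j := by
    have h0 := (so3_entries (hB.mem 0)).1
    have c0 := oc 0 j
    have c1 := oc 1 j
    have c2 := oc 2 j
    have r0 := h0 i 0
    have r1 := h0 i 1
    have r2 := h0 i 2
    simp only [Fin.sum_univ_three] at c0 c1 c2 r0 r1 r2 ⊢
    have hd : B t i j = (if i = 0 then 1 else 0) * B t 0 j + (if i = 1 then 1 else 0) * B t 1 j +
        (if i = 2 then 1 else 0) * B t 2 j := by fin_cases i <;> simp
    have hd' : A t i j = A t i 0 * (if (0 : Fin 3) = j then 1 else 0) +
        A t i 1 * (if (1 : Fin 3) = j then 1 else 0) + A t i 2 * (if (2 : Fin 3) = j then 1 else 0) := by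
      fin_cases j <;> simp
    rw [hd, hd', ← c0, ← c1, ← c2, ← r0, ← r1, ← r2]
    ring
  rw [hdec]
  have hterm : ∀ l, |(∑ m, A t i m * B t l m - ∑ m, A 0 i m * B 0 l m +
      ∑ m, (A 0 i m - B 0 i m) * B 0 l m) * B t l j| ≤
      2 * ((∫ s in (0 : ℝ)..1, |v s - v' s|) + ∫ s in (0 : ℝ)..1, |w s - w' s|) +
        ∑ m, |A 0 i m - B 0 i m| := fun l => by
    rw [abs_mul]
    refine (mul_le_of_le_one_right (abs_nonneg _) (abs_entry_le_one (hB.mem t) l j)).trans ?_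
    refine (abs_add_le _ _).trans (add_le_add (hbd i l) ((Finset.abs_sum_le_sum_abs _ _).trans
      (Finset.sum_le_sum fun m _ => ?_)))
    rw [abs_mul]
    exact mul_le_of_le_one_right (abs_nonneg _) (abs_entry_le_one (hB.mem 0) l m)
  refine (Finset.abs_sum_le_sum_abs _ _).trans ((Finset.sum_le_sum fun l _ => hterm l).trans ?_)
  rw [Finset.sum_const, Finset.card_univ, Fintype.card_fin, nsmul_eq_mul]
  push_cast
  linarith

/-- Convergence of frames: of the initial frame, and of the logarithmic derivative in `L¹`. -/
structure TendstoFrame {ι : Type*} (l : Filter ι) (A : ι → ℝ → Matrix (Fin 3) (Fin 3) ℝ)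
    (v w : ι → ℝ → ℝ) (A₀ : ℝ → Matrix (Fin 3) (Fin 3) ℝ) (v₀ w₀ : ℝ → ℝ) : Prop where
  isFrame : ∀ n, IsFrame (A n) (v n) (w n)
  isFrame_lim : IsFrame A₀ v₀ w₀
  int_v : ∀ n, IntervalIntegrable (v n) volume 0 1
  int_w : ∀ n, IntervalIntegrable (w n) volume 0 1
  int_v_lim : IntervalIntegrable v₀ volume 0 1
  int_w_lim : IntervalIntegrable w₀ volume 0 1
  init : ∀ i j, Tendsto (fun n => A n 0 i j) l (𝓝 (A₀ 0 i j))
  speed : Tendsto (fun n => ∫ t in (0 : ℝ)..1, |v n t - v₀ t|) l (𝓝 0)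
  normal : Tendsto (fun n => ∫ t in (0 : ℝ)..1, |w n t - w₀ t|) l (𝓝 0)

namespace TendstoFrame

variable {ι : Type*} {l : Filter ι} {A : ι → ℝ → Matrix (Fin 3) (Fin 3) ℝ}
  {v w : ι → ℝ → ℝ} {A₀ : ℝ → Matrix (Fin 3) (Fin 3) ℝ} {v₀ w₀ : ℝ → ℝ}

theorem tendstoUniformlyOn (h : TendstoFrame l A v w A₀ v₀ w₀) (i j : Fin 3) :
    TendstoUniformlyOn (fun n t => A n t i j) (fun t => A₀ t i j) l (Icc 0 1) := by
  have hb : Tendsto (fun n => 6 * ((∫ s in (0 : ℝ)..1, |v n s - v₀ s|) +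
      ∫ s in (0 : ℝ)..1, |w n s - w₀ s|) + 3 * ∑ m, |A n 0 i m - A₀ 0 i m|) l (𝓝 0) := by
    have h1 : Tendsto (fun n => ∑ m, |A n 0 i m - A₀ 0 i m|) l (𝓝 0) := by
      have := tendsto_finsetSum (Finset.univ : Finset (Fin 3)) fun m _ =>
        ((h.init i m).sub_const (A₀ 0 i m)).abs
      simpa using this
    simpa using ((h.speed.add h.normal).const_mul 6).add (h1.const_mul 3)
  rw [Metric.tendstoUniformlyOn_iff]
  intro ε hε
  filter_upwards [hb.eventually_lt_const hε] with n hn t ht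
  rw [dist_comm, Real.dist_eq]
  exact ((h.isFrame n).abs_sub_le h.isFrame_lim ((h.int_v n).sub h.int_v_lim).abs
    ((h.int_w n).sub h.int_w_lim).abs ht i j).trans_lt hn

theorem tendstoUniformlyOn_bodyComp (h : TendstoFrame l A v w A₀ v₀ w₀) {η : ι → Fin 3 → ℝ}
    {η₀ : Fin 3 → ℝ} (hη : Tendsto η l (𝓝 η₀)) (j : Fin 3) :
    TendstoUniformlyOn (fun n t => bodyComp (A n t) (η n) j) (fun t => bodyComp (A₀ t) η₀ j) l
      (Icc 0 1) := by
  have hb : Tendsto (fun n => ∑ i, |η n i - η₀ i|) l (𝓝 0) := by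
    have := tendsto_finsetSum (Finset.univ : Finset (Fin 3)) fun m _ =>
      (((tendsto_pi_nhds.1 hη) m).sub_const (η₀ m)).abs
    simpa using this
  have hC : 0 < ∑ i, |η₀ i| + 1 := by positivity
  rw [Metric.tendstoUniformlyOn_iff]
  intro ε hε
  have hu := fun i => (Metric.tendstoUniformlyOn_iff.1 (h.tendstoUniformlyOn i j))
    (ε / (2 * (∑ i, |η₀ i| + 1))) (by positivity)
  filter_upwards [hb.eventually_lt_const (half_pos hε), hu 0, hu 1, hu 2] with n hn h0 h1 h2 t ht
  have hu' : ∀ i, |A n t i j - A₀ t i j| ≤ ε / (2 * (∑ i, |η₀ i| + 1)) := fun i => by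
    rw [← Real.dist_eq, dist_comm]
    fin_cases i
    exacts [(h0 t ht).le, (h1 t ht).le, (h2 t ht).le]
  rw [dist_comm, Real.dist_eq]
  have e : bodyComp (A n t) (η n) j - bodyComp (A₀ t) η₀ j =
      ∑ i, (η n i - η₀ i) * A n t i j + ∑ i, η₀ i * (A n t i j - A₀ t i j) := by
    simp only [bodyComp, Fin.sum_univ_three]; ring
  have b1 : |∑ i, (η n i - η₀ i) * A n t i j| ≤ ∑ i, |η n i - η₀ i| :=
    (Finset.abs_sum_le_sum_abs _ _).trans (Finset.sum_le_sum fun i _ => by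
      rw [abs_mul]
      exact mul_le_of_le_one_right (abs_nonneg _) (abs_entry_le_one ((h.isFrame n).mem t) i j))
  have b2 : |∑ i, η₀ i * (A n t i j - A₀ t i j)| ≤ (∑ i, |η₀ i|) * (ε / (2 * (∑ i, |η₀ i| + 1))) := by
    rw [Finset.sum_mul]
    exact (Finset.abs_sum_le_sum_abs _ _).trans (Finset.sum_le_sum fun i _ => by
      rw [abs_mul]; exact mul_le_mul_of_nonneg_left (hu' i) (abs_nonneg _))
  have b3 : (∑ i, |η₀ i|) * (ε / (2 * (∑ i, |η₀ i| + 1))) ≤ ε / 2 := by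
    rw [mul_div_assoc', div_le_div_iff₀ (by positivity) two_pos]
    nlinarith
  rw [e]
  exact (abs_add_le _ _).trans_lt (by linarith)

theorem tendstoUniformlyOn_bandHeight (h : TendstoFrame l A v w A₀ v₀ w₀) (η₀ : Fin 3 → ℝ) (θ : ℝ) :
    TendstoUniformlyOn (fun n t => bandHeight (A n t) η₀ θ) (fun t => bandHeight (A₀ t) η₀ θ) l
      (Icc 0 1) := by
  rw [Metric.tendstoUniformlyOn_iff]
  intro ε hε
  have hu := fun j => (Metric.tendstoUniformlyOn_iff.1 (h.tendstoUniformlyOn_bodyComp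
    (η := fun _ => η₀) tendsto_const_nhds j)) (ε / 2) (by positivity)
  filter_upwards [hu 0, hu 2] with n h0 h2 t ht
  have h0 := h0 t ht
  have h2 := h2 t ht
  rw [Real.dist_eq] at h0 h2 ⊢
  rw [bandHeight_eq, bandHeight_eq]
  have e : Real.cos θ * bodyComp (A₀ t) η₀ 0 + Real.sin θ * bodyComp (A₀ t) η₀ 2 -
      (Real.cos θ * bodyComp (A n t) η₀ 0 + Real.sin θ * bodyComp (A n t) η₀ 2) =
      Real.cos θ * (bodyComp (A₀ t) η₀ 0 - bodyComp (A n t) η₀ 0) +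
      Real.sin θ * (bodyComp (A₀ t) η₀ 2 - bodyComp (A n t) η₀ 2) := by ring
  rw [e]
  refine (abs_add_le _ _).trans_lt ?_
  rw [abs_mul, abs_mul]
  have c1 := Real.abs_cos_le_one θ
  have c2 := Real.abs_sin_le_one θ
  nlinarith [abs_nonneg (bodyComp (A₀ t) η₀ 0 - bodyComp (A n t) η₀ 0),
    abs_nonneg (bodyComp (A₀ t) η₀ 2 - bodyComp (A n t) η₀ 2)]

theorem _root_.SphereCurves.exists_pos_le_of_continuousOn {f : ℝ → ℝ}
    (hf : ContinuousOn f (Icc 0 1)) (hpos : ∀ t ∈ Icc (0 : ℝ) 1, 0 < f t) :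
    ∃ c > 0, ∀ t ∈ Icc (0 : ℝ) 1, c ≤ f t := by
  obtain ⟨x, hx, hmin⟩ := isCompact_Icc.exists_isMinOn (by simp) hf
  exact ⟨f x, hpos x hx, fun t ht => hmin ht⟩

theorem _root_.TendstoUniformlyOn.eventually_pos {F : ι → ℝ → ℝ} {f : ℝ → ℝ}
    (h : TendstoUniformlyOn F f l (Icc 0 1)) (hf : ContinuousOn f (Icc 0 1))
    (hpos : ∀ t ∈ Icc (0 : ℝ) 1, 0 < f t) : ∀ᶠ n in l, ∀ t ∈ Icc (0 : ℝ) 1, 0 < F n t := by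
  obtain ⟨c, hc, hcf⟩ := exists_pos_le_of_continuousOn hf hpos
  filter_upwards [Metric.tendstoUniformlyOn_iff.1 h c hc] with n hn t ht
  have h1 := hn t ht
  rw [Real.dist_eq] at h1
  linarith [hcf t ht, (abs_lt.1 h1).2]

theorem _root_.SphereCurves.tendsto_integral_mul [l.IsCountablyGenerated] {F p : ι → ℝ → ℝ}
    {f q : ℝ → ℝ} {C : ℝ} (hF : ∀ n, IntervalIntegrable (F n) volume 0 1)
    (hf : IntervalIntegrable f volume 0 1)
    (h : Tendsto (fun n => ∫ t in (0 : ℝ)..1, |F n t - f t|) l (𝓝 0))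
    (hp : ∀ᶠ n in l, ContinuousOn (p n) (Icc 0 1))
    (hpC : ∀ᶠ n in l, ∀ t ∈ Icc (0 : ℝ) 1, |p n t| ≤ C)
    (hpq : ∀ t ∈ Icc (0 : ℝ) 1, Tendsto (fun n => p n t) l (𝓝 (q t))) :
    Tendsto (fun n => ∫ t in (0 : ℝ)..1, F n t * p n t) l (𝓝 (∫ t in (0 : ℝ)..1, f t * q t)) := by
  have hI : uIcc (0 : ℝ) 1 = Icc 0 1 := uIcc_of_le zero_le_one
  have hI' : ∀ {x : ℝ}, x ∈ uIoc (0 : ℝ) 1 → x ∈ Icc (0 : ℝ) 1 := fun {x} hx => by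
    rw [uIoc_of_le zero_le_one] at hx; exact Ioc_subset_Icc_self hx
  have h1 : Tendsto (fun n => ∫ t in (0 : ℝ)..1, f t * p n t) l
      (𝓝 (∫ t in (0 : ℝ)..1, f t * q t)) := by
    refine intervalIntegral.tendsto_integral_filter_of_dominated_convergence (fun t => |f t| * C)
      ?_ ?_ (hf.abs.mul_const C) ?_
    · filter_upwards [hp] with n hn
      have hi : IntervalIntegrable (fun t => f t * p n t) volume 0 1 :=
        hf.mul_continuousOn (by rwa [hI])
      exact (intervalIntegrable_iff.1 hi).aestronglyMeasurable
    · filter_upwards [hpC] with n hn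
      refine Eventually.of_forall fun t ht => ?_
      rw [norm_mul, Real.norm_eq_abs, Real.norm_eq_abs]
      exact mul_le_mul_of_nonneg_left (hn t (hI' ht)) (abs_nonneg _)
    · exact Eventually.of_forall fun t ht => (hpq t (hI' ht)).const_mul (f t)
  have h2 : Tendsto (fun n => ∫ t in (0 : ℝ)..1, (F n t - f t) * p n t) l (𝓝 0) := by
    have hb : Tendsto (fun n => (∫ t in (0 : ℝ)..1, |F n t - f t|) * C) l (𝓝 0) := by
      simpa using h.mul_const C
    refine squeeze_zero_norm' ?_ hb
    filter_upwards [hpC] with n hn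
    rw [← intervalIntegral.integral_mul_const]
    refine intervalIntegral.norm_integral_le_of_norm_le zero_le_one (Eventually.of_forall
      fun t ht => ?_) (((hF n).sub hf).abs.mul_const C)
    rw [norm_mul, Real.norm_eq_abs, Real.norm_eq_abs]
    exact mul_le_mul_of_nonneg_left (hn t (Ioc_subset_Icc_self ht)) (abs_nonneg _)
  have h3 := h2.add h1
  rw [zero_add] at h3
  refine h3.congr' ?_
  filter_upwards [hp] with n hn
  rw [← intervalIntegral.integral_add]
  · exact intervalIntegral.integral_congr fun t _ => by ring
  · exact ((hF n).sub hf).mul_continuousOn (by rwa [hI])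
  · exact hf.mul_continuousOn (by rwa [hI])

/-- The turning depends continuously on the curve and on the direction. -/
theorem tendsto_turning [l.IsCountablyGenerated] (h : TendstoFrame l A v w A₀ v₀ w₀)
    {η : ι → Fin 3 → ℝ} {η₀ : Fin 3 → ℝ} (hη : Tendsto η l (𝓝 η₀))
    (hpos : ∀ t ∈ Icc (0 : ℝ) 1, 0 < bodyComp (A₀ t) η₀ 0 ^ 2 + bodyComp (A₀ t) η₀ 2 ^ 2) :
    Tendsto (fun n => turning (v n) (w n) (fun t => bodyComp (A n t) (η n)) 1) l
      (𝓝 (turning v₀ w₀ (fun t => bodyComp (A₀ t) η₀) 1)) := by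
  have hcA := fun n j => (h.isFrame n).bodyComp_continuousOn (η n) j
  have hc0 := fun j => h.isFrame_lim.bodyComp_continuousOn η₀ j
  obtain ⟨c, hc, hcN⟩ := exists_pos_le_of_continuousOn (((hc0 0).pow 2).add ((hc0 2).pow 2)) hpos
  have hu := fun j => h.tendstoUniformlyOn_bodyComp hη j
  obtain ⟨D, hD⟩ : ∃ D, ∀ j, ∀ t ∈ Icc (0 : ℝ) 1, |bodyComp (A₀ t) η₀ j| ≤ D := by
    refine ⟨∑ i, |η₀ i|, fun j t _ => (Finset.abs_sum_le_sum_abs _ _).trans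
      (Finset.sum_le_sum fun i _ => ?_)⟩
    rw [abs_mul]
    exact mul_le_of_le_one_right (abs_nonneg _) (abs_entry_le_one (h.isFrame_lim.mem t) i j)
  have hD0 : 0 ≤ D := (abs_nonneg _).trans (hD 0 0 (by simp))
  -- the quadratic form changes by less than `c / 2` once the components change by at most `e`
  set e := min 1 (c / (8 * (D + 1))) with he
  have he0 : 0 < e := lt_min one_pos (by positivity)
  have he1 : e ≤ 1 := min_le_left _ _
  have he2 : e * (8 * (D + 1)) ≤ c := by
    have := min_le_right 1 (c / (8 * (D + 1)))
    rwa [← he, le_div_iff₀ (by positivity)] at this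
  have hev : ∀ᶠ n in l, ∀ t ∈ Icc (0 : ℝ) 1, (∀ j, j = 0 ∨ j = 2 → |bodyComp (A n t) (η n) j| ≤ D + 1) ∧
      c / 2 ≤ bodyComp (A n t) (η n) 0 ^ 2 + bodyComp (A n t) (η n) 2 ^ 2 := by
    filter_upwards [Metric.tendstoUniformlyOn_iff.1 (hu 0) e he0,
      Metric.tendstoUniformlyOn_iff.1 (hu 2) e he0] with n h0 h2 t ht
    have h0 := h0 t ht
    have h2 := h2 t ht
    rw [Real.dist_eq] at h0 h2
    have d0 := hD 0 t ht
    have d2 := hD 2 t ht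
    have hN : c ≤ bodyComp (A₀ t) η₀ 0 ^ 2 + bodyComp (A₀ t) η₀ 2 ^ 2 := hcN t ht
    have key : ∀ x y : ℝ, |x - y| < e → |x| ≤ D → |y| ≤ D + 1 ∧ x ^ 2 - 2 * D * e ≤ y ^ 2 := by
      intro x y hxy hx
      have h1 : |y| ≤ |x| + |x - y| := by
        have := abs_sub_abs_le_abs_sub y x
        rw [abs_sub_comm y x] at this; linarith
      have h2 : |x| ≤ |y| + |x - y| := by
        have := abs_sub_abs_le_abs_sub x y; linarith
      refine ⟨by linarith, ?_⟩
      rw [← sq_abs x, ← sq_abs y]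
      have hx0 := abs_nonneg x
      have hy0 := abs_nonneg y
      have hDe := mul_nonneg hD0 he0.le
      rcases le_total |x| |y| with hle | hle
      · have := mul_self_le_mul_self hx0 hle
        nlinarith
      · have h3 : (|x| - |y|) * (|x| + |y|) ≤ e * (2 * D) :=
          mul_le_mul (by linarith) (by linarith) (by linarith) he0.le
        nlinarith
    obtain ⟨k0, k0'⟩ := key _ _ h0 d0
    obtain ⟨k2, k2'⟩ := key _ _ h2 d2
    refine ⟨?_, by nlinarith⟩
    rintro j (rfl | rfl)
    exacts [k0, k2]
  have main : ∀ j, j = 0 ∨ j = 2 → ∀ {F : ι → ℝ → ℝ} {f : ℝ → ℝ},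
      (∀ n, IntervalIntegrable (F n) volume 0 1) → IntervalIntegrable f volume 0 1 →
      Tendsto (fun n => ∫ t in (0 : ℝ)..1, |F n t - f t|) l (𝓝 0) →
      Tendsto (fun n => ∫ t in (0 : ℝ)..1, F n t * (bodyComp (A n t) (η n) j /
        (bodyComp (A n t) (η n) 0 ^ 2 + bodyComp (A n t) (η n) 2 ^ 2))) l
        (𝓝 (∫ t in (0 : ℝ)..1, f t * (bodyComp (A₀ t) η₀ j /
          (bodyComp (A₀ t) η₀ 0 ^ 2 + bodyComp (A₀ t) η₀ 2 ^ 2)))) := by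
    intro j hj F f hF hf hFf
    refine tendsto_integral_mul (C := (D + 1) / (c / 2)) hF hf hFf ?_ ?_ ?_
    · filter_upwards [hev] with n hn
      exact (hcA n j).div (((hcA n 0).pow 2).add ((hcA n 2).pow 2)) fun t ht =>
        ((half_pos hc).trans_le (hn t ht).2).ne'
    · filter_upwards [hev] with n hn t ht
      obtain ⟨b1, b2⟩ := hn t ht
      rw [abs_div, abs_of_pos (lt_of_lt_of_le (half_pos hc) b2)]
      exact div_le_div₀ (by positivity) (b1 j hj) (half_pos hc) b2
    · intro t ht
      have ht' := fun j => (hu j).tendsto_at ht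
      exact (ht' j).div (((ht' 0).pow 2).add ((ht' 2).pow 2)) (hpos t ht).ne'
  have hs := (main 2 (Or.inr rfl) h.int_v h.int_v_lim h.speed).add
    (main 0 (Or.inl rfl) h.int_w h.int_w_lim h.normal)
  have hint : ∀ {F q : ℝ → ℝ}, IntervalIntegrable F volume 0 1 → ContinuousOn q (Icc 0 1) →
      IntervalIntegrable (fun t => F t * q t) volume 0 1 := fun hF hq =>
    hF.mul_continuousOn (by rwa [uIcc_of_le zero_le_one])
  have hlim : turning v₀ w₀ (fun t => bodyComp (A₀ t) η₀) 1 =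
      (∫ t in (0 : ℝ)..1, v₀ t * (bodyComp (A₀ t) η₀ 2 /
          (bodyComp (A₀ t) η₀ 0 ^ 2 + bodyComp (A₀ t) η₀ 2 ^ 2))) +
      ∫ t in (0 : ℝ)..1, w₀ t * (bodyComp (A₀ t) η₀ 0 /
          (bodyComp (A₀ t) η₀ 0 ^ 2 + bodyComp (A₀ t) η₀ 2 ^ 2)) := by
    rw [← intervalIntegral.integral_add]
    · exact intervalIntegral.integral_congr fun t _ => by simp only; ring
    · exact hint h.int_v_lim ((hc0 2).div (((hc0 0).pow 2).add ((hc0 2).pow 2)) fun t ht =>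
        (hpos t ht).ne')
    · exact hint h.int_w_lim ((hc0 0).div (((hc0 0).pow 2).add ((hc0 2).pow 2)) fun t ht =>
        (hpos t ht).ne')
  rw [hlim]
  refine hs.congr' ?_
  filter_upwards [hev] with n hn
  have hne : ∀ t ∈ Icc (0 : ℝ) 1, bodyComp (A n t) (η n) 0 ^ 2 + bodyComp (A n t) (η n) 2 ^ 2 ≠ 0 :=
    fun t ht => ((half_pos hc).trans_le (hn t ht).2).ne'
  rw [← intervalIntegral.integral_add]
  · exact intervalIntegral.integral_congr fun t _ => by simp only; ring
  · exact hint (h.int_v n) ((hcA n 2).div (((hcA n 0).pow 2).add ((hcA n 2).pow 2)) hne)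
  · exact hint (h.int_w n) ((hcA n 0).div (((hcA n 0).pow 2).add ((hcA n 2).pow 2)) hne)

end TendstoFrame

/-- Continuity of frames in the topology on the space of admissible curves. -/
theorem AdmissibleCurve.tendstoFrame {κ₁ κ₂ : EReal} (hκ : κ₁ < κ₂) {ι : Type*} {l : Filter ι}
    {Γ : ι → AdmissibleCurve κ₁ κ₂} {γ : AdmissibleCurve κ₁ κ₂} (h : Tendsto Γ l (𝓝 γ)) :
    TendstoFrame l (fun n => (Γ n).frameMatrix) (fun n => (Γ n).speed)
      (fun n x => (Γ n).speed x * (Γ n).curvature x) γ.frameMatrix γ.speed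
      (fun x => γ.speed x * γ.curvature x) where
  isFrame n := (Γ n).isFrame hκ
  isFrame_lim := γ.isFrame hκ
  int_v n := (Γ n).intervalIntegrable_speed
  int_w n := (Γ n).intervalIntegrable_speed_mul_curvature hκ
  int_v_lim := γ.intervalIntegrable_speed
  int_w_lim := γ.intervalIntegrable_speed_mul_curvature hκ
  init i j := by
    have h' := h
    rw [(Topology.IsInducing.mk rfl : IsInducing fun γ : AdmissibleCurve κ₁ κ₂ =>
      (γ.frame 0, γ.vHat, γ.wHat)).tendsto_nhds_iff] at h'
    have h1 := (continuous_fst.tendsto _).comp h'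
    have e0 : ∀ γ : AdmissibleCurve κ₁ κ₂, γ.frameMatrix 0 = γ.frame 0 := fun γ =>
      γ.frameMatrix_coe 0
    simp only [e0]
    exact ((continuous_subtype_val.matrix_elem i j).tendsto _).comp h1
  speed := by
    refine tendsto_integral_abs_of_eLpNorm ?_ fun n => ((Γ n).memLp_speed.sub γ.memLp_speed).1
    refine tendsto_of_tendsto_of_tendsto_of_le_of_le tendsto_const_nhds (tendsto_speed h)
      (fun _ => zero_le) fun n => ?_
    exact eLpNorm_le_eLpNorm_of_exponent_le one_le_two ((Γ n).memLp_speed.sub γ.memLp_speed).1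
  normal :=
    tendsto_integral_abs_of_eLpNorm (tendsto_eLpNorm_mul_sub (fun n => (Γ n).memLp_speed)
      (fun n => (Γ n).memLp_curvature hκ) γ.memLp_speed (γ.memLp_curvature hκ) (tendsto_speed h)
      (tendsto_curvature hκ h)) fun n =>
      (((Γ n).memLp_speed.1.mul ((Γ n).memLp_curvature hκ).1).sub
        (γ.memLp_speed.1.mul (γ.memLp_curvature hκ).1))

end

section

/-! ### The turning number as an invariant of connected components -/

theorem eq_of_continuousOn_of_int {f : ℝ → ℝ} (hf : ContinuousOn f (Icc 0 1))
    (hint : ∀ t ∈ Icc (0 : ℝ) 1, ∃ n : ℤ, f t = 2 * Real.pi * n) {t : ℝ} (ht : t ∈ Icc (0 : ℝ) 1) :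
    f t = f 0 := by
  have h0 : (0 : ℝ) ∈ Icc (0 : ℝ) 1 := by simp
  have hord : OrdConnected (f '' Icc 0 1) := (isPreconnected_Icc.image f hf).ordConnected
  obtain ⟨n, hn⟩ := hint t ht
  obtain ⟨m, hm⟩ := hint 0 h0
  have hpi := Real.pi_pos
  have key : ∀ {a b : ℝ} {p q : ℤ}, a ∈ f '' Icc 0 1 → b ∈ f '' Icc 0 1 → a = 2 * Real.pi * p →
      b = 2 * Real.pi * q → ¬ p < q := by
    intro a b p q ha hb hap hbq hpq
    have hpq' : (p : ℝ) + 1 ≤ q := by exact_mod_cast hpq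
    obtain ⟨s, hs, hfs⟩ := hord.out ha hb
      (show 2 * Real.pi * p + Real.pi ∈ Icc a b from ⟨by linarith, by nlinarith⟩)
    obtain ⟨r, hr⟩ := hint s hs
    rw [hr] at hfs
    have h1 : (2 * (r : ℝ)) = 2 * p + 1 := by
      have : Real.pi * (2 * (r : ℝ) - (2 * p + 1)) = 0 := by linarith
      have := (mul_eq_zero.1 this).resolve_left hpi.ne'
      linarith
    have h2 : 2 * r = 2 * p + 1 := by exact_mod_cast h1
    omega
  have h1 := key ⟨t, ht, rfl⟩ ⟨0, h0, rfl⟩ hn hm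
  have h2 := key ⟨0, h0, rfl⟩ ⟨t, ht, rfl⟩ hm hn
  rw [hn, hm, le_antisymm (not_lt.1 h2) (not_lt.1 h1)]

theorem bandHeight_add_smul (M : Matrix (Fin 3) (Fin 3) ℝ) (a b : ℝ) (h h' : Fin 3 → ℝ) (θ : ℝ) :
    bandHeight M (a • h + b • h') θ = a * bandHeight M h θ + b * bandHeight M h' θ := by
  simp only [bandHeight, Fin.sum_univ_three, Pi.add_apply, Pi.smul_apply, smul_eq_mul]; ring

theorem bandHeight_smul (M : Matrix (Fin 3) (Fin 3) ℝ) (a : ℝ) (h : Fin 3 → ℝ) (θ : ℝ) :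
    bandHeight M (a • h) θ = a * bandHeight M h θ := by
  simp only [bandHeight, Fin.sum_univ_three, Pi.smul_apply, smul_eq_mul]; ring

theorem normal_part_pos_of_bandHeight_pos {M : Matrix (Fin 3) (Fin 3) ℝ} {h : Fin 3 → ℝ} {θ : ℝ}
    (hp : 0 < bandHeight M h θ) : 0 < bodyComp M h 0 ^ 2 + bodyComp M h 2 ^ 2 := by
  by_contra! hc
  have h0 : bodyComp M h 0 = 0 := by
    nlinarith [sq_nonneg (bodyComp M h 0), sq_nonneg (bodyComp M h 2)]
  have h2 : bodyComp M h 2 = 0 := by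
    nlinarith [sq_nonneg (bodyComp M h 0), sq_nonneg (bodyComp M h 2)]
  rw [bandHeight_eq, h0, h2] at hp
  simp at hp

/-- The positive multiple of Euclidean norm one of a nonzero vector. -/
def unitVec (h : Fin 3 → ℝ) : Fin 3 → ℝ := (√(∑ i, h i ^ 2))⁻¹ • h

theorem sum_sq_pos_of_bandHeight_pos {M : Matrix (Fin 3) (Fin 3) ℝ} {h : Fin 3 → ℝ} {θ : ℝ}
    (hp : 0 < bandHeight M h θ) : 0 < ∑ i, h i ^ 2 := by
  by_contra! hc
  have hz := (Finset.sum_eq_zero_iff_of_nonneg fun i _ => sq_nonneg (h i)).1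
    (le_antisymm hc (Finset.sum_nonneg fun i _ => sq_nonneg (h i)))
  have hz' : ∀ i, h i = 0 := fun i => pow_eq_zero_iff two_ne_zero |>.1 (hz i (Finset.mem_univ i))
  simp [bandHeight, hz'] at hp

theorem sum_sq_unitVec {h : Fin 3 → ℝ} (hp : 0 < ∑ i, h i ^ 2) : ∑ i, unitVec h i ^ 2 = 1 := by
  simp only [unitVec, Pi.smul_apply, smul_eq_mul, mul_pow, ← Finset.mul_sum]
  rw [inv_pow, Real.sq_sqrt hp.le, inv_mul_cancel₀ hp.ne']

theorem unitVec_of_sum_sq_eq_one {h : Fin 3 → ℝ} (hp : ∑ i, h i ^ 2 = 1) : unitVec h = h := by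
  simp [unitVec, hp]

theorem bandHeight_unitVec_pos {M : Matrix (Fin 3) (Fin 3) ℝ} {h : Fin 3 → ℝ} {θ : ℝ}
    (hp : 0 < bandHeight M h θ) : 0 < bandHeight M (unitVec h) θ := by
  rw [unitVec, bandHeight_smul]
  exact mul_pos (inv_pos.2 (Real.sqrt_pos.2 (sum_sq_pos_of_bandHeight_pos hp))) hp

theorem tendsto_unitVec {ι : Type*} {l : Filter ι} {η : ι → Fin 3 → ℝ} {h : Fin 3 → ℝ}
    (hη : Tendsto η l (𝓝 h)) (hp : 0 < ∑ i, h i ^ 2) :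
    Tendsto (fun n => unitVec (η n)) l (𝓝 (unitVec h)) := by
  have h1 : Tendsto (fun n => ∑ i, η n i ^ 2) l (𝓝 (∑ i, h i ^ 2)) :=
    tendsto_finsetSum _ fun i _ => ((tendsto_pi_nhds.1 hη) i).pow 2
  exact (h1.sqrt.inv₀ (Real.sqrt_pos.2 hp).ne').smul hη

/-- The tangent of a closed curve makes an integral number of turns. -/
theorem IsFrame.exists_int_turning {A : ℝ → Matrix (Fin 3) (Fin 3) ℝ} {v w : ℝ → ℝ}
    (hA : IsFrame A v w) (hcl : A 0 = A 1) {h : Fin 3 → ℝ} (hh : ∑ i, h i ^ 2 = 1)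
    (hpos : ∀ t ∈ Icc (0 : ℝ) 1, 0 < bodyComp (A t) h 0 ^ 2 + bodyComp (A t) h 2 ^ 2) :
    ∃ n : ℤ, turning v w (fun t => bodyComp (A t) h) 1 = 2 * Real.pi * n := by
  obtain ⟨Q, hQ, hQh, h0, h0'⟩ := exists_adapted_rotation (hA.mem 0) hh (hpos 0 (by simp))
  have hrow : ∀ t, bodyComp (A t) h = (Q * A t) 2 := fun t => by
    ext j; rw [Matrix.mul_apply, hQh]; rfl
  obtain ⟨-, hp⟩ := (hA.mul_left hQ).turning_polar
    (fun t ht => by simpa only [← hrow] using hpos t ht) h0 h0'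
  obtain ⟨h1, h2⟩ := hp 1 (by simp)
  simp only [← hrow] at h1 h2
  rw [← hcl] at h1 h2
  rw [h0', zero_eq_mul] at h2
  have hr0 : 0 ≤ √(bodyComp (A 0) h 0 ^ 2 + bodyComp (A 0) h 2 ^ 2) := Real.sqrt_nonneg _
  have hne : √(bodyComp (A 0) h 0 ^ 2 + bodyComp (A 0) h 2 ^ 2) ≠ 0 := fun hz => by
    rw [hz, zero_mul] at h1; exact h0.ne' h1
  have hs := h2.resolve_left hne
  rw [h1] at h0
  have hc := (pos_iff_pos_of_mul_pos h0).1 (lt_of_le_of_ne hr0 hne.symm)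
  have hc1 : Real.cos (turning v w (fun t => bodyComp (A t) h) 1) = 1 := by
    have := Real.sin_sq_add_cos_sq (turning v w (fun t => bodyComp (A t) h) 1)
    rw [hs] at this
    nlinarith
  obtain ⟨n, hn⟩ := (Real.cos_eq_one_iff _).1 hc1
  exact ⟨n, by rw [← hn]; ring⟩

variable {κ₁ κ₂ : EReal}

/-- The band of the curve lies in the open half space `h > 0`, and the tangent turns `k` times
around the direction `h`. -/
structure Winds (γ : AdmissibleCurve κ₁ κ₂) (k : ℕ) (h : Fin 3 → ℝ) : Prop where
  sum_sq : ∑ i, h i ^ 2 = 1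
  pos₁ : ∀ t ∈ Icc (0 : ℝ) 1, 0 < bandHeight (γ.frameMatrix t) h (arccot κ₁)
  pos₂ : ∀ t ∈ Icc (0 : ℝ) 1, 0 < bandHeight (γ.frameMatrix t) h (arccot κ₂)
  turning_eq : turning γ.speed (fun x => γ.speed x * γ.curvature x)
    (fun t => bodyComp (γ.frameMatrix t) h) 1 = 2 * Real.pi * k

theorem ClosedCurves.closed (γ : ClosedCurves κ₁ κ₂) :
    γ.1.frameMatrix 0 = γ.1.frameMatrix 1 := by
  have h0 : γ.1.frameMatrix 0 = γ.1.frame 0 := γ.1.frameMatrix_coe 0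
  have h1 : γ.1.frameMatrix 1 = γ.1.frame 1 := γ.1.frameMatrix_coe 1
  rw [h0, h1, γ.2]

theorem Winds.exists_int (hκ : κ₁ < κ₂) (γ : ClosedCurves κ₁ κ₂) {h : Fin 3 → ℝ}
    (hh : ∑ i, h i ^ 2 = 1)
    (h₁ : ∀ t ∈ Icc (0 : ℝ) 1, 0 < bandHeight (γ.1.frameMatrix t) h (arccot κ₁)) :
    ∃ n : ℤ, turning γ.1.speed (fun x => γ.1.speed x * γ.1.curvature x)
      (fun t => bodyComp (γ.1.frameMatrix t) h) 1 = 2 * Real.pi * n :=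
  (γ.1.isFrame hκ).exists_int_turning γ.closed hh fun t ht =>
    normal_part_pos_of_bandHeight_pos (h₁ t ht)

theorem eq_of_int_of_abs_sub_lt {x : ℝ} {k : ℕ} (hx : ∃ n : ℤ, x = 2 * Real.pi * n)
    (h : dist x (2 * Real.pi * k) < 1) : x = 2 * Real.pi * k := by
  obtain ⟨n, rfl⟩ := hx
  rw [Real.dist_eq, ← mul_sub, abs_mul, abs_of_pos Real.two_pi_pos] at h
  have h1 : |(n : ℝ) - k| < 1 := by nlinarith [Real.pi_gt_three, abs_nonneg ((n : ℝ) - k)]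
  have h2 : |n - (k : ℤ)| < 1 := by exact_mod_cast h1
  have h3 : n = k := by rw [Int.abs_lt_one_iff] at h2; omega
  rw [h3]; push_cast; ring

/-- The number of turns does not depend on the half space. -/
theorem Winds.unique (hκ : κ₁ < κ₂) (γ : ClosedCurves κ₁ κ₂) {k k' : ℕ} {h h' : Fin 3 → ℝ}
    (H : Winds γ.1 k h) (H' : Winds γ.1 k' h') : k = k' := by
  set η : ℝ → Fin 3 → ℝ := fun s => (1 - s) • h + s • h' with hη
  have hpos : ∀ θ, (∀ t ∈ Icc (0 : ℝ) 1, 0 < bandHeight (γ.1.frameMatrix t) h θ) →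
      (∀ t ∈ Icc (0 : ℝ) 1, 0 < bandHeight (γ.1.frameMatrix t) h' θ) → ∀ s ∈ Icc (0 : ℝ) 1,
      ∀ t ∈ Icc (0 : ℝ) 1, 0 < bandHeight (γ.1.frameMatrix t) (η s) θ := by
    intro θ h1 h2 s hs t ht
    rw [hη]; simp only
    rw [bandHeight_add_smul]
    rcases hs.1.eq_or_lt with rfl | hs0
    · simpa using h1 t ht
    · exact add_pos_of_nonneg_of_pos (mul_nonneg (by linarith [hs.2]) (h1 t ht).le)
        (mul_pos hs0 (h2 t ht))
  have p1 := hpos _ H.pos₁ H'.pos₁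
  have hsq : ∀ s ∈ Icc (0 : ℝ) 1, 0 < ∑ i, η s i ^ 2 := fun s hs =>
    sum_sq_pos_of_bandHeight_pos (p1 s hs 0 (by simp))
  set f : ℝ → ℝ := fun s => turning γ.1.speed (fun x => γ.1.speed x * γ.1.curvature x)
      (fun t => bodyComp (γ.1.frameMatrix t) (unitVec (η s))) 1 with hf
  have hcont : ContinuousOn f (Icc 0 1) := fun s hs => by
    have hc : Continuous η := by
      rw [hη]; fun_prop
    refine (AdmissibleCurve.tendstoFrame hκ (Γ := fun _ : ℝ => γ.1)
      (l := 𝓝[Icc 0 1] s) tendsto_const_nhds).tendsto_turning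
      (tendsto_unitVec (hc.continuousWithinAt (s := Icc 0 1) (x := s)) (hsq s hs)) fun t ht =>
      normal_part_pos_of_bandHeight_pos (bandHeight_unitVec_pos (p1 s hs t ht))
  have hint : ∀ s ∈ Icc (0 : ℝ) 1, ∃ n : ℤ, f s = 2 * Real.pi * n := fun s hs =>
    Winds.exists_int hκ γ (sum_sq_unitVec (hsq s hs)) fun t ht => bandHeight_unitVec_pos (p1 s hs t ht)
  have e := eq_of_continuousOn_of_int hcont hint (t := 1) (by simp)
  have e0 : unitVec (η 0) = h := by
    rw [hη]; simpa using unitVec_of_sum_sq_eq_one H.sum_sq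
  have e1 : unitVec (η 1) = h' := by
    rw [hη]; simpa using unitVec_of_sum_sq_eq_one H'.sum_sq
  simp only [hf, e0, e1, H.turning_eq, H'.turning_eq] at e
  have := mul_left_cancel₀ Real.two_pi_pos.ne' e
  exact_mod_cast this.symm

instance : FirstCountableTopology (AdmissibleCurve κ₁ κ₂) :=
  have : FirstCountableTopology (Matrix (Fin 3) (Fin 3) ℝ) :=
    inferInstanceAs (FirstCountableTopology (Fin 3 → Fin 3 → ℝ))
  have : FirstCountableTopology SO3 :=
    (IsInducing.subtypeVal
      (t := (Matrix.specialOrthogonalGroup (Fin 3) ℝ : Set (Matrix (Fin 3) (Fin 3) ℝ)))).firstCountableTopology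
  (Topology.IsInducing.mk rfl : IsInducing fun γ : AdmissibleCurve κ₁ κ₂ =>
    (γ.frame 0, γ.vHat, γ.wHat)).firstCountableTopology

/-- By uniform convergence of the frames and continuity of the turning, which is integer-valued. -/
theorem isOpen_winds (hκ : κ₁ < κ₂) (k : ℕ) :
    IsOpen {γ : ClosedCurves κ₁ κ₂ | ∃ h, Winds γ.1 k h} := by
  rw [isOpen_iff_eventually]
  rintro γ ⟨h, H⟩
  have : FirstCountableTopology (ClosedCurves κ₁ κ₂) := IsInducing.subtypeVal.firstCountableTopology
  have : (𝓝 γ).IsCountablyGenerated := FirstCountableTopology.nhds_generated_countable γ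
  have hT := AdmissibleCurve.tendstoFrame hκ (Γ := fun γ : ClosedCurves κ₁ κ₂ => γ.1)
    (continuous_subtype_val.tendsto γ)
  have ht := hT.tendsto_turning (η := fun _ => h) tendsto_const_nhds fun t ht =>
    normal_part_pos_of_bandHeight_pos (H.pos₁ t ht)
  have hcont : ∀ θ, ContinuousOn (fun t => bandHeight (γ.1.frameMatrix t) h θ) (Icc 0 1) := fun θ =>
    ((γ.1.isFrame hκ).bandHeight h θ).continuousOn
  rw [H.turning_eq] at ht
  filter_upwards [(hT.tendstoUniformlyOn_bandHeight h (arccot κ₁)).eventually_pos (hcont _) H.pos₁,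
    (hT.tendstoUniformlyOn_bandHeight h (arccot κ₂)).eventually_pos (hcont _) H.pos₂,
    Metric.tendsto_nhds.1 ht 1 one_pos] with γ' h1 h2 h3
  exact ⟨h, H.sum_sq, h1, h2,
    eq_of_int_of_abs_sub_lt (Winds.exists_int hκ γ' H.sum_sq h1) h3⟩

/-- The half spaces of a convergent sequence have a limit that contains the band of the limit curve
in its closure, and which is tilted into an open half space around that band. -/
theorem isClosed_winds (hκ : κ₁ < κ₂) {k : ℕ} (hk : 1 ≤ k)
    (hkδ : (k + 1) * (arccot κ₁ - arccot κ₂) ≤ Real.pi) :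
    IsClosed {γ : ClosedCurves κ₁ κ₂ | ∃ h, Winds γ.1 k h} := by
  refine IsSeqClosed.isClosed fun Γ γ hΓ hlim => ?_
  choose η hη using hΓ
  have hbdd : ∀ n, η n ∈ Metric.closedBall (0 : Fin 3 → ℝ) 1 := fun n => by
    rw [mem_closedBall_zero_iff, pi_norm_le_iff_of_nonneg zero_le_one]
    intro i
    rw [Real.norm_eq_abs, ← sq_le_one_iff_abs_le_one, ← (hη n).sum_sq]
    exact Finset.single_le_sum (f := fun i => η n i ^ 2) (fun i _ => sq_nonneg _) (Finset.mem_univ i)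
  obtain ⟨h, -, φ, hφ, hφh⟩ := (isCompact_closedBall (0 : Fin 3 → ℝ) 1).tendsto_subseq hbdd
  have hT := AdmissibleCurve.tendstoFrame hκ (Γ := fun n => (Γ (φ n)).1) (l := atTop)
    (((continuous_subtype_val.tendsto γ).comp hlim).comp hφ.tendsto_atTop)
  have hh : ∑ i, h i ^ 2 = 1 := by
    have h1 : Tendsto (fun n => ∑ i, η (φ n) i ^ 2) atTop (𝓝 (∑ i, h i ^ 2)) :=
      tendsto_finsetSum _ fun i _ => ((tendsto_pi_nhds.1 hφh) i).pow 2
    simp only [(hη _).sum_sq] at h1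
    exact (tendsto_nhds_unique h1 tendsto_const_nhds)
  have hlimh : ∀ θ, ∀ t ∈ Icc (0 : ℝ) 1, Tendsto (fun n =>
      bandHeight ((Γ (φ n)).1.frameMatrix t) (η (φ n)) θ) atTop
      (𝓝 (bandHeight (γ.1.frameMatrix t) h θ)) := fun θ t ht => by
    simp only [bandHeight_eq]
    have := fun j => (hT.tendstoUniformlyOn_bodyComp hφh j).tendsto_at ht
    exact ((this 0).const_mul _).add ((this 2).const_mul _)
  have n₁ : ∀ t ∈ Icc (0 : ℝ) 1, 0 ≤ bandHeight (γ.1.frameMatrix t) h (arccot κ₁) := fun t ht =>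
    ge_of_tendsto' (hlimh _ t ht) fun n => ((hη (φ n)).pos₁ t ht).le
  have n₂ : ∀ t ∈ Icc (0 : ℝ) 1, 0 ≤ bandHeight (γ.1.frameMatrix t) h (arccot κ₂) := fun t ht =>
    ge_of_tendsto' (hlimh _ t ht) fun n => ((hη (φ n)).pos₂ t ht).le
  have hF := γ.1.isFrame hκ
  have hN : ∀ t ∈ Icc (0 : ℝ) 1,
      0 < bodyComp (γ.1.frameMatrix t) h 0 ^ 2 + bodyComp (γ.1.frameMatrix t) h 2 ^ 2 := fun t ht =>
    hF.normal_part_pos (γ.1.inBand hκ) γ.closed (by rw [hh]; norm_num) n₁ n₂ ht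
  -- the tangent of the limit curve still makes `k` turns, and never points along `h`
  have hW : turning γ.1.speed (fun x => γ.1.speed x * γ.1.curvature x)
      (fun t => bodyComp (γ.1.frameMatrix t) h) 1 = 2 * Real.pi * k := by
    have h1 := hT.tendsto_turning hφh hN
    simp only [Function.comp_apply, (hη _).turning_eq] at h1
    exact tendsto_nhds_unique h1 tendsto_const_nhds
  have hρ := arccot_strictAnti hκ
  have em : arccot κ₁ = (arccot κ₁ + arccot κ₂) / 2 + (arccot κ₁ - arccot κ₂) / 2 := by ring
  have em' : arccot κ₂ = (arccot κ₁ + arccot κ₂) / 2 - (arccot κ₁ - arccot κ₂) / 2 := by ring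
  obtain ⟨h', hh'⟩ : ∃ h' : Fin 3 → ℝ, ∀ t ∈ Icc (0 : ℝ) 1,
      0 < bandHeight (γ.1.frameMatrix t) h' (arccot κ₁) ∧
      0 < bandHeight (γ.1.frameMatrix t) h' (arccot κ₂) := by
    have hB : InBand γ.1.speed (fun x => γ.1.speed x * γ.1.curvature x)
        ((arccot κ₁ + arccot κ₂) / 2 + (arccot κ₁ - arccot κ₂) / 2)
        ((arccot κ₁ + arccot κ₂) / 2 - (arccot κ₁ - arccot κ₂) / 2) := by
      rw [← em, ← em']; exact γ.1.inBand hκ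
    have := exists_open_halfSpace hF hB γ.closed (by linarith) hk (by linarith) hh
      (by rw [← em]; exact n₁) (by rw [← em']; exact n₂) hW
    rwa [← em, ← em'] at this
  -- push `h` slightly in the direction of `h'`
  have hηε : Tendsto (fun ε : ℝ => (1 : ℝ) • h + ε • h') (𝓝[>] 0) (𝓝 h) := by
    have hc : Continuous (fun ε : ℝ => (1 : ℝ) • h + ε • h') := by fun_prop
    have := hc.tendsto 0
    simp only [one_smul, zero_smul, add_zero] at this
    simpa only [one_smul] using this.mono_left nhdsWithin_le_nhds
  have hηu := tendsto_unitVec hηε (by rw [hh]; norm_num)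
  rw [unitVec_of_sum_sq_eq_one hh] at hηu
  have hturn := (AdmissibleCurve.tendstoFrame hκ (Γ := fun _ : ℝ => γ.1) (l := 𝓝[>] 0)
      tendsto_const_nhds).tendsto_turning hηu hN
  rw [hW] at hturn
  obtain ⟨ε, hε, hε0⟩ := ((Metric.tendsto_nhds.1 hturn 1 one_pos).and
    (self_mem_nhdsWithin (a := (0 : ℝ)) (s := Ioi 0))).exists
  have hε0 : (0 : ℝ) < ε := hε0
  have q : ∀ θ, (∀ t ∈ Icc (0 : ℝ) 1, 0 ≤ bandHeight (γ.1.frameMatrix t) h θ) →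
      (∀ t ∈ Icc (0 : ℝ) 1, 0 < bandHeight (γ.1.frameMatrix t) h' θ) →
      ∀ t ∈ Icc (0 : ℝ) 1, 0 < bandHeight (γ.1.frameMatrix t) ((1 : ℝ) • h + ε • h') θ := by
    intro θ h1 h2 t ht
    rw [bandHeight_add_smul]
    have := mul_pos hε0 (h2 t ht)
    linarith [h1 t ht]
  have q1 := q _ n₁ fun t ht => (hh' t ht).1
  have q2 := q _ n₂ fun t ht => (hh' t ht).2
  have hsq := sum_sq_unitVec (sum_sq_pos_of_bandHeight_pos (q1 0 (by simp)))
  exact ⟨unitVec ((1 : ℝ) • h + ε • h'), hsq, fun t ht => bandHeight_unitVec_pos (q1 t ht),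
    fun t ht => bandHeight_unitVec_pos (q2 t ht), eq_of_int_of_abs_sub_lt
      (Winds.exists_int hκ γ hsq fun t ht => bandHeight_unitVec_pos (q1 t ht)) hε⟩

/-- Curves with different numbers of turns lie in different components. -/
theorem connectedComponent_ne_of_winds (hκ : κ₁ < κ₂) {k k' : ℕ} (hk : 1 ≤ k) (hkk : k ≠ k')
    (hkδ : (k + 1) * (arccot κ₁ - arccot κ₂) ≤ Real.pi) {X : Type*} [TopologicalSpace X]
    {f : X → ClosedCurves κ₁ κ₂} (hf : Continuous f) {σ τ : X} {h h' : Fin 3 → ℝ}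
    (hσ : Winds (f σ).1 k h) (hτ : Winds (f τ).1 k' h') :
    connectedComponent σ ≠ connectedComponent τ := by
  intro he
  have hclop : IsClopen (f ⁻¹' {γ : ClosedCurves κ₁ κ₂ | ∃ h, Winds γ.1 k h}) :=
    IsClopen.preimage ⟨isClosed_winds hκ hk hkδ, isOpen_winds hκ k⟩ hf
  have hm : τ ∈ connectedComponent σ := by rw [he]; exact mem_connectedComponent
  obtain ⟨h'', H⟩ := hclop.connectedComponent_subset (x := σ) ⟨h, hσ⟩ hm
  exact hkk (Winds.unique hκ (f τ) H hτ)

end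

section

/-! ### Parametrized circles -/

theorem HasACDeriv.deriv_zero_of_const {f f' : ℝ → ℝ} (hf : HasACDeriv f f') {c : ℝ}
    (h : ∀ t ∈ Icc (0 : ℝ) 1, f t = c) : ∀ᵐ t, t ∈ Ioo (0 : ℝ) 1 → f' t = 0 := by
  filter_upwards [hf.2] with t ht ht'
  refine (ht ht').unique ((hasDerivAt_const t c).congr_of_eventuallyEq ?_)
  filter_upwards [Ioo_mem_nhds ht'.1 ht'.2] with x hx using h x (Ioo_subset_Icc_self hx)

theorem eq_zero_of_ae_of_continuousOn {f : ℝ → ℝ} (hf : ContinuousOn f (Icc 0 1))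
    (h : ∀ᵐ t, t ∈ Ioo (0 : ℝ) 1 → f t = 0) : ∀ t ∈ Icc (0 : ℝ) 1, f t = 0 := by
  refine Measure.eqOn_Icc_of_ae_eq (μ := volume) (g := fun _ => 0) zero_ne_one ?_ hf
    continuousOn_const
  rw [EventuallyEq, ← restrict_Ioo_eq_restrict_Icc, ae_restrict_iff' measurableSet_Ioo]
  exact h

/-- A frame whose first column runs along a parallel of latitude: the tangent is horizontal, the
geodesic curvature is constant, and the longitude advances at the rate `v / sin ρ`. -/
theorem IsFrame.of_parallel {B : ℝ → Matrix (Fin 3) (Fin 3) ℝ} {v κ : ℝ → ℝ}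
    (hB : IsFrame B v (fun t => v t * κ t)) (hv : ∀ t, 0 < v t) {ρ : ℝ} (hρ : 0 < Real.sin ρ)
    {φ : ℝ → ℝ} (hφ : ContinuousOn φ (Icc 0 1)) (hφm : StrictMonoOn φ (Icc 0 1)) (hφ0 : φ 0 = 0)
    (h0 : ∀ t ∈ Icc (0 : ℝ) 1, B t 0 0 = Real.sin ρ * Real.cos (φ t))
    (h1 : ∀ t ∈ Icc (0 : ℝ) 1, B t 1 0 = Real.sin ρ * Real.sin (φ t))
    (h2 : ∀ t ∈ Icc (0 : ℝ) 1, B t 2 0 = Real.cos ρ) :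
    (∀ᵐ t, t ∈ Ioo (0 : ℝ) 1 → κ t = Real.cos ρ / Real.sin ρ) ∧
    ∫ t in (0 : ℝ)..1, v t = φ 1 * Real.sin ρ ∧
    ∀ t ∈ Icc (0 : ℝ) 1, B t 2 1 = 0 ∧ B t 2 2 = Real.sin ρ := by
  have hT : ∀ t ∈ Icc (0 : ℝ) 1, B t 2 1 = 0 := by
    refine eq_zero_of_ae_of_continuousOn (hB.deriv_tan 2).continuousOn ?_
    filter_upwards [(hB.deriv_pos 2).deriv_zero_of_const h2] with t ht ht'
    exact (mul_eq_zero.1 (ht ht')).resolve_left (hv t).ne'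
  have hN : ∀ t ∈ Icc (0 : ℝ) 1, B t 2 2 = B 0 2 2 := fun t ht => by
    refine (hB.deriv_nor 2).eq_of_deriv_zero (Eventually.of_forall fun x hx => ?_) ht
    rw [hT x (Ioo_subset_Icc_self hx), mul_zero]
  obtain ⟨ε, hε⟩ : ∃ ε, B 0 2 2 = ε * Real.sin ρ := ⟨B 0 2 2 / Real.sin ρ, by field_simp⟩
  have hsc := Real.sin_sq_add_cos_sq ρ
  have hε2 : ε ^ 2 = 1 := by
    have := (so3_entries (hB.mem 0)).1 2 2
    simp only [Fin.sum_univ_three, if_true] at this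
    rw [h2 0 (by simp), hT 0 (by simp), hε] at this
    have h3 : (ε ^ 2 - 1) * Real.sin ρ ^ 2 = 0 := by nlinarith
    have := (mul_eq_zero.1 h3).resolve_right (pow_ne_zero 2 hρ.ne')
    linarith
  have hvi : IntervalIntegrable v volume 0 1 := by
    -- `v² = |γ'|²`; integrability is read off from the derivatives of the columns
    have e : ∀ t, v t = ∑ i, B t i 1 * (v t * B t i 1) := fun t => by
      have := (so3_entries (hB.mem t)).2.1 1 1
      simp only [Fin.sum_univ_three, if_true] at this ⊢
      linear_combination -v t * this
    rw [funext e]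
    have hs : ∀ i, IntervalIntegrable (fun t => B t i 1 * (v t * B t i 1)) volume 0 1 := fun i =>
      ((hB.deriv_pos i).intervalIntegrable (by simp) (by simp)).continuousOn_mul
        (by rw [uIcc_of_le zero_le_one]; exact (hB.deriv_tan i).continuousOn)
    simp only [Fin.sum_univ_three]
    exact ((hs 0).add (hs 1)).add (hs 2)
  have hκ : ∀ᵐ t, t ∈ Ioo (0 : ℝ) 1 → κ t * ε * Real.sin ρ = Real.cos ρ := by
    filter_upwards [(hB.deriv_tan 2).deriv_zero_of_const hT] with t ht ht'
    have h3 := ht ht'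
    rw [h2 t (Ioo_subset_Icc_self ht'), hN t (Ioo_subset_Icc_self ht'), hε] at h3
    have h4 : v t * (κ t * ε * Real.sin ρ - Real.cos ρ) = 0 := by linear_combination h3
    linarith [(mul_eq_zero.1 h4).resolve_left (hv t).ne']
  set ψ : ℝ → ℝ := fun t => ∫ s in (0 : ℝ)..t, ε * v s / Real.sin ρ with hψ
  have hψi : IntervalIntegrable (fun s => ε * v s / Real.sin ρ) volume 0 1 :=
    (hvi.const_mul ε).div_const _
  have hψd : HasACDeriv ψ (fun s => ε * v s / Real.sin ρ) :=
    HasACDeriv.of_integral hψi fun t _ => by simp [hψ]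
  have hψ0 : ψ 0 = 0 := by simp [hψ]
  have htan : ∀ t ∈ Icc (0 : ℝ) 1, Real.sin ρ * B t 0 1 = -(ε * B t 1 0) ∧
      Real.sin ρ * B t 1 1 = ε * B t 0 0 := by
    intro t ht
    obtain ⟨-, hc, hd, -⟩ := so3_entries (hB.mem t)
    have c01 := hc 0 1
    have c00 := hc 0 0
    simp [Fin.sum_univ_three] at c01 c00
    rw [hT t ht, h2 t ht] at *
    rw [hN t ht, hε] at hd
    have c00' : B t 0 0 * B t 0 0 + B t 1 0 * B t 1 0 = Real.sin ρ ^ 2 := by linarith [h2 t ht]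
    constructor
    · refine mul_left_cancel₀ hρ.ne' ?_
      linear_combination -B t 0 1 * c00' + B t 0 0 * c01 - B t 1 0 * hd
    · refine mul_left_cancel₀ hρ.ne' ?_
      linear_combination -B t 1 1 * c00' + B t 1 0 * c01 + B t 0 0 * hd
  have hD : ∀ t ∈ Icc (0 : ℝ) 1, B t 0 0 * Real.cos (ψ t) + B t 1 0 * Real.sin (ψ t) =
      Real.sin ρ := by
    have hd := ((hB.deriv_pos 0).mul hψd.cos).add ((hB.deriv_pos 1).mul hψd.sin)
    intro t ht
    have := hd.eq_of_deriv_zero (Eventually.of_forall fun x hx => ?_) ht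
    · rw [this, hψ0, h0 0 (by simp), hφ0]; simp
    · obtain ⟨t1, t2⟩ := htan x (Ioo_subset_Icc_self hx)
      have e1 : B x 0 1 = -(ε * B x 1 0) / Real.sin ρ := by rw [← t1]; field_simp
      have e2 : B x 1 1 = ε * B x 0 0 / Real.sin ρ := by rw [← t2]; field_simp
      simp only [e1, e2]; ring
  have hφψ : ∀ t ∈ Icc (0 : ℝ) 1, φ t = ψ t := by
    have hint : ∀ t ∈ Icc (0 : ℝ) 1, ∃ n : ℤ, φ t - ψ t = 2 * Real.pi * n := fun t ht => by
      have h3 := hD t ht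
      rw [h0 t ht, h1 t ht] at h3
      have h4 : Real.cos (φ t - ψ t) = 1 := by
        rw [Real.cos_sub]
        refine mul_left_cancel₀ hρ.ne' ?_
        linear_combination h3
      obtain ⟨n, hn⟩ := (Real.cos_eq_one_iff _).1 h4
      exact ⟨n, by rw [← hn]; ring⟩
    intro t ht
    have := eq_of_continuousOn_of_int (f := fun t => φ t - ψ t) (hφ.sub hψd.continuousOn) hint ht
    rw [hφ0, hψ0] at this
    linarith
  have e1 := hφψ 1 (by simp)
  have hψ1 : ψ 1 = ε * (∫ s in (0 : ℝ)..1, v s) / Real.sin ρ := by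
    simp only [hψ]
    rw [intervalIntegral.integral_div, intervalIntegral.integral_const_mul]
  have hφ1 : 0 < φ 1 := by
    rw [← hφ0]; exact hφm (by simp) (by simp) one_pos
  have hI : 0 ≤ ∫ s in (0 : ℝ)..1, v s :=
    intervalIntegral.integral_nonneg zero_le_one fun s _ => (hv s).le
  have hε1 : ε = 1 := by
    rcases sq_eq_one_iff.1 hε2 with h | h
    · exact h
    · exfalso
      rw [e1, hψ1, h] at hφ1
      have : -1 * (∫ s in (0 : ℝ)..1, v s) / Real.sin ρ ≤ 0 :=
        div_nonpos_of_nonpos_of_nonneg (by linarith) hρ.le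
      linarith
  subst hε1
  refine ⟨?_, ?_, fun t ht => ⟨hT t ht, ?_⟩⟩
  · filter_upwards [hκ] with t ht ht'
    rw [← ht ht']; field_simp
  · rw [e1, hψ1]; field_simp
  · rw [hN t ht, hε, one_mul]

variable {κ₁ κ₂ : EReal}

/-- A circle traversed `k` times has constant geodesic curvature `cot ρ`, with `ρ` strictly between
the bounds, and length `2 π k sin ρ`; its frame is constant as seen from the axis of the
circle. -/
theorem exists_circle_data (hκ : κ₁ < κ₂) (γ : AdmissibleCurve κ₁ κ₂) {k : ℕ}
    (h : IsCircleTraversed k γ.curve) : ∃ ρ, arccot κ₂ < ρ ∧ ρ < arccot κ₁ ∧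
      (∀ᵐ x, x ∈ Ioo (0 : ℝ) 1 → γ.curvature x = Real.cos ρ / Real.sin ρ) ∧
      ∫ x in (0 : ℝ)..1, γ.speed x = 2 * Real.pi * k * Real.sin ρ ∧
      ∃ η : Fin 3 → ℝ, ∑ i, η i ^ 2 = 1 ∧ ∀ t ∈ Icc (0 : ℝ) 1,
        bodyComp (γ.frameMatrix t) η 0 = Real.cos ρ ∧ bodyComp (γ.frameMatrix t) η 1 = 0 ∧
        bodyComp (γ.frameMatrix t) η 2 = Real.sin ρ := by
  obtain ⟨P, ρ, φ, hρ0, hρ1, hφ, hφm, hφ0, hφ1, hc⟩ := h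
  have hs := Real.sin_pos_of_pos_of_lt_pi hρ0 hρ1
  obtain ⟨hP1, hP2⟩ := mem_so3_iff.1 P.2
  have hP3 : (P : Matrix (Fin 3) (Fin 3) ℝ).transpose * P = 1 := mul_eq_one_comm.1 hP1
  have hPt : (P : Matrix (Fin 3) (Fin 3) ℝ).transpose ∈ Matrix.specialOrthogonalGroup (Fin 3) ℝ :=
    mem_so3_iff.2 ⟨by rw [Matrix.transpose_transpose]; exact hP3, by rw [Matrix.det_transpose, hP2]⟩
  have hB := (γ.isFrame hκ).mul_left hPt
  have hcol : ∀ t ∈ Icc (0 : ℝ) 1, ∀ i, ((P : Matrix (Fin 3) (Fin 3) ℝ).transpose *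
      γ.frameMatrix t) i 0 = ![Real.sin ρ * Real.cos (φ (projIcc 0 1 zero_le_one t)),
        Real.sin ρ * Real.sin (φ (projIcc 0 1 zero_le_one t)), Real.cos ρ] i := by
    intro t ht i
    have h1 := hc (projIcc 0 1 zero_le_one t)
    have h2 : (fun i => γ.frameMatrix t i 0) = Matrix.mulVec (P : Matrix (Fin 3) (Fin 3) ℝ)
        ![Real.sin ρ * Real.cos (φ (projIcc 0 1 zero_le_one t)),
        Real.sin ρ * Real.sin (φ (projIcc 0 1 zero_le_one t)), Real.cos ρ] := h1
    have h3 : ((P : Matrix (Fin 3) (Fin 3) ℝ).transpose * γ.frameMatrix t) i 0 =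
        Matrix.mulVec (P : Matrix (Fin 3) (Fin 3) ℝ).transpose (fun i => γ.frameMatrix t i 0) i := by
      rw [Matrix.mul_apply]; rfl
    rw [h3, h2, Matrix.mulVec_mulVec, hP3, Matrix.one_mulVec]
  have hrow : ∀ t j, bodyComp (γ.frameMatrix t) (fun i => (P : Matrix (Fin 3) (Fin 3) ℝ) i 2) j =
      ((P : Matrix (Fin 3) (Fin 3) ℝ).transpose * γ.frameMatrix t) 2 j := fun t j => by
    rw [Matrix.mul_apply]; rfl
  have hp0 : projIcc (0 : ℝ) 1 zero_le_one 0 = 0 := projIcc_left _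
  have hp1 : projIcc (0 : ℝ) 1 zero_le_one 1 = 1 := projIcc_right _
  obtain ⟨hκρ, hI, hN⟩ := hB.of_parallel γ.speed_pos hs
    (φ := fun t => φ (projIcc 0 1 zero_le_one t)) (hφ.comp continuous_projIcc).continuousOn
    (fun s hs' t ht hst => hφm (strictMonoOn_projIcc _ hs' ht hst)) (by rw [hp0, hφ0])
    (fun t ht => by rw [hcol t ht]; rfl) (fun t ht => by rw [hcol t ht]; rfl)
    (fun t ht => by rw [hcol t ht]; rfl)
  rw [hp1, hφ1] at hI
  -- the curvature is attained, so `ρ` lies between the bounds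
  have hmem : Real.cos ρ / Real.sin ρ ∈ curvInterval κ₁ κ₂ := by
    have hne : (volume (Ioo (0 : ℝ) 1)) ≠ 0 := by simp
    obtain ⟨x, hx, hx'⟩ : ∃ x ∈ Ioo (0 : ℝ) 1, γ.curvature x = Real.cos ρ / Real.sin ρ := by
      by_contra! hcon
      refine hne (measure_mono_null (fun x hx => ?_) (ae_iff.1 hκρ))
      exact fun h => hcon x hx (h hx)
    rw [← hx']
    exact hCurvInv_mem hκ _
  rw [mem_curvInterval_iff, arccot_cot hρ0 hρ1] at hmem
  refine ⟨ρ, hmem.1, hmem.2, hκρ, hI,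
    fun i => (P : Matrix (Fin 3) (Fin 3) ℝ) i 2, ?_, fun t ht => ⟨?_, ?_, ?_⟩⟩
  · have := (so3_entries P.2).2.1 2 2
    simp only [if_true] at this
    rw [← this]; exact Finset.sum_congr rfl fun i _ => pow_two _
  · rw [hrow, hcol t ht]; rfl
  · rw [hrow]; exact (hN t ht).1
  · rw [hrow]; exact (hN t ht).2

/-- A circle winds around its axis: its band is a rotated arc, of height `cos (ρ - θ)` at the
angle `θ`. -/
theorem exists_winds_of_circle (hκ : κ₁ < κ₂) (hρ : arccot κ₁ - arccot κ₂ ≤ Real.pi / 2)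
    (γ : AdmissibleCurve κ₁ κ₂) {k : ℕ} (h : IsCircleTraversed k γ.curve) : ∃ η, Winds γ k η := by
  obtain ⟨ρ, hρ2, hρ1, hκρ, hI, η, hη, hN⟩ := exists_circle_data hκ γ h
  have hs := Real.sin_pos_of_pos_of_lt_pi ((arccot_nonneg κ₂).trans_lt hρ2)
    (hρ1.trans_le (arccot_le_pi κ₁))
  have hb : ∀ θ, ∀ t ∈ Icc (0 : ℝ) 1, bandHeight (γ.frameMatrix t) η θ = Real.cos (ρ - θ) :=
    fun θ t ht => by
      rw [bandHeight_eq, (hN t ht).1, (hN t ht).2.2, Real.cos_sub]; ring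
  refine ⟨η, hη, fun t ht => ?_, fun t ht => ?_, ?_⟩
  · rw [hb _ t ht]; exact Real.cos_pos_of_mem_Ioo ⟨by linarith, by linarith⟩
  · rw [hb _ t ht]; exact Real.cos_pos_of_mem_Ioo ⟨by linarith, by linarith⟩
  · have e : turning γ.speed (fun x => γ.speed x * γ.curvature x)
        (fun t => bodyComp (γ.frameMatrix t) η) 1 = ∫ x in (0 : ℝ)..1, γ.speed x / Real.sin ρ := by
      refine intervalIntegral.integral_congr_ae ?_
      have h1 : ∀ᵐ t : ℝ, t ≠ 1 := by simp [ae_iff]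
      filter_upwards [hκρ, h1] with t ht ht1 ht'
      rw [uIoc_of_le zero_le_one] at ht'
      have ht2 : t ∈ Ioo (0 : ℝ) 1 := ⟨ht'.1, lt_of_le_of_ne ht'.2 ht1⟩
      rw [(hN t (Ioo_subset_Icc_self ht2)).1, (hN t (Ioo_subset_Icc_self ht2)).2.2, ht ht2,
        Real.cos_sq_add_sin_sq, div_one]
      have := Real.sin_sq_add_cos_sq ρ
      field_simp
      linear_combination γ.speed t * this
    rw [e, intervalIntegral.integral_div, hI]
    field_simp

/-- If `(k + 1) (ρ₁ - ρ₂) ≤ π`, then circles traversed `k` and `k + 2` times are in different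
components of any space mapped continuously to the space of closed curves. -/
theorem connectedComponent_ne_of_circle (hκ : κ₁ < κ₂) {k : ℕ} (hk : 1 ≤ k)
    (hkδ : (k + 1) * (arccot κ₁ - arccot κ₂) ≤ Real.pi) {X : Type*} [TopologicalSpace X]
    {f : X → ClosedCurves κ₁ κ₂} (hf : Continuous f) {σ τ : X}
    (hσ : IsCircleTraversed k (f σ).1.curve) (hτ : IsCircleTraversed (k + 2) (f τ).1.curve) :
    connectedComponent σ ≠ connectedComponent τ := by
  have hk' : (1 : ℝ) ≤ k := by exact_mod_cast hk
  have hlt := arccot_strictAnti hκ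
  have hρ : arccot κ₁ - arccot κ₂ ≤ Real.pi / 2 := by nlinarith
  obtain ⟨_, h1⟩ := exists_winds_of_circle hκ hρ _ hσ
  obtain ⟨_, h2⟩ := exists_winds_of_circle hκ hρ _ hτ
  exact connectedComponent_ne_of_winds hκ hk (by omega) hkδ hf h1 h2

end

/-! ### Frames of piecewise circular curves -/

/-- The rotation by the angle `α` about the axis `(cos r, 0, sin r)`. A frame moving along a circle
of radius `r` is multiplied by these matrices on the right. -/
def rot (r α : ℝ) : Matrix (Fin 3) (Fin 3) ℝ :=
  !![1 - (1 - Real.cos α) * Real.sin r ^ 2, -(Real.sin α * Real.sin r),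
      (1 - Real.cos α) * (Real.sin r * Real.cos r);
    Real.sin α * Real.sin r, Real.cos α, -(Real.sin α * Real.cos r);
    (1 - Real.cos α) * (Real.sin r * Real.cos r), Real.sin α * Real.cos r,
      1 - (1 - Real.cos α) * Real.cos r ^ 2]

theorem rot_zero (r : ℝ) : rot r 0 = 1 := by
  ext i j; fin_cases i <;> fin_cases j <;> simp [rot]

theorem rot_add (r α β : ℝ) : rot r (α + β) = rot r α * rot r β := by
  have h := Real.sin_sq_add_cos_sq r
  have hc : Real.cos r ^ 2 = 1 - Real.sin r ^ 2 := by linarith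
  ext i j; fin_cases i <;> fin_cases j <;>
    simp [rot, Matrix.mul_apply, Fin.sum_univ_three, Real.cos_add, Real.sin_add] <;>
    ring_nf <;> simp only [hc, show Real.cos r ^ 3 = Real.cos r * Real.cos r ^ 2 by ring,
      show Real.cos r ^ 4 = Real.cos r ^ 2 * Real.cos r ^ 2 by ring] <;> ring

theorem rot_two_pi_mul (r : ℝ) (n : ℕ) : rot r (2 * Real.pi * n) = 1 := by
  have hc : Real.cos (2 * Real.pi * n) = 1 := by rw [mul_comm]; exact Real.cos_nat_mul_two_pi n
  have hs : Real.sin (2 * Real.pi * n) = 0 := by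
    have := Real.sin_nat_mul_pi (2 * n)
    rwa [show ((2 * n : ℕ) : ℝ) * Real.pi = 2 * Real.pi * n by push_cast; ring] at this
  ext i j; fin_cases i <;> fin_cases j <;> simp [rot, hc, hs]

theorem rot_add_pi (r α : ℝ) : rot (r + Real.pi) α = rot r (-α) := by
  ext i j; fin_cases i <;> fin_cases j <;> simp [rot]

theorem rot_mul_neg (r α : ℝ) : rot r α * rot r (-α) = 1 := by
  rw [← rot_add, add_neg_cancel, rot_zero]

theorem transpose_rot (r α : ℝ) : (rot r α).transpose = rot r (-α) := by
  ext i j; fin_cases i <;> fin_cases j <;> simp [rot]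

theorem rot_mem (r α : ℝ) : rot r α ∈ Matrix.specialOrthogonalGroup (Fin 3) ℝ := by
  refine mem_so3_iff.2 ⟨by rw [transpose_rot, rot_mul_neg], ?_⟩
  have h := Real.sin_sq_add_cos_sq r
  have h' := Real.sin_sq_add_cos_sq α
  simp only [rot, Matrix.det_fin_three, Matrix.of_apply, Matrix.cons_val', Matrix.cons_val_zero,
    Matrix.cons_val_one, Matrix.cons_val]
  linear_combination (-Real.cos α + 1) * h + (Real.sin r ^ 2 + Real.cos r ^ 2) * h'

/-- A half turn conjugates rotations by reflecting the position of the axis. -/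
theorem half_turn_conj (r θ ω : ℝ) :
    rot r Real.pi * rot θ ω * rot r Real.pi = rot (2 * r - θ) ω := by
  have h := Real.sin_sq_add_cos_sq r
  have hc : Real.cos r ^ 2 = 1 - Real.sin r ^ 2 := by linarith
  have ht := Real.sin_sq_add_cos_sq θ
  have htc : Real.cos θ ^ 2 = 1 - Real.sin θ ^ 2 := by linarith
  ext i j; fin_cases i <;> fin_cases j <;>
    simp [rot, Matrix.mul_apply, Fin.sum_univ_three, Real.sin_sub, Real.cos_sub, Real.sin_two_mul,
      Real.cos_two_mul'] <;>
    ring_nf <;> simp only [hc, htc, show Real.cos r ^ 3 = Real.cos r * Real.cos r ^ 2 by ring,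
      show Real.cos r ^ 4 = Real.cos r ^ 2 * Real.cos r ^ 2 by ring] <;> ring

theorem continuous_rot (r : ℝ) (i j : Fin 3) : Continuous fun α => rot r α i j := by
  fin_cases i <;> fin_cases j <;> simp [rot] <;> fun_prop

theorem hasDerivAt_rot (r α : ℝ) (i j : Fin 3) : HasDerivAt (fun α => rot r α i j)
    ((rot r α * logDeriv (Real.sin r) (Real.cos r)) i j) α := by
  have hs := Real.hasDerivAt_sin α
  have hc := Real.hasDerivAt_cos α
  have h := Real.sin_sq_add_cos_sq r
  have hc2 : Real.cos r ^ 2 = 1 - Real.sin r ^ 2 := by linarith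
  fin_cases i <;> fin_cases j <;>
    simp [rot, Matrix.mul_apply, Fin.sum_univ_three, logDeriv]
  · exact (((hc.const_sub 1).mul_const _).const_sub 1).congr_deriv (by ring)
  · refine (hs.mul_const _).neg.congr_deriv ?_
    linear_combination -(1 - Real.cos α) * Real.sin r * h
  · exact ((hc.const_sub 1).mul_const _).congr_deriv (by ring)
  · exact (hs.mul_const _).congr_deriv (by ring)
  · refine hc.congr_deriv ?_
    linear_combination Real.sin α * h
  · exact (hs.mul_const _).neg.congr_deriv (by ring)
  · exact ((hc.const_sub 1).mul_const _).congr_deriv (by ring)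
  · refine (hs.mul_const _).congr_deriv ?_
    linear_combination (1 - Real.cos α) * Real.cos r * h
  · exact (((hc.const_sub 1).mul_const _).const_sub 1).congr_deriv (by ring)

/-- The step function taking successively the values `p.1` on intervals of length `p.2`, for `p` in
the list, and then the value `d`. -/
def stepVal (d : ℝ) : List (ℝ × ℝ) → ℝ → ℝ
  | [], _ => d
  | p :: L, τ => if τ ≤ p.2 then p.1 else stepVal d L (τ - p.2)

/-- The frame of a curve composed of circular arcs: the list contains the radii and the angles,
`τ` is the total angle travelled, and the last circle, of radius `d`, is never left. -/
def stepFrame (d : ℝ) : List (ℝ × ℝ) → ℝ → Matrix (Fin 3) (Fin 3) ℝ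
  | [], τ => rot d τ
  | p :: L, τ => if τ ≤ p.2 then rot p.1 τ else rot p.1 p.2 * stepFrame d L (τ - p.2)

/-- The sum of the angles of the arcs in a list. -/
def totalAngle (L : List (ℝ × ℝ)) : ℝ := (L.map Prod.snd).sum

/-- The rotation that takes the initial to the final frame of a piecewise circular curve. -/
def stepProd (L : List (ℝ × ℝ)) : Matrix (Fin 3) (Fin 3) ℝ := (L.map fun p => rot p.1 p.2).prod

/-- The point `τ` is not one of the break points of the step function. -/
def IsGeneric : List (ℝ × ℝ) → ℝ → Prop
  | [], _ => True
  | p :: L, τ => τ ≠ p.2 ∧ IsGeneric L (τ - p.2)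

theorem countable_not_isGeneric (L : List (ℝ × ℝ)) : {τ | ¬ IsGeneric L τ}.Countable := by
  induction L with
  | nil => simp [IsGeneric]
  | cons p L ih =>
    refine ((countable_singleton p.2).union (ih.preimage_of_injOn (f := fun τ => τ - p.2)
      (fun x _ y _ h => by simpa using h))).mono fun τ hτ => ?_
    by_cases h : τ = p.2
    · exact Or.inl h
    · exact Or.inr fun hg => hτ ⟨h, hg⟩

theorem measurable_stepVal (d : ℝ) (L : List (ℝ × ℝ)) : Measurable (stepVal d L) := by
  induction L with
  | nil => exact measurable_const
  | cons p L ih =>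
    exact Measurable.ite measurableSet_Iic measurable_const (ih.comp (measurable_id.sub_const _))

theorem stepVal_mem {d : ℝ} {S : Set ℝ} (hd : d ∈ S) {L : List (ℝ × ℝ)} (hL : ∀ p ∈ L, p.1 ∈ S)
    (τ : ℝ) : stepVal d L τ ∈ S := by
  induction L generalizing τ with
  | nil => exact hd
  | cons p L ih =>
    rw [stepVal]
    split_ifs
    · exact hL p (by simp)
    · exact ih (fun q hq => hL q (by simp [hq])) _

theorem stepFrame_mem (d : ℝ) (L : List (ℝ × ℝ)) (τ : ℝ) :
    stepFrame d L τ ∈ Matrix.specialOrthogonalGroup (Fin 3) ℝ := by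
  induction L generalizing τ with
  | nil => exact rot_mem d τ
  | cons p L ih =>
    rw [stepFrame]
    split_ifs
    · exact rot_mem _ _
    · exact mul_mem (rot_mem _ _) (ih _)

theorem stepFrame_zero (d : ℝ) {L : List (ℝ × ℝ)} (hL : ∀ p ∈ L, 0 ≤ p.2) :
    stepFrame d L 0 = 1 := by
  cases L with
  | nil => exact rot_zero d
  | cons p L => rw [stepFrame, if_pos (hL p (by simp)), rot_zero]

theorem stepFrame_of_le {d : ℝ} {p : ℝ × ℝ} {L : List (ℝ × ℝ)} (hL : ∀ q ∈ L, 0 ≤ q.2) {τ : ℝ}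
    (h : p.2 ≤ τ) : stepFrame d (p :: L) τ = rot p.1 p.2 * stepFrame d L (τ - p.2) := by
  rcases h.eq_or_lt with rfl | h
  · rw [stepFrame, if_pos le_rfl, sub_self, stepFrame_zero d hL, mul_one]
  · rw [stepFrame, if_neg (not_le.2 h)]

theorem totalAngle_nonneg {L : List (ℝ × ℝ)} (hL : ∀ p ∈ L, 0 ≤ p.2) : 0 ≤ totalAngle L :=
  List.sum_nonneg fun x hx => by
    obtain ⟨p, hp, rfl⟩ := List.mem_map.1 hx
    exact hL p hp

theorem stepFrame_totalAngle (d : ℝ) {L : List (ℝ × ℝ)} (hL : ∀ p ∈ L, 0 ≤ p.2) :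
    stepFrame d L (totalAngle L) = stepProd L := by
  induction L with
  | nil => simp [stepFrame, totalAngle, stepProd, rot_zero]
  | cons p L ih =>
    have hL' : ∀ q ∈ L, 0 ≤ q.2 := fun q hq => hL q (by simp [hq])
    have e : totalAngle (p :: L) = p.2 + totalAngle L := by simp [totalAngle]
    rw [stepFrame_of_le hL' (by rw [e]; linarith [totalAngle_nonneg hL']), e, add_sub_cancel_left,
      ih hL']
    simp [stepProd]

theorem continuous_stepFrame (d : ℝ) {L : List (ℝ × ℝ)} (hL : ∀ p ∈ L, 0 ≤ p.2) (i j : Fin 3) :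
    Continuous fun τ => stepFrame d L τ i j := by
  induction L generalizing i j with
  | nil => exact continuous_rot d i j
  | cons p L ih =>
    have hL' : ∀ q ∈ L, 0 ≤ q.2 := fun q hq => hL q (by simp [hq])
    have e : (fun τ => stepFrame d (p :: L) τ i j) = fun τ => if τ ≤ p.2 then rot p.1 τ i j else
        (rot p.1 p.2 * stepFrame d L (τ - p.2)) i j := by
      ext τ; rw [stepFrame]; split_ifs <;> rfl
    rw [e]
    refine Continuous.if_le (continuous_rot _ _ _) ?_ continuous_id continuous_const ?_
    · simp only [Matrix.mul_apply]
      exact continuous_finsetSum _ fun l _ => continuous_const.mul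
        ((ih hL' l j).comp (continuous_id.sub continuous_const))
    · rintro τ rfl
      rw [sub_self, stepFrame_zero d hL', mul_one]

theorem hasDerivAt_stepFrame (d : ℝ) (L : List (ℝ × ℝ)) {τ : ℝ} (hτ : IsGeneric L τ)
    (i j : Fin 3) : HasDerivAt (fun τ => stepFrame d L τ i j) ((stepFrame d L τ *
      logDeriv (Real.sin (stepVal d L τ)) (Real.cos (stepVal d L τ))) i j) τ := by
  induction L generalizing τ i j with
  | nil => exact hasDerivAt_rot d τ i j
  | cons p L ih =>
    rcases lt_or_gt_of_ne hτ.1 with h | h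
    · rw [stepFrame, stepVal, if_pos h.le, if_pos h.le]
      refine (hasDerivAt_rot p.1 τ i j).congr_of_eventuallyEq ?_
      filter_upwards [Iio_mem_nhds h] with x hx
      rw [stepFrame, if_pos (le_of_lt hx)]
    · rw [stepFrame, stepVal, if_neg (not_le.2 h), if_neg (not_le.2 h), Matrix.mul_assoc,
        Matrix.mul_apply]
      refine HasDerivAt.congr_of_eventuallyEq (f := fun x => ∑ l, rot p.1 p.2 i l *
        stepFrame d L (x - p.2) l j) (HasDerivAt.fun_sum fun l _ => HasDerivAt.const_mul _ ?_) ?_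
      · exact (ih hτ.2 l j).comp_sub_const τ p.2
      · filter_upwards [Ioi_mem_nhds h] with x hx
        rw [stepFrame, if_neg (not_le.2 hx), Matrix.mul_apply]

theorem HasACDeriv.of_hasDerivAt_off_countable {f f' : ℝ → ℝ} {s : Set ℝ} (hs : s.Countable)
    (hf : Continuous f) (hd : ∀ t, t ∉ s → HasDerivAt f (f' t) t)
    (hi : IntervalIntegrable f' volume 0 1) : HasACDeriv f f' := by
  refine HasACDeriv.of_integral hi fun t ht => ?_
  rw [integral_eq_of_hasDerivAt_off_countable_of_le f f' ht.1 hs hf.continuousOn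
    (fun x hx => hd x hx.2) (hi.mono_set ?_)]
  · ring
  · rw [uIcc_of_le ht.1, uIcc_of_le zero_le_one]; exact Icc_subset_Icc_right ht.2

theorem intervalIntegrable_of_bounded {f : ℝ → ℝ} (hf : Measurable f) {C : ℝ}
    (hC : ∀ t, |f t| ≤ C) : IntervalIntegrable f volume 0 1 :=
  (intervalIntegrable_const (c := C)).mono_fun' hf.aestronglyMeasurable
    (Eventually.of_forall hC)

/-- A piecewise circular curve, run through with constant angular speed, has the expected frame. -/
theorem isFrame_stepFrame (d : ℝ) {L : List (ℝ × ℝ)} (hL : ∀ p ∈ L, 0 ≤ p.2) {Ω : ℝ} (hΩ : Ω ≠ 0) :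
    IsFrame (fun t => stepFrame d L (Ω * t)) (fun t => Ω * Real.sin (stepVal d L (Ω * t)))
      (fun t => Ω * Real.cos (stepVal d L (Ω * t))) := by
  have hs : {t : ℝ | ¬ IsGeneric L (Ω * t)}.Countable :=
    (countable_not_isGeneric L).preimage_of_injOn (f := fun t => Ω * t)
      (fun x _ y _ h => mul_left_cancel₀ hΩ h)
  have hm : Measurable fun t => stepVal d L (Ω * t) :=
    (measurable_stepVal d L).comp (measurable_const_mul Ω)
  have hc : ∀ i j, Continuous fun t => stepFrame d L (Ω * t) i j := fun i j =>
    (continuous_stepFrame d hL i j).comp (continuous_const_mul Ω)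
  have hv : IntervalIntegrable (fun t => Ω * Real.sin (stepVal d L (Ω * t))) volume 0 1 :=
    (intervalIntegrable_of_bounded (Real.measurable_sin.comp hm)
      fun t => Real.abs_sin_le_one _).const_mul Ω
  have hw : IntervalIntegrable (fun t => Ω * Real.cos (stepVal d L (Ω * t))) volume 0 1 :=
    (intervalIntegrable_of_bounded (Real.measurable_cos.comp hm)
      fun t => Real.abs_cos_le_one _).const_mul Ω
  have hint : ∀ {f : ℝ → ℝ} (i j), IntervalIntegrable f volume 0 1 →
      IntervalIntegrable (fun t => f t * stepFrame d L (Ω * t) i j) volume 0 1 := fun i j hf =>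
    hf.mul_continuousOn (hc i j).continuousOn
  have hd : ∀ i j (f' : ℝ → ℝ), (∀ t, Ω * (stepFrame d L (Ω * t) *
      logDeriv (Real.sin (stepVal d L (Ω * t))) (Real.cos (stepVal d L (Ω * t)))) i j = f' t) →
      IntervalIntegrable f' volume 0 1 → HasACDeriv (fun t => stepFrame d L (Ω * t) i j) f' := by
    intro i j f' h hi
    refine HasACDeriv.of_hasDerivAt_off_countable hs (hc i j) (fun t ht => ?_) hi
    rw [← h t, mul_comm Ω]
    have h1 := hasDerivAt_stepFrame d L (not_not.1 ht) i j
    exact h1.comp t (by simpa using (hasDerivAt_id t).const_mul Ω)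
  refine ⟨fun t => stepFrame_mem d L _, fun i => ?_, fun i => ?_, fun i => ?_⟩
  · refine hd i 0 _ (fun t => ?_) (hint i 1 hv)
    simp [Matrix.mul_apply, Fin.sum_univ_three, logDeriv]; ring
  · refine hd i 1 _ (fun t => ?_) ((hint i 0 hv.neg).add (hint i 2 hw))
    simp [Matrix.mul_apply, Fin.sum_univ_three, logDeriv]; ring
  · refine hd i 2 _ (fun t => ?_) (hint i 1 hw.neg)
    simp [Matrix.mul_apply, Fin.sum_univ_three, logDeriv]; ring

section

/-! ### Construction of admissible curves, and paths between them -/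

/-- A curve given by its frame, its speed and its geodesic curvature, such that `h ∘ v` and
`h_{κ₁, κ₂} ∘ κ` are square integrable. -/
structure FrameData (κ₁ κ₂ : EReal) where
  /-- the frame -/
  frame : ℝ → Matrix (Fin 3) (Fin 3) ℝ
  /-- the speed -/
  speed : ℝ → ℝ
  /-- the geodesic curvature -/
  curv : ℝ → ℝ
  isFrame : IsFrame frame speed fun t => speed t * curv t
  speed_pos : ∀ t, 0 < speed t
  curv_mem : ∀ t, curv t ∈ curvInterval κ₁ κ₂
  memLp_speed : MemLp (fun s : unitInterval => hSpeed (speed s)) 2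
  memLp_curv : MemLp (fun s : unitInterval => hCurv κ₁ κ₂ (curv s)) 2

theorem IsFrame.continuousOn_entry {A : ℝ → Matrix (Fin 3) (Fin 3) ℝ} {v w : ℝ → ℝ}
    (hA : IsFrame A v w) (i j : Fin 3) : ContinuousOn (fun t => A t i j) (Icc 0 1) := by
  fin_cases j
  · exact (hA.deriv_pos i).continuousOn
  · exact (hA.deriv_tan i).continuousOn
  · exact (hA.deriv_nor i).continuousOn

theorem IsFrame.hasACDeriv_entry {A : ℝ → Matrix (Fin 3) (Fin 3) ℝ} {v w : ℝ → ℝ}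
    (hA : IsFrame A v w) (i j : Fin 3) : HasACDeriv (fun t => A t i j)
      (fun t => (A t * logDeriv (v t) (w t)) i j) := by
  fin_cases j
  · refine (hA.deriv_pos i).congr_deriv (Eventually.of_forall fun t _ => ?_)
    simp [Matrix.mul_apply, Fin.sum_univ_three, logDeriv]; ring
  · refine (hA.deriv_tan i).congr_deriv (Eventually.of_forall fun t _ => ?_)
    simp [Matrix.mul_apply, Fin.sum_univ_three, logDeriv]; ring
  · refine (hA.deriv_nor i).congr_deriv (Eventually.of_forall fun t _ => ?_)
    simp [Matrix.mul_apply, Fin.sum_univ_three, logDeriv]; ring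

variable {κ₁ κ₂ : EReal}

/-- The admissible curve with the given frame. -/
def FrameData.toCurve (hκ : κ₁ < κ₂) (D : FrameData κ₁ κ₂) : AdmissibleCurve κ₁ κ₂ where
  vHat := D.memLp_speed.toLp
  wHat := D.memLp_curv.toLp
  frame := ⟨fun t => ⟨D.frame t, D.isFrame.mem t⟩, by
    refine Continuous.subtype_mk (continuous_matrix fun i j => ?_) _
    exact (D.isFrame.continuousOn_entry i j).comp_continuous continuous_subtype_val fun t => t.2⟩
  frame_eq t i j := by
    have h1 : ∀ᵐ s : unitInterval, (D.frame s * logDeriv (hSpeedInv (D.memLp_speed.toLp _ s))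
        (hSpeedInv (D.memLp_speed.toLp _ s) * hCurvInv κ₁ κ₂ (D.memLp_curv.toLp _ s))) i j =
        (D.frame s * logDeriv (D.speed s) (D.speed s * D.curv s)) i j := by
      filter_upwards [D.memLp_speed.coeFn_toLp, D.memLp_curv.coeFn_toLp] with s hs hs'
      rw [hs, hs', hSpeedInv_hSpeed (D.speed_pos s), hCurvInv_hCurv hκ (D.curv_mem s)]
    have h2 := setIntegral_unitInterval_Iic
      (fun x => (D.frame x * logDeriv (D.speed x) (D.speed x * D.curv x)) i j) t
    have h3 := (D.isFrame.hasACDeriv_entry i j).integral_eq (a := 0) (by simp) t.2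
    change D.frame t i j = D.frame ((0 : unitInterval) : ℝ) i j + ∫ s in Set.Iic t,
      (D.frame s * logDeriv (hSpeedInv (D.memLp_speed.toLp _ s))
        (hSpeedInv (D.memLp_speed.toLp _ s) * hCurvInv κ₁ κ₂ (D.memLp_curv.toLp _ s))) i j
    rw [integral_congr_ae (ae_restrict_of_ae h1), h2, h3]
    simp

/-- An admissible curve is determined by its initial frame and its data. -/
theorem AdmissibleCurve.ext_data (hκ : κ₁ < κ₂) {γ γ' : AdmissibleCurve κ₁ κ₂}
    (h0 : γ.frame 0 = γ'.frame 0) (hv : γ.vHat = γ'.vHat) (hw : γ.wHat = γ'.wHat) : γ = γ' := by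
  have ev : γ.speed = γ'.speed := by ext x; rw [speed, speed, hv]
  have ek : γ.curvature = γ'.curvature := by ext x; rw [curvature, curvature, hw]
  have hA := γ.isFrame hκ
  have hB := γ'.isFrame hκ
  rw [ev, ek] at hA
  have e0 : γ.frameMatrix 0 = γ'.frameMatrix 0 := by
    have h1 : γ.frameMatrix 0 = γ.frame 0 := γ.frameMatrix_coe 0
    have h2 : γ'.frameMatrix 0 = γ'.frame 0 := γ'.frameMatrix_coe 0
    rw [h1, h2, h0]
  have ef : γ.frame = γ'.frame := by
    ext t i j
    have := hA.abs_sub_le hB (by simp) (by simp) t.2 i j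
    rw [e0] at this
    simp only [sub_self, abs_zero, intervalIntegral.integral_zero, Finset.sum_const_zero, add_zero,
      mul_zero] at this
    have := abs_nonpos_iff.1 this
    rw [frameMatrix_coe, frameMatrix_coe] at this
    linarith
  cases γ; cases γ'
  simp only at hv hw ef
  subst hv hw ef
  rfl

/-- Dominated convergence in `L²`. -/
theorem tendsto_toLp_of_dominated {ι : Type*} {l : Filter ι} [l.IsCountablyGenerated]
    {F : ι → unitInterval → ℝ} {f g : unitInterval → ℝ} (hF : ∀ n, MemLp (F n) 2)
    (hf : MemLp f 2) (hg : MemLp g 2) (hb : ∀ n, ∀ᵐ s, |F n s| ≤ g s) (hfg : ∀ᵐ s, |f s| ≤ g s)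
    (hlim : ∀ᵐ s, Tendsto (fun n => F n s) l (𝓝 (f s))) :
    Tendsto (fun n => (hF n).toLp) l (𝓝 hf.toLp) := by
  rw [Lp.tendsto_Lp_iff_tendsto_eLpNorm'']
  have hsub : ∀ n, MemLp (F n - f) 2 := fun n => (hF n).sub hf
  have h1 : Tendsto (fun n => ∫ s, ‖(F n - f) s‖ ^ (2 : ℝ)) l (𝓝 0) := by
    have := tendsto_integral_filter_of_dominated_convergence (l := l) (μ := volume)
      (F := fun n (s : unitInterval) => ‖(F n - f) s‖ ^ (2 : ℝ)) (f := fun _ => (0 : ℝ))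
      (fun s => 4 * g s ^ 2) ?_ ?_ (hg.integrable_sq.const_mul 4) ?_
    · simpa using this
    · exact Eventually.of_forall fun n => ((hsub n).1.norm.aemeasurable.pow_const _).aestronglyMeasurable
    · refine Eventually.of_forall fun n => ?_
      filter_upwards [hb n, hfg] with s h1 h2
      have h3 : |F n s - f s| ≤ 2 * g s := (abs_sub _ _).trans (by linarith)
      rw [Real.rpow_two, Real.norm_eq_abs, Real.norm_eq_abs, abs_of_nonneg (by positivity)]
      have h4 := abs_nonneg (F n s - f s)
      simp only [Pi.sub_apply]
      nlinarith
    · filter_upwards [hlim] with s hs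
      have h2 : Tendsto (fun n => ‖(F n - f) s‖ ^ (2 : ℝ)) l (𝓝 (‖f s - f s‖ ^ (2 : ℝ))) :=
        (((hs.sub_const (f s)).norm).rpow_const (Or.inr two_pos.le))
      simpa using h2
  have h2 : ∀ n, eLpNorm (F n - f) 2 volume =
      ENNReal.ofReal ((∫ s, ‖(F n - f) s‖ ^ (2 : ℝ)) ^ (2 : ℝ)⁻¹) := fun n => by
    have := (hsub n).eLpNorm_eq_integral_rpow_norm two_ne_zero ENNReal.ofNat_ne_top
    simpa using this
  simp only [h2]
  have h3 := ENNReal.tendsto_ofReal (h1.rpow_const (p := (2 : ℝ)⁻¹) (Or.inr (by norm_num)))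
  simpa using h3

theorem isOpen_curvInterval (κ₁ κ₂ : EReal) : IsOpen (curvInterval κ₁ κ₂) :=
  (isOpen_lt continuous_const continuous_coe_real_ereal).inter
    (isOpen_lt continuous_coe_real_ereal continuous_const)

theorem hSpeed_continuousAt {x : ℝ} (hx : 0 < x) : ContinuousAt hSpeed x :=
  continuousAt_id.sub (continuousAt_inv₀ hx.ne')

/-- Dominated convergence of speed and curvature implies convergence of curves. -/
theorem FrameData.tendsto_toCurve (hκ : κ₁ < κ₂) {ι : Type*} {l : Filter ι}
    [l.IsCountablyGenerated] {D : ι → FrameData κ₁ κ₂} {D₀ : FrameData κ₁ κ₂}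
    (h0 : ∀ i j, Tendsto (fun n => (D n).frame 0 i j) l (𝓝 (D₀.frame 0 i j)))
    {g g' : unitInterval → ℝ} (hg : MemLp g 2) (hg' : MemLp g' 2)
    (hb : ∀ n, ∀ᵐ s : unitInterval, |hSpeed ((D n).speed s)| ≤ g s)
    (hb₀ : ∀ᵐ s : unitInterval, |hSpeed (D₀.speed s)| ≤ g s)
    (hb' : ∀ n, ∀ᵐ s : unitInterval, |hCurv κ₁ κ₂ ((D n).curv s)| ≤ g' s)
    (hb₀' : ∀ᵐ s : unitInterval, |hCurv κ₁ κ₂ (D₀.curv s)| ≤ g' s)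
    (hv : ∀ᵐ s : unitInterval, Tendsto (fun n => (D n).speed s) l (𝓝 (D₀.speed s)))
    (hc : ∀ᵐ s : unitInterval, Tendsto (fun n => (D n).curv s) l (𝓝 (D₀.curv s))) :
    Tendsto (fun n => (D n).toCurve hκ) l (𝓝 (D₀.toCurve hκ)) := by
  rw [(Topology.IsInducing.mk rfl : IsInducing fun γ : AdmissibleCurve κ₁ κ₂ =>
    (γ.frame 0, γ.vHat, γ.wHat)).tendsto_nhds_iff]
  refine Tendsto.prodMk_nhds ?_ (Tendsto.prodMk_nhds ?_ ?_)
  · rw [tendsto_subtype_rng]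
    refine tendsto_pi_nhds.2 fun i => tendsto_pi_nhds.2 fun j => ?_
    have := h0 i j
    simpa [FrameData.toCurve] using this
  · refine tendsto_toLp_of_dominated (fun n => (D n).memLp_speed) D₀.memLp_speed hg hb hb₀ ?_
    filter_upwards [hv] with s hs
    exact (hSpeed_continuousAt (D₀.speed_pos s)).tendsto.comp hs
  · refine tendsto_toLp_of_dominated (fun n => (D n).memLp_curv) D₀.memLp_curv hg' hb' hb₀' ?_
    filter_upwards [hc] with s hs
    exact ((continuousOn_hCurv κ₁ κ₂).continuousAt
      ((isOpen_curvInterval κ₁ κ₂).mem_nhds (D₀.curv_mem s))).tendsto.comp hs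

/-- The loop, with initial frame the identity, defined by frame data that close up. -/
def FrameData.toLoop (hκ : κ₁ < κ₂) (D : FrameData κ₁ κ₂) (h0 : D.frame 0 = 1)
    (h1 : D.frame 1 = 1) : CurvesTo κ₁ κ₂ 1 :=
  ⟨D.toCurve hκ, Subtype.ext (by simpa [FrameData.toCurve] using h0),
    Subtype.ext (by simpa [FrameData.toCurve] using h1)⟩

theorem connectedComponent_eq_of_path {X : Type*} [TopologicalSpace X] {f : unitInterval → X}
    (hf : Continuous f) (s t : unitInterval) :
    connectedComponent (f s) = connectedComponent (f t) :=
  (connectedComponent_eq ((isPreconnected_range hf).subset_connectedComponent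
    (mem_range_self s) (mem_range_self t)))

end

section

/-! ### Curves of constant geodesic curvature -/

variable {κ₁ κ₂ : EReal}

/-- The curve has the geodesic curvature `cot ρ` and the length of a circle of radius `ρ` traversed
`k` times. -/
def IsCircular (γ : AdmissibleCurve κ₁ κ₂) (ρ : ℝ) (k : ℕ) : Prop :=
  (∀ᵐ x, x ∈ Ioo (0 : ℝ) 1 → γ.curvature x = Real.cos ρ / Real.sin ρ) ∧
    ∫ x in (0 : ℝ)..1, γ.speed x = 2 * Real.pi * k * Real.sin ρ

theorem hSpeed_speed (γ : AdmissibleCurve κ₁ κ₂) (s : unitInterval) :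
    hSpeed (γ.speed s) = γ.vHat s := by rw [γ.speed_coe, hSpeed_hSpeedInv]

theorem hCurv_curvature (hκ : κ₁ < κ₂) (γ : AdmissibleCurve κ₁ κ₂) (s : unitInterval) :
    hCurv κ₁ κ₂ (γ.curvature s) = γ.wHat s := by
  rw [γ.curvature_coe]; exact Function.invFunOn_eq (hCurv_surj hκ _)

theorem FrameData.toCurve_eq (hκ : κ₁ < κ₂) (D : FrameData κ₁ κ₂) (γ : AdmissibleCurve κ₁ κ₂)
    (h0 : D.frame 0 = γ.frame 0) (hv : ∀ᵐ s : unitInterval, D.speed s = γ.speed s)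
    (hc : ∀ᵐ s : unitInterval, D.curv s = γ.curvature s) : D.toCurve hκ = γ := by
  refine AdmissibleCurve.ext_data hκ (Subtype.ext (by simpa [FrameData.toCurve] using h0)) ?_ ?_
  · refine Lp.ext ?_
    filter_upwards [D.memLp_speed.coeFn_toLp, hv] with s h1 h2
    rw [← hSpeed_speed γ s, ← h2]; exact h1
  · refine Lp.ext ?_
    filter_upwards [D.memLp_curv.coeFn_toLp, hc] with s h1 h2
    rw [← hCurv_curvature hκ γ s, ← h2]; exact h1

theorem FrameData.toCurve_speed (hκ : κ₁ < κ₂) (D : FrameData κ₁ κ₂) :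
    ∀ᵐ x, x ∈ Ioo (0 : ℝ) 1 → (D.toCurve hκ).speed x = D.speed x := by
  refine ae_unitInterval_iff.1 ?_
  filter_upwards [D.memLp_speed.coeFn_toLp] with s h1
  rw [AdmissibleCurve.speed_coe, ← hSpeedInv_hSpeed (D.speed_pos s)]
  exact congrArg hSpeedInv h1

theorem FrameData.toCurve_curvature (hκ : κ₁ < κ₂) (D : FrameData κ₁ κ₂) :
    ∀ᵐ x, x ∈ Ioo (0 : ℝ) 1 → (D.toCurve hκ).curvature x = D.curv x := by
  refine ae_unitInterval_iff.1 ?_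
  filter_upwards [D.memLp_curv.coeFn_toLp] with s h1
  rw [AdmissibleCurve.curvature_coe, ← hCurvInv_hCurv hκ (D.curv_mem s)]
  exact congrArg (hCurvInv κ₁ κ₂) h1

theorem intervalIntegral_congr_Ioo {f g : ℝ → ℝ} (h : ∀ᵐ x, x ∈ Ioo (0 : ℝ) 1 → f x = g x) :
    ∫ x in (0 : ℝ)..1, f x = ∫ x in (0 : ℝ)..1, g x := by
  refine intervalIntegral.integral_congr_ae ?_
  have h1 : ∀ᵐ t : ℝ, t ≠ 1 := by simp [ae_iff]
  filter_upwards [h, h1] with t ht ht1 ht'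
  rw [uIoc_of_le zero_le_one] at ht'
  exact ht ⟨ht'.1, lt_of_le_of_ne ht'.2 ht1⟩

theorem contDiff_rot (r : ℝ) (i j : Fin 3) : ContDiff ℝ 1 fun α => rot r α i j := by
  fin_cases i <;> fin_cases j <;> simp [rot] <;> fun_prop

theorem isFrame_rot {ρ : ℝ} (hρ : 0 < Real.sin ρ) {ψ v : ℝ → ℝ}
    (hψ : HasACDeriv ψ fun t => v t / Real.sin ρ) :
    IsFrame (fun t => rot ρ (ψ t)) v fun t => v t * (Real.cos ρ / Real.sin ρ) := by
  have h := fun i j => hψ.comp (contDiff_rot ρ i j) fun x => hasDerivAt_rot ρ x i j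
  refine ⟨fun t => rot_mem _ _, fun i => ?_, fun i => ?_, fun i => ?_⟩
  · refine (h i 0).congr_deriv (Eventually.of_forall fun t _ => ?_)
    simp [Matrix.mul_apply, Fin.sum_univ_three, logDeriv]; field_simp
  · refine (h i 1).congr_deriv (Eventually.of_forall fun t _ => ?_)
    simp [Matrix.mul_apply, Fin.sum_univ_three, logDeriv]; field_simp
  · refine (h i 2).congr_deriv (Eventually.of_forall fun t _ => ?_)
    simp [Matrix.mul_apply, Fin.sum_univ_three, logDeriv]; field_simp

theorem measurable_hSpeed : Measurable hSpeed := measurable_id.sub measurable_inv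

theorem abs_hSpeed_le {x : ℝ} (hx : 0 < x) : |hSpeed x| ≤ x + x⁻¹ := by
  have h := inv_pos.2 hx
  rw [hSpeed, abs_le]; constructor <;> linarith

theorem abs_hSpeed_convex_comb_le (γ₀ γ₁ : AdmissibleCurve κ₁ κ₂) {x : ℝ} (hx : x ∈ Icc (0 : ℝ) 1)
    (s : unitInterval) : |hSpeed ((1 - x) * γ₀.speed s + x * γ₁.speed s)| ≤
      2 * (|γ₀.vHat s| + 1) + 2 * (|γ₁.vHat s| + 1) := by
  rw [γ₀.speed_coe, γ₁.speed_coe]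
  have p0 := hSpeedInv_pos (γ₀.vHat s)
  have p1 := hSpeedInv_pos (γ₁.vHat s)
  have b0 := hSpeedInv_le (γ₀.vHat s)
  have b1 := hSpeedInv_le (γ₁.vHat s)
  have i0 := inv_hSpeedInv_le (γ₀.vHat s)
  have i1 := inv_hSpeedInv_le (γ₁.vHat s)
  generalize hSpeedInv (γ₀.vHat s) = a at *
  generalize hSpeedInv (γ₁.vHat s) = b at *
  have hmin : min a b ≤ (1 - x) * a + x * b := by
    have h1 := min_le_left a b
    have h2 := min_le_right a b
    nlinarith [hx.1, hx.2]
  have hpos : 0 < (1 - x) * a + x * b := (lt_min p0 p1).trans_le hmin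
  have hle : (1 - x) * a + x * b ≤ a + b := by nlinarith [hx.1, hx.2]
  have hinv : ((1 - x) * a + x * b)⁻¹ ≤ a⁻¹ + b⁻¹ := by
    refine (inv_anti₀ (lt_min p0 p1) hmin).trans ?_
    have q0 := inv_pos.2 p0
    have q1 := inv_pos.2 p1
    rcases min_choice a b with h | h <;> rw [h] <;> linarith
  linarith [abs_hSpeed_le hpos]

/-- Loops of the same constant geodesic curvature and the same length are in the same component:
their speeds can be interpolated. -/
theorem connectedComponent_eq_of_isCircular (hκ : κ₁ < κ₂) {ρ : ℝ} (hρ2 : arccot κ₂ < ρ)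
    (hρ1 : ρ < arccot κ₁) {k : ℕ} {σ τ : CurvesTo κ₁ κ₂ 1} (hσ : IsCircular σ.1 ρ k)
    (hτ : IsCircular τ.1 ρ k) : connectedComponent σ = connectedComponent τ := by
  have hs := Real.sin_pos_of_pos_of_lt_pi ((arccot_nonneg κ₂).trans_lt hρ2)
    (hρ1.trans_le (arccot_le_pi κ₁))
  have hg : MemLp (fun s => 2 * (|σ.1.vHat s| + 1) + 2 * (|τ.1.vHat s| + 1)) 2
      (volume : Measure unitInterval) := by
    have h : ∀ f : L2I, MemLp (fun s => 2 * (|f s| + 1)) 2 (volume : Measure unitInterval) :=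
      fun f => (((Lp.memLp f).norm).add (memLp_const (1 : ℝ))).const_mul 2
    exact (h _).add (h _)
  have hvi : ∀ x : ℝ, IntervalIntegrable (fun t => ((1 - x) * σ.1.speed t + x * τ.1.speed t) /
      Real.sin ρ) volume 0 1 := fun x =>
    ((σ.1.intervalIntegrable_speed.const_mul _).add
      (τ.1.intervalIntegrable_speed.const_mul _)).div_const _
  have hI : ∀ x : ℝ, ∫ t in (0 : ℝ)..1, ((1 - x) * σ.1.speed t + x * τ.1.speed t) / Real.sin ρ =
      2 * Real.pi * k := fun x => by
    rw [intervalIntegral.integral_div, intervalIntegral.integral_add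
      (σ.1.intervalIntegrable_speed.const_mul _) (τ.1.intervalIntegrable_speed.const_mul _),
      intervalIntegral.integral_const_mul, intervalIntegral.integral_const_mul, hσ.2, hτ.2]
    field_simp; ring
  let D : unitInterval → FrameData κ₁ κ₂ := fun x =>
    { frame := fun t => rot ρ (∫ s in (0 : ℝ)..t, ((1 - (x : ℝ)) * σ.1.speed s +
        x * τ.1.speed s) / Real.sin ρ)
      speed := fun t => (1 - (x : ℝ)) * σ.1.speed t + x * τ.1.speed t
      curv := fun _ => Real.cos ρ / Real.sin ρ
      isFrame := isFrame_rot hs (HasACDeriv.of_integral (hvi x) fun t _ => by simp)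
      speed_pos := fun t => by
        rcases x.2.1.eq_or_lt with h | h
        · rw [← h]; simpa using σ.1.speed_pos t
        · exact add_pos_of_nonneg_of_pos (mul_nonneg (by linarith [x.2.2]) (σ.1.speed_pos t).le)
            (mul_pos h (τ.1.speed_pos t))
      curv_mem := fun _ => cot_mem_curvInterval hρ2 hρ1
      memLp_speed := by
        refine hg.mono (measurable_hSpeed.comp_aemeasurable ?_).aestronglyMeasurable
          (Eventually.of_forall fun s => ?_)
        · exact ((σ.1.memLp_speed.1.aemeasurable.const_mul _).add
            (τ.1.memLp_speed.1.aemeasurable.const_mul _))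
        · rw [Real.norm_eq_abs]
          exact (abs_hSpeed_convex_comb_le σ.1 τ.1 x.2 s).trans (le_abs_self _)
      memLp_curv := memLp_const _ }
  have hD0 : ∀ x, (D x).frame 0 = 1 := fun x => by simp [D, rot_zero]
  have hD1 : ∀ x, (D x).frame 1 = 1 := fun x => by
    simp only [D]; rw [hI, rot_two_pi_mul]
  have hcont : Continuous fun x => (D x).toLoop hκ (hD0 x) (hD1 x) := by
    refine Continuous.subtype_mk (continuous_iff_continuousAt.2 fun x₀ => ?_) _
    refine FrameData.tendsto_toCurve hκ (fun i j => by simp only [hD0]; exact tendsto_const_nhds) hg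
      (memLp_const |hCurv κ₁ κ₂ (Real.cos ρ / Real.sin ρ)|)
      (fun x => Eventually.of_forall fun s => abs_hSpeed_convex_comb_le σ.1 τ.1 x.2 s)
      (Eventually.of_forall fun s => abs_hSpeed_convex_comb_le σ.1 τ.1 x₀.2 s)
      (fun x => Eventually.of_forall fun s => le_rfl) (Eventually.of_forall fun s => le_rfl)
      (Eventually.of_forall fun s => ?_) (Eventually.of_forall fun s => tendsto_const_nhds)
    have : Continuous fun x : unitInterval =>
      (1 - (x : ℝ)) * σ.1.speed s + x * τ.1.speed s := by fun_prop
    exact this.tendsto x₀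
  have he := connectedComponent_eq_of_path hcont 0 1
  have e0 : (D 0).toLoop hκ (hD0 0) (hD1 0) = σ := Subtype.ext (FrameData.toCurve_eq hκ _ _
    (by rw [hD0, σ.2.1]; rfl) (Eventually.of_forall fun s => by simp [D])
    (by
      filter_upwards [ae_unitInterval_iff.2 hσ.1] with s h
      exact h.symm))
  have e1 : (D 1).toLoop hκ (hD0 1) (hD1 1) = τ := Subtype.ext (FrameData.toCurve_eq hκ _ _
    (by rw [hD0, τ.2.1]; rfl) (Eventually.of_forall fun s => by simp [D])
    (by
      filter_upwards [ae_unitInterval_iff.2 hτ.1] with s h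
      exact h.symm))
  rwa [e0, e1] at he

/-! ### Continuity of piecewise circular curves in radii and angles -/

theorem measurable_hCurv (κ₁ κ₂ : EReal) : Measurable (hCurv κ₁ κ₂) := by
  unfold hCurv
  split_ifs <;> fun_prop

/-- A list of radii and angles depending on a parameter, evaluated at the parameter. -/
def evalArcs (F : List ((unitInterval → ℝ) × (unitInterval → ℝ))) (x : unitInterval) :
    List (ℝ × ℝ) := F.map fun p => (p.1 x, p.2 x)

theorem tendsto_stepVal {d : unitInterval → ℝ} (hd : Continuous d)
    {F : List ((unitInterval → ℝ) × (unitInterval → ℝ))}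
    (hF : ∀ p ∈ F, Continuous p.1 ∧ Continuous p.2) {τ : unitInterval → ℝ} (hτ : Continuous τ)
    {x : unitInterval} (hg : IsGeneric (evalArcs F x) (τ x)) :
    Tendsto (fun y => stepVal (d y) (evalArcs F y) (τ y)) (𝓝 x)
      (𝓝 (stepVal (d x) (evalArcs F x) (τ x))) := by
  induction F generalizing τ with
  | nil => exact hd.tendsto x
  | cons p F ih =>
    obtain ⟨h1, h2⟩ := hF p (by simp)
    have ih' := ih (fun q hq => hF q (by simp [hq])) (hτ.sub h2) hg.2
    rcases lt_or_gt_of_ne hg.1 with h | h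
    · have e : stepVal (d x) (evalArcs (p :: F) x) (τ x) = p.1 x := by
        simp only [evalArcs, List.map_cons, stepVal]; exact if_pos (le_of_lt h)
      rw [e]
      refine (h1.tendsto x).congr' ?_
      filter_upwards [(hτ.tendsto x).eventually_lt (h2.tendsto x) h] with y hy
      simp only [evalArcs, List.map_cons, stepVal]; exact (if_pos hy.le).symm
    · have e : stepVal (d x) (evalArcs (p :: F) x) (τ x) =
          stepVal (d x) (evalArcs F x) (τ x - p.2 x) := by
        simp only [evalArcs, List.map_cons, stepVal]; exact if_neg (not_le.2 h)
      rw [e]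
      refine ih'.congr' ?_
      filter_upwards [(h2.tendsto x).eventually_lt (hτ.tendsto x) h] with y hy
      simp only [evalArcs, List.map_cons, stepVal]; exact (if_neg (not_le.2 hy)).symm

section
variable {lo hi Ω₀ Ω₁ : ℝ}

theorem sin_pos_of_mem (hlo : arccot κ₂ < lo) (hhi : hi < arccot κ₁) {r : ℝ}
    (hr : r ∈ Icc lo hi) : 0 < Real.sin r :=
  Real.sin_pos_of_pos_of_lt_pi ((arccot_nonneg κ₂).trans_lt (hlo.trans_le hr.1))
    ((hr.2.trans_lt hhi).trans_le (arccot_le_pi κ₁))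

theorem exists_bound_hSpeed (hlo : arccot κ₂ < lo) (hhi : hi < arccot κ₁) (hΩ₀ : 0 < Ω₀) :
    ∃ C, ∀ Ω ∈ Icc Ω₀ Ω₁, ∀ r ∈ Icc lo hi, |hSpeed (Ω * Real.sin r)| ≤ C := by
  obtain ⟨C, hC⟩ := ((isCompact_Icc (a := Ω₀) (b := Ω₁)).prod
    (isCompact_Icc (a := lo) (b := hi))).exists_bound_of_continuousOn
    (f := fun p : ℝ × ℝ => hSpeed (p.1 * Real.sin p.2)) (by
      intro p hp
      refine ContinuousAt.continuousWithinAt ?_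
      refine ContinuousAt.comp (f := fun p : ℝ × ℝ => p.1 * Real.sin p.2)
        (hSpeed_continuousAt (mul_pos (hΩ₀.trans_le hp.1.1) (sin_pos_of_mem hlo hhi hp.2))) ?_
      fun_prop)
  exact ⟨C, fun Ω hΩ r hr => hC (Ω, r) ⟨hΩ, hr⟩⟩

theorem exists_bound_hCurv (hlo : arccot κ₂ < lo) (hhi : hi < arccot κ₁) :
    ∃ C, ∀ r ∈ Icc lo hi, |hCurv κ₁ κ₂ (Real.cos r / Real.sin r)| ≤ C := by
  obtain ⟨C, hC⟩ := (isCompact_Icc (a := lo) (b := hi)).exists_bound_of_continuousOn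
    (f := fun r => hCurv κ₁ κ₂ (Real.cos r / Real.sin r)) (by
      refine (continuousOn_hCurv κ₁ κ₂).comp ?_ fun r hr =>
        cot_mem_curvInterval (hlo.trans_le hr.1) (hr.2.trans_lt hhi)
      exact Real.continuous_cos.continuousOn.div Real.continuous_sin.continuousOn
        fun r hr => (sin_pos_of_mem hlo hhi hr).ne')
  exact ⟨C, fun r hr => hC r hr⟩

/-- The piecewise circular curve with given radii and angles, with constant angular speed. -/
def arcData (hlo : arccot κ₂ < lo) (hhi : hi < arccot κ₁) {d : ℝ} (hd : d ∈ Icc lo hi)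
    {L : List (ℝ × ℝ)} (hr : ∀ p ∈ L, p.1 ∈ Icc lo hi) (hL : ∀ p ∈ L, 0 ≤ p.2)
    (hΩ : 0 < totalAngle L) : FrameData κ₁ κ₂ where
  frame t := stepFrame d L (totalAngle L * t)
  speed t := totalAngle L * Real.sin (stepVal d L (totalAngle L * t))
  curv t := Real.cos (stepVal d L (totalAngle L * t)) / Real.sin (stepVal d L (totalAngle L * t))
  isFrame := by
    convert isFrame_stepFrame d hL hΩ.ne' using 1
    ext t
    have := (sin_pos_of_mem hlo hhi (stepVal_mem hd hr (totalAngle L * t))).ne'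
    field_simp
  speed_pos t := mul_pos hΩ (sin_pos_of_mem hlo hhi (stepVal_mem hd hr _))
  curv_mem t := by
    have h := stepVal_mem hd hr (totalAngle L * t)
    exact cot_mem_curvInterval (hlo.trans_le h.1) (h.2.trans_lt hhi)
  memLp_speed := by
    obtain ⟨C, hC⟩ := exists_bound_hSpeed (Ω₁ := totalAngle L) hlo hhi hΩ
    refine MemLp.of_bound (Measurable.aestronglyMeasurable (measurable_hSpeed.comp
      ((Real.measurable_sin.comp ((measurable_stepVal d L).comp
        (measurable_subtype_coe.const_mul _))).const_mul _))) C (Eventually.of_forall fun s => ?_)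
    exact hC _ ⟨le_rfl, le_rfl⟩ _ (stepVal_mem hd hr _)
  memLp_curv := by
    obtain ⟨C, hC⟩ := exists_bound_hCurv hlo hhi
    have hm : Measurable fun s : unitInterval => stepVal d L (totalAngle L * s) :=
      (measurable_stepVal d L).comp (measurable_subtype_coe.const_mul _)
    refine MemLp.of_bound (Measurable.aestronglyMeasurable ((measurable_hCurv κ₁ κ₂).comp
      ((Real.measurable_cos.comp hm).div (Real.measurable_sin.comp hm)))) C
      (Eventually.of_forall fun s => ?_)
    exact hC _ (stepVal_mem hd hr _)

/-- A continuous family of piecewise circular loops joins circular loops at its ends. -/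
theorem connectedComponent_eq_of_arcs (hκ : κ₁ < κ₂) (hlo : arccot κ₂ < lo)
    (hhi : hi < arccot κ₁) {d : unitInterval → ℝ} (hdc : Continuous d) (hd : ∀ x, d x ∈ Icc lo hi)
    {F : List ((unitInterval → ℝ) × (unitInterval → ℝ))}
    (hFc : ∀ p ∈ F, Continuous p.1 ∧ Continuous p.2) (hr : ∀ p ∈ F, ∀ x, p.1 x ∈ Icc lo hi)
    (hF : ∀ p ∈ F, ∀ x, 0 ≤ p.2 x) (hΩ₀ : 0 < Ω₀)
    (hΩ : ∀ x, totalAngle (evalArcs F x) ∈ Icc Ω₀ Ω₁)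
    (hprod : ∀ x, stepProd (evalArcs F x) = 1) {n m : ℕ} {σ τ : CurvesTo κ₁ κ₂ 1}
    (hσ : IsCircular σ.1 (d 0) n) (hτ : IsCircular τ.1 (d 1) m)
    (h0 : ∀ p ∈ F, p.1 0 = d 0) (h0' : totalAngle (evalArcs F 0) = 2 * Real.pi * n)
    (h1 : ∀ p ∈ F, p.1 1 = d 1) (h1' : totalAngle (evalArcs F 1) = 2 * Real.pi * m) :
    connectedComponent σ = connectedComponent τ := by
  have hr' : ∀ x, ∀ p ∈ evalArcs F x, p.1 ∈ Icc lo hi := fun x p hp => by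
    obtain ⟨q, hq, rfl⟩ := List.mem_map.1 hp
    exact hr q hq x
  have hF' : ∀ x, ∀ p ∈ evalArcs F x, 0 ≤ p.2 := fun x p hp => by
    obtain ⟨q, hq, rfl⟩ := List.mem_map.1 hp
    exact hF q hq x
  have hΩp : ∀ x, 0 < totalAngle (evalArcs F x) := fun x => hΩ₀.trans_le (hΩ x).1
  have hΩc : Continuous fun x => totalAngle (evalArcs F x) := by
    have e : (fun x => totalAngle (evalArcs F x)) = fun x => (F.map fun p => p.2 x).sum := by
      ext x; simp [totalAngle, evalArcs, Function.comp_def]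
    rw [e]
    exact continuous_list_sum F fun p hp => (hFc p hp).2
  let D : unitInterval → FrameData κ₁ κ₂ := fun x =>
    arcData hlo hhi (hd x) (hr' x) (hF' x) (hΩp x)
  have hD0 : ∀ x, (D x).frame 0 = 1 := fun x => by
    simp only [D, arcData]
    rw [mul_zero, stepFrame_zero _ (hF' x)]
  have hD1 : ∀ x, (D x).frame 1 = 1 := fun x => by
    simp only [D, arcData]
    rw [mul_one, stepFrame_totalAngle _ (hF' x), hprod]
  obtain ⟨C, hC⟩ := exists_bound_hSpeed (Ω₁ := Ω₁) hlo hhi hΩ₀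
  obtain ⟨C', hC'⟩ := exists_bound_hCurv hlo hhi
  have hcont : Continuous fun x => (D x).toLoop hκ (hD0 x) (hD1 x) := by
    refine Continuous.subtype_mk (continuous_iff_continuousAt.2 fun x₀ => ?_) _
    have hgen : ∀ᵐ s : unitInterval, Tendsto (fun x => stepVal (d x) (evalArcs F x)
        (totalAngle (evalArcs F x) * s)) (𝓝 x₀)
        (𝓝 (stepVal (d x₀) (evalArcs F x₀) (totalAngle (evalArcs F x₀) * s))) := by
      have hs : {t : ℝ | ¬ IsGeneric (evalArcs F x₀) (totalAngle (evalArcs F x₀) * t)}.Countable :=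
        (countable_not_isGeneric _).preimage_of_injOn (f := fun t => totalAngle (evalArcs F x₀) * t)
          (fun x _ y _ h => mul_left_cancel₀ (hΩp x₀).ne' h)
      have hae : ∀ᵐ s : unitInterval,
          IsGeneric (evalArcs F x₀) (totalAngle (evalArcs F x₀) * s) := by
        refine (ae_unitInterval_iff (p := fun t =>
          IsGeneric (evalArcs F x₀) (totalAngle (evalArcs F x₀) * t))).2 ?_
        filter_upwards [hs.ae_notMem volume] with t ht _ using not_not.1 ht
      filter_upwards [hae] with s h
      exact tendsto_stepVal hdc hFc (hΩc.mul continuous_const) h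
    refine FrameData.tendsto_toCurve hκ (fun i j => by simp only [hD0]; exact tendsto_const_nhds)
      (memLp_const C) (memLp_const C')
      (fun x => Eventually.of_forall fun s => hC _ (hΩ x) _ (stepVal_mem (hd x) (hr' x) _))
      (Eventually.of_forall fun s => hC _ (hΩ x₀) _ (stepVal_mem (hd x₀) (hr' x₀) _))
      (fun x => Eventually.of_forall fun s => hC' _ (stepVal_mem (hd x) (hr' x) _))
      (Eventually.of_forall fun s => hC' _ (stepVal_mem (hd x₀) (hr' x₀) _)) ?_ ?_
    · filter_upwards [hgen] with s h
      exact (hΩc.tendsto x₀).mul ((Real.continuous_sin.tendsto _).comp h)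
    · filter_upwards [hgen] with s h
      exact ((Real.continuous_cos.tendsto _).comp h).div ((Real.continuous_sin.tendsto _).comp h)
        (sin_pos_of_mem hlo hhi (stepVal_mem (hd x₀) (hr' x₀) _)).ne'
  have hcirc : ∀ x (n : ℕ), (∀ p ∈ F, p.1 x = d x) → totalAngle (evalArcs F x) = 2 * Real.pi * n →
      IsCircular ((D x).toLoop hκ (hD0 x) (hD1 x)).1 (d x) n := by
    intro x n hx hn
    have hval : ∀ τ, stepVal (d x) (evalArcs F x) τ = d x := fun τ =>
      stepVal_mem (S := {d x}) rfl (fun p hp => by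
        obtain ⟨q, hq, rfl⟩ := List.mem_map.1 hp
        exact hx q hq) τ
    constructor
    · filter_upwards [FrameData.toCurve_curvature hκ (D x)] with t ht ht'
      refine (ht ht').trans ?_
      simp only [D, arcData, hval]
    · refine (intervalIntegral_congr_Ioo (FrameData.toCurve_speed hκ (D x))).trans ?_
      simp only [D, arcData, hval, intervalIntegral.integral_const, hn]
      simp
  have e0 := connectedComponent_eq_of_isCircular hκ (hlo.trans_le (hd 0).1) ((hd 0).2.trans_lt hhi)
    hσ (hcirc 0 n h0 h0')
  have e1 := connectedComponent_eq_of_isCircular hκ (hlo.trans_le (hd 1).1) ((hd 1).2.trans_lt hhi)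
    hτ (hcirc 1 m h1 h1')
  rw [e0, e1]
  exact connectedComponent_eq_of_path hcont 0 1

end

end

section

/-! ### Adding two turns to a circle -/

variable {κ₁ κ₂ : EReal}

/-- The image of the axis at `θ` under successive half turns about the axes in the list, the last
one being applied first. -/
def reflectAxis : List ℝ → ℝ → ℝ
  | [], θ => θ
  | r :: L, θ => 2 * r - reflectAxis L θ

/-- The list of `n` radii that are alternately `a` and `b`. -/
def alternating (a b : ℝ) : ℕ → List ℝ
  | 0 => []
  | n + 1 => a :: alternating b a n

theorem mem_alternating {a b r : ℝ} {n : ℕ} (h : r ∈ alternating a b n) : r = a ∨ r = b := by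
  induction n generalizing a b with
  | zero => simp [alternating] at h
  | succ n ih =>
    rcases List.mem_cons.1 h with rfl | h
    · exact Or.inl rfl
    · exact (ih h).symm

theorem length_alternating (a b : ℝ) (n : ℕ) : (alternating a b n).length = n := by
  induction n generalizing a b with
  | zero => rfl
  | succ n ih => simp [alternating, ih]

/-- Each half turn of the alternating product moves the axis on by `a - b`. -/
theorem exists_reflectAxis_alternating (a b : ℝ) (n : ℕ) :
    ∃ θ, (θ = a ∨ θ = b) ∧ reflectAxis (alternating a b n) θ = b + (n + 1) * (a - b) := by
  induction n generalizing a b with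
  | zero => exact ⟨a, Or.inl rfl, by simp [reflectAxis, alternating]⟩
  | succ n ih =>
    obtain ⟨θ, hθ, h⟩ := ih b a
    refine ⟨θ, hθ.symm, ?_⟩
    rw [alternating, reflectAxis, h]; push_cast; ring

/-- A rotation conjugated by a sequence of half turns. -/
theorem prod_half_turns (L : List ℝ) (θ ω : ℝ) :
    (L.map fun r => rot r Real.pi).prod * rot θ ω * (L.reverse.map fun r => rot r Real.pi).prod =
      rot (reflectAxis L θ) ω := by
  induction L with
  | nil => simp [reflectAxis]
  | cons r L ih =>
    rw [reflectAxis, ← half_turn_conj, ← ih]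
    simp only [List.map_cons, List.prod_cons, List.reverse_cons, List.map_append, List.map_nil,
      List.prod_append, List.prod_nil, mul_one, mul_assoc]

/-- Moves along the unit interval from `0` to `1`, stays there and moves back to `0`. -/
def plateau (u : unitInterval) : ℝ := min 1 (min (3 * (u : ℝ)) (3 - 3 * u))

/-- An angle that increases from `0` to `2 π` while `plateau` is constant. -/
def spin (u : unitInterval) : ℝ := 2 * Real.pi * max 0 (min 1 (3 * (u : ℝ) - 1))

theorem continuous_plateau : Continuous plateau := by unfold plateau; fun_prop

theorem continuous_spin : Continuous spin := by unfold spin; fun_prop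

theorem plateau_mem (u : unitInterval) : plateau u ∈ Icc (0 : ℝ) 1 :=
  ⟨le_min zero_le_one (le_min (by linarith [u.2.1]) (by linarith [u.2.2])), min_le_left _ _⟩

theorem spin_mem (u : unitInterval) : spin u ∈ Icc (0 : ℝ) (2 * Real.pi) := by
  have h := Real.two_pi_pos
  have h1 : max 0 (min 1 (3 * (u : ℝ) - 1)) ≤ 1 := max_le zero_le_one (min_le_left _ _)
  have h0 : 0 ≤ max 0 (min 1 (3 * (u : ℝ) - 1)) := le_max_left _ _
  exact ⟨mul_nonneg h.le h0, by rw [spin]; nlinarith⟩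

/-- The radii are in place whenever the additional arcs are neither trivial nor full circles. -/
theorem plateau_or_spin (u : unitInterval) : plateau u = 1 ∨ spin u = 0 ∨ spin u = 2 * Real.pi := by
  rcases le_total (3 * (u : ℝ)) 1 with h | h
  · right; left
    rw [spin, max_eq_left ((min_le_right _ _).trans (by linarith)), mul_zero]
  · rcases le_total (3 * (u : ℝ)) 2 with h' | h'
    · left
      exact min_eq_left (le_min h (by linarith))
    · right; right
      rw [spin, min_eq_left (by linarith), max_eq_right zero_le_one, mul_one]

/-- The arcs of the loops that join a circle traversed `k` times to one traversed `k + 2` times.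
The half turns along the list `L` and back cancel. The radii, `e` at the ends, move to prescribed
values; there the two additional arcs of angle `spin` have opposite axes in space, so that they
cancel as well, and may grow to full circles. -/
def bridge (e : unitInterval → ℝ) (L : List ℝ) (θ₀ θ₁ : ℝ) :
    List ((unitInterval → ℝ) × (unitInterval → ℝ)) :=
  let rad : ℝ → unitInterval → ℝ := fun r u => (1 - plateau u) * e u + plateau u * r
  (rad θ₀, spin) :: (L.map fun r => (rad r, fun _ => Real.pi)) ++
    (rad θ₁, spin) :: (L.reverse.map fun r => (rad r, fun _ => Real.pi))

theorem mem_bridge {e : unitInterval → ℝ} {L : List ℝ} {θ₀ θ₁ : ℝ}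
    {p : (unitInterval → ℝ) × (unitInterval → ℝ)} (hp : p ∈ bridge e L θ₀ θ₁) :
    ∃ r, (r = θ₀ ∨ r = θ₁ ∨ r ∈ L) ∧ (p.1 = fun u => (1 - plateau u) * e u + plateau u * r) ∧
      (p.2 = spin ∨ p.2 = fun _ => Real.pi) := by
  simp only [bridge, List.cons_append, List.mem_cons, List.mem_append, List.mem_map,
    List.mem_reverse] at hp
  rcases hp with rfl | ⟨r, hr, rfl⟩ | rfl | ⟨r, hr, rfl⟩
  · exact ⟨θ₀, Or.inl rfl, rfl, Or.inl rfl⟩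
  · exact ⟨r, Or.inr (Or.inr hr), rfl, Or.inr rfl⟩
  · exact ⟨θ₁, Or.inr (Or.inl rfl), rfl, Or.inl rfl⟩
  · exact ⟨r, Or.inr (Or.inr hr), rfl, Or.inr rfl⟩

theorem totalAngle_bridge (e : unitInterval → ℝ) (L : List ℝ) (θ₀ θ₁ : ℝ) (u : unitInterval) :
    totalAngle (evalArcs (bridge e L θ₀ θ₁) u) = 2 * (Real.pi * L.length + spin u) := by
  simp [totalAngle, evalArcs, bridge, Function.comp_def]
  ring

/-- The loops close up. While the additional arcs grow, the radii are the prescribed ones and the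
arcs cancel; at other times they are trivial or full circles. -/
theorem stepProd_bridge (e : unitInterval → ℝ) (L : List ℝ) {θ₀ θ₁ : ℝ}
    (h : reflectAxis L θ₁ = θ₀ + Real.pi) (u : unitInterval) :
    stepProd (evalArcs (bridge e L θ₀ θ₁) u) = 1 := by
  have key : stepProd (evalArcs (bridge e L θ₀ θ₁) u) =
      rot ((1 - plateau u) * e u + plateau u * θ₀) (spin u) *
      rot (reflectAxis (L.map fun r => (1 - plateau u) * e u + plateau u * r)
        ((1 - plateau u) * e u + plateau u * θ₁)) (spin u) := by
    rw [← prod_half_turns]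
    simp [stepProd, evalArcs, bridge, Function.comp_def, List.map_reverse, mul_assoc]
  rw [key]
  rcases plateau_or_spin u with h1 | h1 | h1
  · simp only [h1, sub_self, zero_mul, zero_add, one_mul, List.map_id', h]
    rw [rot_add_pi, rot_mul_neg]
  · rw [h1, rot_zero, rot_zero, one_mul]
  · have e1 : 2 * Real.pi = 2 * Real.pi * (1 : ℕ) := by simp
    rw [h1, e1, rot_two_pi_mul, rot_two_pi_mul, one_mul]

/-- If `π < (k + 1) (ρ₁ - ρ₂)`, then two turns can be added to a circle traversed `k` times. -/
theorem connectedComponent_eq_add_two (hκ : κ₁ < κ₂) {k : ℕ} (hk : 1 ≤ k)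
    (hkδ : Real.pi < (k + 1) * (arccot κ₁ - arccot κ₂)) {ρ ρ' : ℝ} (hρ2 : arccot κ₂ < ρ)
    (hρ1 : ρ < arccot κ₁) (hρ2' : arccot κ₂ < ρ') (hρ1' : ρ' < arccot κ₁)
    {σ τ : CurvesTo κ₁ κ₂ 1} (hσ : IsCircular σ.1 ρ k) (hτ : IsCircular τ.1 ρ' (k + 2)) :
    connectedComponent σ = connectedComponent τ := by
  have hk0 : (0 : ℝ) < k + 1 := by positivity
  have hπ := Real.pi_pos
  have hw : Real.pi / (k + 1) < arccot κ₁ - arccot κ₂ := by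
    rw [div_lt_iff₀ hk0]; linarith
  have hw0 : 0 < Real.pi / (k + 1) := by positivity
  -- two radii between the bounds at distance `π / (k + 1)`
  obtain ⟨a, b, hb, hab, ha, hba⟩ : ∃ a b, arccot κ₂ < b ∧ a - b = Real.pi / (k + 1) ∧
      a < arccot κ₁ ∧ b < a :=
    ⟨arccot κ₂ + (arccot κ₁ - arccot κ₂ - Real.pi / (k + 1)) / 2 + Real.pi / (k + 1),
      arccot κ₂ + (arccot κ₁ - arccot κ₂ - Real.pi / (k + 1)) / 2, by linarith, by ring,
      by linarith, by linarith⟩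
  obtain ⟨θ, hθ, hrefl⟩ := exists_reflectAxis_alternating a b k
  have hrefl' : reflectAxis (alternating a b k) θ = b + Real.pi := by
    rw [hrefl, hab]; field_simp
  set e : unitInterval → ℝ := fun u => (1 - (u : ℝ)) * ρ + u * ρ' with he
  have hec : Continuous e := by rw [he]; fun_prop
  have hconv : ∀ {lo hi x y t : ℝ}, x ∈ Icc lo hi → y ∈ Icc lo hi → t ∈ Icc (0 : ℝ) 1 →
      (1 - t) * x + t * y ∈ Icc lo hi := fun {lo hi x y t} hx hy ht => by
    constructor <;> nlinarith [hx.1, hx.2, hy.1, hy.2, ht.1, ht.2]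
  have hρm : ρ ∈ Icc (min b (min ρ ρ')) (max a (max ρ ρ')) :=
    ⟨(min_le_right _ _).trans (min_le_left _ _), (le_max_left _ _).trans (le_max_right _ _)⟩
  have hρm' : ρ' ∈ Icc (min b (min ρ ρ')) (max a (max ρ ρ')) :=
    ⟨(min_le_right _ _).trans (min_le_right _ _), (le_max_right _ _).trans (le_max_right _ _)⟩
  have ham : a ∈ Icc (min b (min ρ ρ')) (max a (max ρ ρ')) :=
    ⟨(min_le_left _ _).trans hba.le, le_max_left _ _⟩
  have hbm : b ∈ Icc (min b (min ρ ρ')) (max a (max ρ ρ')) :=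
    ⟨min_le_left _ _, hba.le.trans (le_max_left _ _)⟩
  have hem : ∀ u, e u ∈ Icc (min b (min ρ ρ')) (max a (max ρ ρ')) := fun u => hconv hρm hρm' u.2
  have hrm : ∀ p ∈ bridge e (alternating a b k) b θ, ∀ u,
      p.1 u ∈ Icc (min b (min ρ ρ')) (max a (max ρ ρ')) := by
    intro p hp u
    obtain ⟨r, hr, h1, -⟩ := mem_bridge hp
    rw [h1]
    refine hconv (hem u) ?_ (plateau_mem u)
    have hr' : r = a ∨ r = b := by
      rcases hr with rfl | rfl | hr
      · exact Or.inr rfl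
      · exact hθ
      · exact mem_alternating hr
    rcases hr' with rfl | rfl
    exacts [ham, hbm]
  have p0 : plateau 0 = 0 := by simp [plateau]
  have p1 : plateau 1 = 0 := by simp [plateau]
  have s0 : spin 0 = 0 := by simp [spin]
  have s1 : spin 1 = 2 * Real.pi := by
    rw [spin]; norm_num
  have hk' : (1 : ℝ) ≤ k := by exact_mod_cast hk
  have e0 : e 0 = ρ := by simp [he]
  have e1 : e 1 = ρ' := by simp [he]
  -- the rescaled loops are admissible: all radii stay between the least and the largest in use
  refine connectedComponent_eq_of_arcs hκ (lt_min hb (lt_min hρ2 hρ2'))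
    (max_lt ha (max_lt hρ1 hρ1')) hec hem (F := bridge e (alternating a b k) b θ)
    (Ω₀ := 2 * Real.pi) (Ω₁ := 2 * (Real.pi * k + 2 * Real.pi)) ?_ hrm ?_ Real.two_pi_pos ?_
    (stepProd_bridge e _ hrefl') (n := k) (m := k + 2) (by rwa [e0]) (by rwa [e1]) ?_ ?_ ?_ ?_
  · intro p hp
    obtain ⟨r, -, h1, h2⟩ := mem_bridge hp
    rw [h1]
    refine ⟨((continuous_const.sub continuous_plateau).mul hec).add
      (continuous_plateau.mul continuous_const), ?_⟩
    rcases h2 with h2 | h2 <;> rw [h2]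
    exacts [continuous_spin, continuous_const]
  · intro p hp u
    obtain ⟨r, -, -, h2⟩ := mem_bridge hp
    rcases h2 with h2 | h2 <;> rw [h2]
    exacts [(spin_mem u).1, hπ.le]
  · intro u
    rw [totalAngle_bridge, length_alternating]
    constructor
    · nlinarith [(spin_mem u).1]
    · linarith [(spin_mem u).2]
  · intro p hp
    obtain ⟨r, -, h1, -⟩ := mem_bridge hp
    rw [h1]; simp [p0]
  · rw [totalAngle_bridge, length_alternating, s0]; ring
  · intro p hp
    obtain ⟨r, -, h1, -⟩ := mem_bridge hp
    rw [h1]; simp [p1]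
  · rw [totalAngle_bridge, length_alternating, s1]; push_cast; ring

/-! ### Closed curves with arbitrary initial frame -/

theorem exists_angle {x y : ℝ} : ∃ a, x = √(x ^ 2 + y ^ 2) * Real.cos a ∧
    y = √(x ^ 2 + y ^ 2) * Real.sin a := by
  refine ⟨Complex.arg ⟨x, y⟩, ?_, ?_⟩
  · have := Complex.norm_mul_cos_arg ⟨x, y⟩
    rw [Complex.norm_eq_sqrt_sq_add_sq] at this
    exact this.symm
  · have := Complex.norm_mul_sin_arg ⟨x, y⟩
    rw [Complex.norm_eq_sqrt_sq_add_sq] at this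
    exact this.symm

/-- Euler angles. -/
theorem exists_euler_angles {M : Matrix (Fin 3) (Fin 3) ℝ}
    (hM : M ∈ Matrix.specialOrthogonalGroup (Fin 3) ℝ) :
    ∃ a b c, M = rot 0 a * rot (Real.pi / 2) b * rot 0 c := by
  have hM' := (so3_entries hM).2.1 0 0
  simp only [Fin.sum_univ_three, if_true] at hM'
  obtain ⟨a, ha1, ha2⟩ := exists_angle (x := M 1 0) (y := M 2 0)
  obtain ⟨b, hb1, hb2⟩ := exists_angle (x := M 0 0) (y := √(M 1 0 ^ 2 + M 2 0 ^ 2))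
  have hone : √(M 0 0 ^ 2 + √(M 1 0 ^ 2 + M 2 0 ^ 2) ^ 2) = 1 := by
    rw [Real.sq_sqrt (by positivity), Real.sqrt_eq_one]; linarith
  rw [hone, one_mul] at hb1 hb2
  rw [hb2] at ha1 ha2
  have hT := mul_mem (rot_mem 0 a) (rot_mem (Real.pi / 2) b)
  obtain ⟨hT1, hT2⟩ := mem_so3_iff.1 hT
  have hT3 := mul_eq_one_comm.1 hT1
  set T := rot 0 a * rot (Real.pi / 2) b with hTdef
  have hN : T.transpose * M ∈ Matrix.specialOrthogonalGroup (Fin 3) ℝ := by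
    refine mul_mem (mem_so3_iff.2 ⟨?_, ?_⟩) hM
    · rw [Matrix.transpose_transpose, hT3]
    · rw [Matrix.det_transpose, hT2]
  have hcol : ∀ i, T i 0 = M i 0 := by
    intro i
    fin_cases i <;> simp [hTdef, rot, Matrix.mul_apply, Fin.sum_univ_three]
    · linarith
    · linarith
    · linarith
  have hN0 : ∀ i, (T.transpose * M) i 0 = if i = 0 then 1 else 0 := by
    intro i
    have := congrFun (congrFun hT3 i) 0
    rw [Matrix.mul_apply] at this ⊢
    simp only [← hcol]
    rw [this, Matrix.one_apply]
  have hMT : M = T * (T.transpose * M) := by rw [← Matrix.mul_assoc, hT1, Matrix.one_mul]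
  obtain ⟨-, hdet⟩ := mem_so3_iff.1 hN
  obtain ⟨hr, hc, hd, -⟩ := so3_entries hN
  generalize T.transpose * M = N at *
  have n0 := hN0 0
  have n1 := hN0 1
  have n2 := hN0 2
  simp at n0 n1 n2
  have r0 := hr 0 0
  have c1 := hc 1 1
  have c12 := hc 1 2
  simp [Fin.sum_univ_three, n0] at r0 c1 c12
  have h01 : N 0 1 = 0 := by nlinarith [mul_self_nonneg (N 0 1), mul_self_nonneg (N 0 2)]
  have h02 : N 0 2 = 0 := by nlinarith [mul_self_nonneg (N 0 1), mul_self_nonneg (N 0 2)]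
  rw [h01] at c1 c12
  obtain ⟨c, hc1, hc2⟩ := exists_angle (x := N 1 1) (y := N 2 1)
  have hone' : √(N 1 1 ^ 2 + N 2 1 ^ 2) = 1 := by rw [Real.sqrt_eq_one]; linarith
  rw [hone', one_mul] at hc1 hc2
  have h22 : N 2 2 = N 1 1 := by rw [← hd, n0, n1]; ring
  rw [Matrix.det_fin_three, n0, n1, n2, h01, h02] at hdet
  have h12 : N 1 2 = -N 2 1 := by
    rw [h22] at hdet c12
    linear_combination N 1 1 * c12 - N 2 1 * hdet - N 1 2 * c1
  refine ⟨a, b, c, ?_⟩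
  rw [hMT]
  congr 1
  ext i j
  fin_cases i <;> fin_cases j <;> simp [rot, n0, n1, n2, h01, h02, h12, h22, ← hc1, ← hc2]

/-- Euler angles parametrize the rotation group by a connected space. -/
theorem preconnectedSpace_so3 : PreconnectedSpace SO3 := by
  let f : ℝ × ℝ × ℝ → SO3 := fun p =>
    ⟨rot 0 p.1 * rot (Real.pi / 2) p.2.1 * rot 0 p.2.2,
      mul_mem (mul_mem (rot_mem _ _) (rot_mem _ _)) (rot_mem _ _)⟩
  have hr : ∀ r, Continuous fun α => rot r α := fun r =>
    continuous_matrix fun i j => continuous_rot r i j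
  have hf : Continuous f := by
    refine Continuous.subtype_mk ?_ _
    exact (((hr 0).comp continuous_fst).mul ((hr _).comp (continuous_fst.comp continuous_snd))).mul
      ((hr 0).comp (continuous_snd.comp continuous_snd))
  have hsurj : Function.Surjective f := fun M => by
    obtain ⟨a, b, c, h⟩ := exists_euler_angles M.2
    exact ⟨(a, b, c), Subtype.ext h.symm⟩
  exact ⟨by rw [← hsurj.range_eq]; exact isPreconnected_range hf⟩

/-- Loops at the identity are closed curves. -/
def inclusion (γ : CurvesTo κ₁ κ₂ 1) : ClosedCurves κ₁ κ₂ := ⟨γ.1, γ.2.1.trans γ.2.2.symm⟩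

theorem continuous_inclusion : Continuous (inclusion : CurvesTo κ₁ κ₂ 1 → ClosedCurves κ₁ κ₂) :=
  Continuous.subtype_mk continuous_subtype_val _

/-- The frame data of a rotated curve. -/
def AdmissibleCurve.rotate (hκ : κ₁ < κ₂) (γ : AdmissibleCurve κ₁ κ₂) (Q : SO3) :
    FrameData κ₁ κ₂ where
  frame t := Q * γ.frameMatrix t
  speed := γ.speed
  curv := γ.curvature
  isFrame := (γ.isFrame hκ).mul_left Q.2
  speed_pos := γ.speed_pos
  curv_mem t := hCurvInv_mem hκ _
  memLp_speed := by simp only [hSpeed_speed]; exact Lp.memLp _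
  memLp_curv := by simp only [hCurv_curvature hκ]; exact Lp.memLp _

/-- A closed curve lies in the component of a rotated curve starting at the identity. -/
theorem exists_rotate_eq (hκ : κ₁ < κ₂) (γ : ClosedCurves κ₁ κ₂) : ∃ γ' : CurvesTo κ₁ κ₂ 1,
    (∀ ρ k, IsCircular γ.1 ρ k → IsCircular γ'.1 ρ k) ∧
    connectedComponent γ = connectedComponent (inclusion γ') := by
  have := preconnectedSpace_so3
  let f : SO3 → ClosedCurves κ₁ κ₂ := fun Q => ⟨(γ.1.rotate hκ Q).toCurve hκ, Subtype.ext (by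
    have := γ.closed
    simp [FrameData.toCurve, AdmissibleCurve.rotate, this])⟩
  have hf : Continuous f := by
    refine Continuous.subtype_mk (continuous_induced_rng.2 ?_) _
    refine Continuous.prodMk ?_ (continuous_const (y := (((γ.1.rotate hκ 1).memLp_speed.toLp :
      L2I), ((γ.1.rotate hκ 1).memLp_curv.toLp : L2I))))
    refine Continuous.subtype_mk ?_ _
    exact continuous_subtype_val.mul continuous_const
  have hcomp : ∀ Q Q', connectedComponent (f Q) = connectedComponent (f Q') := fun Q Q' =>
    connectedComponent_eq ((isPreconnected_range hf).subset_connectedComponent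
      (mem_range_self Q) (mem_range_self Q'))
  have hf1 : f 1 = γ := Subtype.ext (FrameData.toCurve_eq hκ _ _
    (by
      have e0 : γ.1.frameMatrix 0 = γ.1.frame 0 := γ.1.frameMatrix_coe 0
      simp [AdmissibleCurve.rotate, e0])
    (Eventually.of_forall fun s => rfl) (Eventually.of_forall fun s => rfl))
  have hinv : ((γ.1.frame 0)⁻¹ : SO3).1 * γ.1.frameMatrix 0 = 1 := by
    have e0 : γ.1.frameMatrix 0 = γ.1.frame 0 := γ.1.frameMatrix_coe 0
    rw [e0]
    exact congrArg Subtype.val (inv_mul_cancel (γ.1.frame 0))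
  refine ⟨(γ.1.rotate hκ (γ.1.frame 0)⁻¹).toLoop hκ hinv ?_, ?_, ?_⟩
  · have := hinv
    rw [γ.closed] at this
    exact this
  · rintro ρ k ⟨h1, h2⟩
    constructor
    · filter_upwards [h1, FrameData.toCurve_curvature hκ (γ.1.rotate hκ (γ.1.frame 0)⁻¹)] with t a b ht
      exact (b ht).trans (a ht)
    · rw [← h2]
      exact intervalIntegral_congr_Ioo (FrameData.toCurve_speed hκ (γ.1.rotate hκ (γ.1.frame 0)⁻¹))
  · exact (congrArg connectedComponent hf1.symm).trans (hcomp 1 (γ.1.frame 0)⁻¹)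

end

/-! ### Circles traversed `k` and `k + 2` times -/

theorem floor_le_iff {κ₁ κ₂ : EReal} (hκ : κ₁ < κ₂) (k : ℕ) :
    ⌊Real.pi / (arccot κ₁ - arccot κ₂)⌋ ≤ (k : ℤ) ↔
      Real.pi < (k + 1) * (arccot κ₁ - arccot κ₂) := by
  have hpos : 0 < arccot κ₁ - arccot κ₂ := sub_pos.2 (arccot_strictAnti hκ)
  rw [← Int.lt_add_one_iff, Int.floor_lt, div_lt_iff₀ hpos]
  push_cast
  rfl

theorem isCircular_of_circle {κ₁ κ₂ : EReal} (hκ : κ₁ < κ₂) (γ : AdmissibleCurve κ₁ κ₂) {k : ℕ}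
    (h : IsCircleTraversed k γ.curve) :
    ∃ ρ, arccot κ₂ < ρ ∧ ρ < arccot κ₁ ∧ IsCircular γ ρ k := by
  obtain ⟨ρ, h2, h1, hc, hI, -⟩ := exists_circle_data hκ γ h
  exact ⟨ρ, h2, h1, hc, hI⟩

end SphereCurves

end

theorem theoremD (κ₁ κ₂ : EReal) (hκ : κ₁ < κ₂) (k : ℕ) (hk : 1 ≤ k) :
    (∀ σ τ : SphereCurves.CurvesTo κ₁ κ₂ 1,
      SphereCurves.IsCircleTraversed k σ.1.curve →
      SphereCurves.IsCircleTraversed (k + 2) τ.1.curve →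
      (connectedComponent σ = connectedComponent τ ↔
        ⌊Real.pi / (SphereCurves.arccot κ₁ - SphereCurves.arccot κ₂)⌋ ≤ (k : ℤ))) ∧
    (∀ σ τ : SphereCurves.ClosedCurves κ₁ κ₂,
      SphereCurves.IsCircleTraversed k σ.1.curve →
      SphereCurves.IsCircleTraversed (k + 2) τ.1.curve →
      (connectedComponent σ = connectedComponent τ ↔
        ⌊Real.pi / (SphereCurves.arccot κ₁ - SphereCurves.arccot κ₂)⌋ ≤ (k : ℤ))) := by
  refine ⟨fun σ τ hσ hτ => ?_, fun σ τ hσ hτ => ?_⟩ <;> rw [SphereCurves.floor_le_iff hκ] <;>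
    refine ⟨fun h => ?_, fun h => ?_⟩
  · by_contra! hc
    exact SphereCurves.connectedComponent_ne_of_circle hκ hk hc
      SphereCurves.continuous_inclusion hσ hτ h
  · obtain ⟨ρ, h2, h1, hρ⟩ := SphereCurves.isCircular_of_circle hκ σ.1 hσ
    obtain ⟨ρ', h2', h1', hρ'⟩ := SphereCurves.isCircular_of_circle hκ τ.1 hτ
    exact SphereCurves.connectedComponent_eq_add_two hκ hk h h2 h1 h2' h1' hρ hρ'
  · by_contra! hc
    exact SphereCurves.connectedComponent_ne_of_circle hκ hk hc continuous_id hσ hτ h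
  · obtain ⟨ρ, h2, h1, hρ⟩ := SphereCurves.isCircular_of_circle hκ σ.1 hσ
    obtain ⟨ρ', h2', h1', hρ'⟩ := SphereCurves.isCircular_of_circle hκ τ.1 hτ
    obtain ⟨σ', hσ', eσ⟩ := SphereCurves.exists_rotate_eq hκ σ
    obtain ⟨τ', hτ', eτ⟩ := SphereCurves.exists_rotate_eq hκ τ
    have he := SphereCurves.connectedComponent_eq_add_two hκ hk h h2 h1 h2' h1' (hσ' _ _ hρ)
      (hτ' _ _ hρ')
    rw [eσ, eτ]
    have hm : τ' ∈ connectedComponent σ' := by rw [he]; exact mem_connectedComponent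
    exact connectedComponent_eq (SphereCurves.continuous_inclusion.image_connectedComponent_subset
      σ' ⟨τ', hm, rfl⟩)
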